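/- Let $E_0\in\mathbb R$, $J\subseteq\mathbb N$, let $(u_j)_{j\in J}$ be distinct positive numbers and $(h_j)_{j\in J}$ positive numbers with $\sum_{j\in J}h_j<\infty$. For $I\subseteq J$ let $$\Pi(I)=\{u+iv: u>0,\ v>0\}\setminus\bigcup_{j\in I}\{u_j+iv: 0<v\le h_j\}.$$ Let $\{J_N\}_{N\in\mathbb N}$ be an increasing sequence of finite sets with $\bigcup_N J_N=J$, and put $\Pi=\Pi(J)$, $\Pi_N=\Pi(J_N)$. Let $\Theta$ and $\Theta_N$ be conformal maps of the upper half-plane $\mathbb C_+$ onto $\Pi$ and $\Pi_N$, respectively, both normalized, in the sense of boundary values, by $E_0\mapsto 0$, $-\infty\mapsto i\infty$, and $z^{1/2}[1+o(1)]$ as $z\to-\infty$ (where $z^{1/2}=i|z|^{1/2}$ for $z<0$). For $j\in J$, let $a_j$ and $b_j$ be the infimum and the supremum of the set of those $x\in\mathbb R$ at which $\Theta$ has a boundary value in the slit $\{u_j+iv:0<v\le h_j\}$. Let $\phi_N=\Theta_N^{-1}\circ\Theta:\mathbb C_+\to\mathbb C_+$. Then, for each $j\in J$, $a_j<b_j$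 and the boundary pre-image of the $j$-th slit under $\Theta$ is the bounded open interval $(a_j,b_j)$. For every $N$ and every $j\in J_N$ the map $\phi_N$ has real boundary values $\phi_N(a_j)$ and $\phi_N(b_j)$ (limits as $z\to a_j$, resp. $z\to b_j$, $z\in\mathbb C_+$), and $$\phi_N(b_j)-\phi_N(a_j)\ge b_j-a_j\quad\text{for all } j\in J_N,$$ $$\sum_{j\in J_N}[\phi_N(b_j)-\phi_N(a_j)]\le\sum_{j\in J}(b_j-a_j).$$ Moreover, for every $N$ and every $M\in\mathbb N$ such that $\{j\in J: j<M\}\subseteq J_N$ (in particular for $M=N$ if $\{j\in J: j<N\}\subseteq J_N$), $$\sum_{j\in J_N,\ j\ge M}[\phi_N(b_j)-\phi_N(a_j)]\le\sum_{j\in J,\ j\ge M}(b_j-a_j).$$ The sums on the right are sums of positive terms with values in $[0,\infty]$. -/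

import Mathlib

open Set Filter Topology Asymptotics

noncomputable section

/-- The open upper half-plane `ℂ₊`, as a subset of `ℂ`. -/
local notation "ℂ₊" => UpperHalfPlane.upperHalfPlaneSet

/-- The vertical slit `{s + i v : 0 < v ≤ t}`. -/
def slit (s t : ℝ) : Set ℂ := {w | w.re = s ∧ 0 < w.im ∧ w.im ≤ t}

/-- The comb domain: the open first quadrant with the slits `{u j + i v : 0 < v ≤ h j}`, `j ∈ I`,
removed. -/
def combDomain (I : Set ℕ) (u h : ℕ → ℝ) : Set ℂ :=
  {w | 0 < w.re ∧ 0 < w.im} \ ⋃ j ∈ I, slit (u j) (h j)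

/-- `Θ` restricts to a conformal map of `ℂ₊` onto `Ω`, normalized by `E₀ ↦ 0`, `-∞ ↦ i∞` and
`Θ(x) = x ^ (1/2) (1 + o(1))` as `x → -∞`, where `Θ(x)`, `x` real, is the boundary value of `Θ`
and `x ^ (1/2) = i |x| ^ (1/2)` for `x < 0` (so that the last condition contains `-∞ ↦ i∞`).
The values of `Θ` off `ℂ₊` play no role. -/
structure IsNormalizedConformalMap (E₀ : ℝ) (Ω : Set ℂ) (Θ : ℂ → ℂ) : Prop where
  differentiableOn : DifferentiableOn ℂ Θ ℂ₊
  bijOn : BijOn Θ ℂ₊ Ω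
  tendsto_zero : Tendsto Θ (𝓝[ℂ₊] (E₀ : ℂ)) (𝓝 0)
  asymptotic : ∃ g : ℝ → ℂ, (∀ᶠ x : ℝ in atBot, Tendsto Θ (𝓝[ℂ₊] (x : ℂ)) (𝓝 (g x))) ∧
    g ~[atBot] fun x : ℝ => (x : ℂ) ^ (1 / 2 : ℂ)

/-- The set of real points that `Θ` maps, in the sense of boundary values from `ℂ₊`, into the slit
`{s + i v : 0 < v ≤ t}`. -/
def slitPreimage (Θ : ℂ → ℂ) (s t : ℝ) : Set ℝ :=
  {x | ∃ w ∈ slit s t, Tendsto Θ (𝓝[ℂ₊] (x : ℂ)) (𝓝 w)}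

/-- The left endpoint of the gap corresponding to the slit `{s + i v : 0 < v ≤ t}`. -/
def gapLeft (Θ : ℂ → ℂ) (s t : ℝ) : ℝ := sInf (slitPreimage Θ s t)

/-- The right endpoint of the gap corresponding to the slit `{s + i v : 0 < v ≤ t}`. -/
def gapRight (Θ : ℂ → ℂ) (s t : ℝ) : ℝ := sSup (slitPreimage Θ s t)

/-- The map `Θ'⁻¹ ∘ Θ`, where `Θ'⁻¹` is the inverse of `Θ'` on `ℂ₊`. -/
def comparisonMap (Θ' Θ : ℂ → ℂ) : ℂ → ℂ := fun z => Function.invFunOn Θ' ℂ₊ (Θ z)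

/-- `φ` has the real boundary value `y` at the real point `x`. -/
def HasRealBoundaryValue (φ : ℂ → ℂ) (x y : ℝ) : Prop :=
  Tendsto φ (𝓝[ℂ₊] (x : ℂ)) (𝓝 (y : ℂ))

end

/-!
Write `Ω = Π` and `Ω' = Π_N ⊇ Π`, let `Θ`, `Θ'` be the normalized conformal maps onto them and
`φ = Θ'⁻¹ ∘ Θ`, a holomorphic self-map of the upper half-plane.

*Boundary behaviour.* By the length-area argument (`exists_semicircle_image_small`), small
half-circles around a real point have images of small diameter. As the heights of the slits tend to
zero, a comb domain is locally connected at its boundary, and `Θ` extends continuously to the closed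
half-plane and tends to infinity at infinity (`IsConformalOnto.isProper`); the normalization at `-∞`
enters here. The extension attains every boundary point, and the points of a slit are attained
exactly on an open interval, the gap (`IsComb.slitPreimage_eq_Ioo`). The map `φ` has a continuous
extension too (`exists_tendsto_comparisonMap`): two cluster values at a real point would force `Θ'`
to be constant on an interval. The extension is real wherever the boundary value of `Θ` lies outside
`Ω'`, in particular on the gaps of the slits of `Ω'`, and it maps these gaps of `Θ` into the
corresponding gaps of `Θ'`.

*Infinity.* The normalization gives `φ(x) / x → 1` as `x → -∞`. By Lindelöf's theorem
(`tendsto_div_imaginary_axis`) the limit is the same along the imaginary axis, and then Julia's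
lemma (`im_le_im_of_tendsto_div`) yields `Im φ(z) ≥ Im z`.

*Lower bound.* The function `φ(z) - z` has a nonnegative imaginary part, and it is real on a gap
`(a, b)` of a slit of `Ω'`. So it is nondecreasing there, which is `b - a ≤ φ(b) - φ(a)`
(`gap_length_le`).

*Upper bound.* Let `A` be a set of slits of `Ω'`, and let `G` consist of `A` and at least all slits
of `Ω` that are missing in `Ω'`. Off the gaps of `Θ` for `G`, the map `φ` has real boundary values
outside the gaps of `Θ'` for `A`. By the maximum principle, the harmonic measure of the gaps of `Θ'`
for `A` at `φ(z)` is at most the harmonic measure of the gaps of `Θ` for `G` at `z`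
(`exists_sum_viewAngle_comp_le`). At `z = i y`, with `y → ∞`, harmonic measures are asymptotic to
lengths divided by `π y`; hence the total length of the former gaps is at most that of the latter
(`sum_gap_length_le`). The intervals `(φ(a), φ(b))` are contained in the former gaps.
-/

local notation "ℂ₊" => UpperHalfPlane.upperHalfPlaneSet

/-! ### Functions on the upper half-plane -/

lemma mem_upperHalfPlaneSet_iff {z : ℂ} : z ∈ ℂ₊ ↔ 0 < z.im := Iff.rfl

lemma isOpen_halfPlane : IsOpen ℂ₊ := UpperHalfPlane.isOpen_upperHalfPlaneSet

lemma convex_halfPlane : Convex ℝ ℂ₊ := convex_halfSpace_im_gt 0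

lemma closure_halfPlane : closure ℂ₊ = {z : ℂ | 0 ≤ z.im} := by
  have := Complex.closure_setOfPred_lt_im 0
  exact this

lemma nhdsWithin_halfPlane_neBot {z : ℂ} (hz : 0 ≤ z.im) : (𝓝[ℂ₊] z).NeBot := by
  rw [← mem_closure_iff_nhdsWithin_neBot, closure_halfPlane]
  exact hz

instance nhdsWithin_halfPlane_ofReal_neBot (x : ℝ) : (𝓝[ℂ₊] (x : ℂ)).NeBot :=
  nhdsWithin_halfPlane_neBot (by simp)

/-- A function continuous on a disc and holomorphic off the real axis is holomorphic. -/
theorem differentiableOn_ball_of_off_real {f : ℂ → ℂ} {c : ℂ} {r : ℝ}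
    (hc : ContinuousOn f (Metric.ball c r))
    (hd : ∀ z ∈ Metric.ball c r, z.im ≠ 0 → DifferentiableAt ℂ f z) :
    DifferentiableOn ℂ f (Metric.ball c r) := by
  refine (Complex.IsConservativeOn.isExactOn_ball hc ?_).differentiableOn Metric.isOpen_ball
  intro z w hzw
  rw [← add_eq_zero_iff_eq_neg, Complex.wedgeIntegral_add_wedgeIntegral_eq]
  have key : ∀ z w : ℂ, Complex.Rectangle z w ⊆ Metric.ball c r →
      (0 : ℝ) ∉ Ioo (min z.im w.im) (max z.im w.im) →
      (∫ x : ℝ in z.re..w.re, f (x + z.im * Complex.I)) -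
      (∫ x : ℝ in z.re..w.re, f (x + w.im * Complex.I)) +
      Complex.I • (∫ y : ℝ in z.im..w.im, f (w.re + y * Complex.I)) -
      Complex.I • (∫ y : ℝ in z.im..w.im, f (z.re + y * Complex.I)) = 0 := by
    intro z w hzw h0
    refine Complex.integral_boundary_rect_eq_zero_of_continuousOn_of_differentiableOn f z w
      (hc.mono hzw) fun x hx => (hd x (hzw ?_) ?_).differentiableWithinAt
    · exact ⟨Ioo_subset_Icc_self hx.1, Ioo_subset_Icc_self hx.2⟩
    · intro h
      exact h0 (h ▸ hx.2)
  by_cases h0 : (0 : ℝ) ∈ Ioo (min z.im w.im) (max z.im w.im)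
  swap
  · exact key z w hzw h0
  have h0' : (0 : ℝ) ∈ uIcc z.im w.im := Ioo_subset_Icc_self h0
  have sub1 : Complex.Rectangle z ⟨w.re, 0⟩ ⊆ Metric.ball c r := by
    refine Subset.trans ?_ hzw
    intro x hx
    exact ⟨hx.1, uIcc_subset_uIcc_left h0' hx.2⟩
  have sub2 : Complex.Rectangle ⟨z.re, 0⟩ w ⊆ Metric.ball c r := by
    refine Subset.trans ?_ hzw
    intro x hx
    exact ⟨hx.1, uIcc_subset_uIcc_right h0' hx.2⟩
  have k1 := key z ⟨w.re, 0⟩ sub1 (by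
    simp only [mem_Ioo, not_and, not_lt]
    intro h
    rcases min_lt_iff.1 h with h | h
    · exact (max_le_iff.2 ⟨h.le, le_rfl⟩)
    · exact absurd h (lt_irrefl _))
  have k2 := key ⟨z.re, 0⟩ w sub2 (by
    simp only [mem_Ioo, not_and, not_lt]
    intro h
    rcases min_lt_iff.1 h with h | h
    · exact absurd h (lt_irrefl _)
    · exact (max_le_iff.2 ⟨le_rfl, h.le⟩))
  have vert : ∀ a ∈ uIcc z.re w.re, ∀ s ∈ uIcc z.im w.im, ∀ t ∈ uIcc z.im w.im,
      IntervalIntegrable (fun y : ℝ => f (a + y * Complex.I)) MeasureTheory.volume s t := by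
    intro a ha s hs t ht
    apply ContinuousOn.intervalIntegrable
    refine hc.comp (by fun_prop) ?_
    intro y hy
    apply hzw
    refine ⟨by simpa using ha, ?_⟩
    simpa using uIcc_subset_uIcc hs ht hy
  have v1 := intervalIntegral.integral_add_adjacent_intervals
    (vert w.re right_mem_uIcc z.im left_mem_uIcc 0 h0')
    (vert w.re right_mem_uIcc 0 h0' w.im right_mem_uIcc)
  have v2 := intervalIntegral.integral_add_adjacent_intervals
    (vert z.re left_mem_uIcc z.im left_mem_uIcc 0 h0')
    (vert z.re left_mem_uIcc 0 h0' w.im right_mem_uIcc)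
  rw [← v1, ← v2]
  simp only [smul_add] at k1 k2 ⊢
  linear_combination k1 + k2

/-- **Schwarz reflection principle**, local form: a holomorphic function on the upper half-plane
with real boundary values `g` on an interval continues holomorphically across that interval. -/
theorem exists_reflection {f : ℂ → ℂ} (hf : DifferentiableOn ℂ f ℂ₊) {α β : ℝ} {g : ℝ → ℝ}
    (hlim : ∀ x ∈ Ioo α β, Tendsto f (𝓝[ℂ₊] (x : ℂ)) (𝓝 (g x : ℂ))) {x₀ : ℝ}
    (hx₀ : x₀ ∈ Ioo α β) :
    ∃ r > 0, ∃ G : ℂ → ℂ, DifferentiableOn ℂ G (Metric.ball (x₀ : ℂ) r) ∧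
      (∀ z ∈ Metric.ball (x₀ : ℂ) r, 0 < z.im → G z = f z) ∧
      ∀ x : ℝ, (x : ℂ) ∈ Metric.ball (x₀ : ℂ) r → x ∈ Ioo α β ∧ G x = g x := by
  classical
  set r := min (x₀ - α) (β - x₀) with hr
  have hr0 : 0 < r := lt_min (by linarith [hx₀.1]) (by linarith [hx₀.2])
  have hre : ∀ z ∈ Metric.ball (x₀ : ℂ) r, z.re ∈ Ioo α β := by
    intro z hz
    have h1 : |z.re - x₀| < r := by
      have := Complex.abs_re_le_norm (z - x₀)
      rw [mem_ball_iff_norm] at hz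
      simp at this
      exact this.trans_lt hz
    have h2 := abs_lt.1 h1
    constructor
    · have := min_le_left (x₀ - α) (β - x₀); linarith
    · have := min_le_right (x₀ - α) (β - x₀); linarith
  set fh := extendFrom ℂ₊ f with hfh
  have hcont : ContinuousOn fh (Metric.ball (x₀ : ℂ) r ∩ {z | 0 ≤ z.im}) := by
    apply continuousOn_extendFrom
    · rw [closure_halfPlane]; exact inter_subset_right
    · rintro z ⟨hz, hz0⟩
      rcases (show 0 ≤ z.im from hz0).lt_or_eq with h | h
      · exact ⟨f z, (hf z h).continuousWithinAt⟩
      · refine ⟨g z.re, ?_⟩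
        have : z = (z.re : ℂ) := Complex.ext (by simp) (by simp [← h])
        rw [this]
        simpa using hlim z.re (hre z hz)
  have hfh_real : ∀ x ∈ Ioo α β, fh (x : ℂ) = g x := fun x hx =>
    extendFrom_eq (by rw [closure_halfPlane]; simp) (hlim x hx)
  have hfh_im : ∀ z ∈ ℂ₊, fh z = f z := fun z hz =>
    extendFrom_eq (subset_closure hz) (hf z hz).continuousWithinAt
  set G : ℂ → ℂ := fun z => if 0 ≤ z.im then fh z else starRingEnd ℂ (fh (starRingEnd ℂ z)) with hG
  have hball_conj : ∀ z ∈ Metric.ball (x₀ : ℂ) r, starRingEnd ℂ z ∈ Metric.ball (x₀ : ℂ) r := by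
    intro z hz
    rw [mem_ball_iff_norm] at hz ⊢
    have : starRingEnd ℂ z - x₀ = starRingEnd ℂ (z - x₀) := by simp
    rwa [this, RCLike.norm_conj]
  have hGup : ∀ z ∈ Metric.ball (x₀ : ℂ) r, 0 < z.im → G z = f z := by
    intro z _ hz
    simp [hG, hz.le, hfh_im z hz]
  have hfront : frontier {z : ℂ | 0 ≤ z.im} = {z | z.im = 0} := Complex.frontier_setOfPred_le_im 0
  have hGc : ContinuousOn G (Metric.ball (x₀ : ℂ) r) := by
    apply ContinuousOn.if
    · rintro z ⟨hz, hz'⟩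
      rw [hfront] at hz'
      have hz0 : z.im = 0 := hz'
      have : z = (z.re : ℂ) := Complex.ext (by simp) (by simp [hz0])
      rw [this, Complex.conj_ofReal, hfh_real _ (hre z hz), Complex.conj_ofReal]
    · rw [IsClosed.closure_eq (isClosed_le continuous_const Complex.continuous_im)]
      exact hcont
    · have hcl : closure {z : ℂ | ¬ 0 ≤ z.im} = {z | z.im ≤ 0} := by
        simp only [not_le]
        exact Complex.closure_setOfPred_im_lt 0
      rw [hcl]
      refine Complex.continuous_conj.comp_continuousOn
        (hcont.comp Complex.continuous_conj.continuousOn ?_)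
      rintro z ⟨hz, hz0⟩
      refine ⟨hball_conj z hz, ?_⟩
      have : z.im ≤ 0 := hz0
      simpa using this
  refine ⟨r, hr0, G, ?_, hGup, ?_⟩
  · refine differentiableOn_ball_of_off_real hGc ?_
    intro z hz hz0
    rcases lt_or_gt_of_ne hz0 with h | h
    · have h1 : DifferentiableAt ℂ f (starRingEnd ℂ z) :=
        (hf _ (by simpa using h)).differentiableAt (isOpen_halfPlane.mem_nhds (by simpa using h))
      have h2 : DifferentiableAt ℂ (fun w => starRingEnd ℂ (f (starRingEnd ℂ w))) z := by
        have := h1.conj_conj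
        simpa [Function.comp_def] using this
      refine h2.congr_of_eventuallyEq ?_
      have hopen : {w : ℂ | w.im < 0} ∈ 𝓝 z := (isOpen_lt Complex.continuous_im
        continuous_const).mem_nhds h
      filter_upwards [hopen] with w hw
      have hw' : w.im < 0 := hw
      simp only [hG, not_le.2 hw', if_false]
      rw [hfh_im]
      simpa using hw'
    · refine ((hf z h).differentiableAt (isOpen_halfPlane.mem_nhds h)).congr_of_eventuallyEq ?_
      filter_upwards [isOpen_halfPlane.mem_nhds h, Metric.isOpen_ball.mem_nhds hz] with w hw hw'
      exact hGup w hw' hw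
  · intro x hx
    have hx' : x ∈ Ioo α β := by simpa using hre x hx
    exact ⟨hx', by simp [hG, hfh_real x hx']⟩

/-- A holomorphic function on the upper half-plane that has boundary value `c` on a whole
interval is constant. -/
theorem eqOn_const_of_tendsto_const_on_Ioo {f : ℂ → ℂ} (hf : DifferentiableOn ℂ f ℂ₊)
    {α β : ℝ} (hαβ : α < β) {c : ℂ}
    (hlim : ∀ x ∈ Ioo α β, Tendsto f (𝓝[ℂ₊] (x : ℂ)) (𝓝 c)) : ∀ z ∈ ℂ₊, f z = c := by
  obtain ⟨x₀, hx₀⟩ := exists_between hαβ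
  obtain ⟨r, hr, G, hG, hGup, hGre⟩ := exists_reflection (f := fun z => f z - c) (hf.sub_const c)
    (g := fun _ => 0) (fun x hx => by simpa using (hlim x hx).sub_const c) hx₀
  have hGan : AnalyticOnNhd ℂ G (Metric.ball (x₀ : ℂ) r) := hG.analyticOnNhd Metric.isOpen_ball
  have hfreq : ∃ᶠ z in 𝓝[≠] (x₀ : ℂ), G z = 0 := by
    have h1 : Tendsto (fun x : ℝ => (x : ℂ)) (𝓝[≠] x₀) (𝓝[≠] (x₀ : ℂ)) := by
      apply tendsto_nhdsWithin_of_tendsto_nhds_of_eventually_within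
      · exact (Complex.continuous_ofReal.tendsto x₀).mono_left nhdsWithin_le_nhds
      · filter_upwards [self_mem_nhdsWithin] with x hx
        simpa using hx
    refine h1.frequently (Eventually.frequently ?_)
    have : ∀ᶠ x : ℝ in 𝓝 x₀, (x : ℂ) ∈ Metric.ball (x₀ : ℂ) r :=
      Complex.continuous_ofReal.continuousAt.eventually (Metric.ball_mem_nhds _ hr)
    filter_upwards [this.filter_mono nhdsWithin_le_nhds] with x hx
    simpa using (hGre x hx).2
  have hG0 := hGan.eqOn_zero_of_preconnected_of_frequently_eq_zero
    (convex_ball _ _).isPreconnected (Metric.mem_ball_self hr) hfreq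
  set z₁ : ℂ := x₀ + (r / 2 : ℝ) * Complex.I with hz₁
  have hz₁b : z₁ ∈ Metric.ball (x₀ : ℂ) r := by
    rw [mem_ball_iff_norm]
    simp [hz₁, abs_of_pos hr, hr]
  have hz₁i : 0 < z₁.im := by simp [hz₁, hr]
  have hfan : AnalyticOnNhd ℂ (fun z => f z - c) ℂ₊ :=
    (hf.sub_const c).analyticOnNhd isOpen_halfPlane
  have := hfan.eqOn_zero_of_preconnected_of_eventuallyEq_zero convex_halfPlane.isPreconnected
    (z₀ := z₁) hz₁i (by
      filter_upwards [Metric.isOpen_ball.mem_nhds hz₁b, isOpen_halfPlane.mem_nhds hz₁i] with w h1 h2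
      have := hG0 h1
      rw [hGup w h1 h2] at this
      exact this)
  intro z hz
  exact sub_eq_zero.1 (this hz)

/-- A holomorphic function with nonnegative imaginary part on the upper half-plane and real
boundary values on an interval has nondecreasing boundary values there: by the Cauchy–Riemann
equations, the derivative of the boundary function is the normal derivative of the imaginary part
at its minimum. -/
theorem monotoneOn_of_im_nonneg {f : ℂ → ℂ} (hf : DifferentiableOn ℂ f ℂ₊)
    (him : ∀ z ∈ ℂ₊, 0 ≤ (f z).im) {α β : ℝ} {g : ℝ → ℝ}
    (hlim : ∀ x ∈ Ioo α β, Tendsto f (𝓝[ℂ₊] (x : ℂ)) (𝓝 (g x : ℂ))) :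
    MonotoneOn g (Ioo α β) := by
  have key : ∀ x₀ ∈ Ioo α β, ∃ d, 0 ≤ d ∧ HasDerivAt g d x₀ := by
    intro x₀ hx₀
    obtain ⟨r, hr, G, hG, hGup, hGre⟩ := exists_reflection hf hlim hx₀
    have hGd : HasDerivAt G (deriv G x₀) x₀ :=
      (hG.differentiableAt (Metric.ball_mem_nhds _ hr)).hasDerivAt
    have hGx₀ := (hGre x₀ (Metric.mem_ball_self hr)).2
    refine ⟨(deriv G x₀).re, ?_, ?_⟩
    · have h1 : HasDerivAt (fun y : ℝ => (G (x₀ + y * Complex.I)).im) (deriv G x₀).re 0 := by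
        have h2 : HasDerivAt (fun y : ℝ => (x₀ : ℂ) + y * Complex.I) Complex.I 0 := by
          have := ((Complex.ofRealCLM.hasDerivAt (x := (0 : ℝ))).mul_const Complex.I).const_add
            (x₀ : ℂ)
          simpa using this
        have h3 : HasDerivAt (fun y : ℝ => G (x₀ + y * Complex.I)) (deriv G x₀ * Complex.I) 0 := by
          have h4 : HasDerivAt G (deriv G x₀) ((x₀ : ℂ) + (0 : ℝ) * Complex.I) := by simpa using hGd
          exact h4.comp (0 : ℝ) h2
        have h5 := Complex.imCLM.hasFDerivAt.comp_hasDerivAt (0 : ℝ) h3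
        simpa [Function.comp_def] using h5
      refine ge_of_tendsto (h1.tendsto_slope.mono_left
        (nhdsWithin_mono (0 : ℝ) (fun y (hy : y ∈ Ioi (0:ℝ)) => (ne_of_gt hy)))) ?_
      have hev : ∀ᶠ y : ℝ in 𝓝 0, ((x₀ : ℂ) + y * Complex.I) ∈ Metric.ball (x₀ : ℂ) r := by
        have : ContinuousAt (fun y : ℝ => (x₀ : ℂ) + y * Complex.I) 0 := by fun_prop
        exact this.eventually_mem (by
          simpa using Metric.ball_mem_nhds (x₀ : ℂ) hr)
      filter_upwards [hev.filter_mono nhdsWithin_le_nhds, self_mem_nhdsWithin] with y hy hy0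
      have hy0' : 0 < y := hy0
      have hup : 0 < ((x₀ : ℂ) + y * Complex.I).im := by simpa using hy0'
      simp only [slope_def_field, Complex.ofReal_zero, zero_mul, add_zero, hGx₀, Complex.ofReal_im,
        sub_zero, hGup _ hy hup]
      exact div_nonneg (him _ hup) hy0'.le
    · have h5 := hGd.real_of_complex
      refine h5.congr_of_eventuallyEq ?_
      have : ∀ᶠ x : ℝ in 𝓝 x₀, (x : ℂ) ∈ Metric.ball (x₀ : ℂ) r :=
        Complex.continuous_ofReal.continuousAt.eventually (Metric.ball_mem_nhds _ hr)
      filter_upwards [this] with x hx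
      simp [(hGre x hx).2]
  refine monotoneOn_of_deriv_nonneg (convex_Ioo α β) ?_ ?_ ?_
  · intro x hx
    obtain ⟨d, -, h⟩ := key x hx
    exact h.continuousAt.continuousWithinAt
  · intro x hx
    rw [interior_Ioo] at hx
    obtain ⟨d, -, h⟩ := key x hx
    exact h.differentiableAt.differentiableWithinAt
  · intro x hx
    rw [interior_Ioo] at hx
    obtain ⟨d, h0, h⟩ := key x hx
    rwa [h.deriv]

/-- **Maximum modulus principle** on the upper half-plane, in terms of the upper limits of the
modulus at all boundary points, including the point at infinity. -/
theorem norm_le_of_boundary_limsup_le {f : ℂ → ℂ} (hf : DifferentiableOn ℂ f ℂ₊) {C : ℝ}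
    (hreal : ∀ x : ℝ, ∀ c > C, ∀ᶠ z in 𝓝[ℂ₊] (x : ℂ), ‖f z‖ < c)
    (hinf : ∀ c > C, ∀ᶠ z in cocompact ℂ ⊓ 𝓟 ℂ₊, ‖f z‖ < c) : ∀ z ∈ ℂ₊, ‖f z‖ ≤ C := by
  intro z₀ hz₀
  by_contra! hlt
  set S : Set ℂ := {z | z ∈ ℂ₊ ∧ ‖f z₀‖ ≤ ‖f z‖} with hS
  have hScl : IsClosed S := by
    rw [← closure_subset_iff_isClosed]
    intro z hz
    have hz0 : 0 ≤ z.im := by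
      have := closure_mono (fun w (hw : w ∈ S) => hw.1) hz
      rwa [closure_halfPlane] at this
    have hfr : ∃ᶠ w in 𝓝[ℂ₊] z, ‖f z₀‖ ≤ ‖f w‖ := by
      rw [frequently_nhdsWithin_iff]
      refine (mem_closure_iff_frequently.1 hz).mono fun w hw => ⟨hw.2, hw.1⟩
    rcases hz0.lt_or_eq with h | h
    · refine ⟨h, ?_⟩
      exact ge_of_tendsto_of_frequently ((hf z h).continuousWithinAt.norm) hfr
    · have hzr : z = (z.re : ℂ) := Complex.ext (by simp) (by simp [← h])
      rw [hzr] at hfr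
      have := hreal z.re _ hlt
      exact absurd (hfr.and_eventually this) (by
        rw [not_frequently]; exact Eventually.of_forall fun w hw => absurd hw.2 (not_lt.2 hw.1))
  have hScomp : IsCompact S := by
    have h1 := hinf _ hlt
    rw [eventually_inf_principal] at h1
    obtain ⟨K, hK, hKs⟩ := mem_cocompact.1 h1
    refine hK.of_isClosed_subset hScl fun z hz => ?_
    by_contra hzK
    exact absurd (hKs hzK hz.1) (not_lt.2 hz.2)
  obtain ⟨z₁, hz₁, hmax⟩ := hScomp.exists_isMaxOn ⟨z₀, hz₀, le_rfl⟩
    (hf.continuousOn.mono (fun z hz => hz.1)).norm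
  have hmax' : IsMaxOn (norm ∘ f) ℂ₊ z₁ := by
    intro z hz
    by_cases h : ‖f z₀‖ ≤ ‖f z‖
    · exact hmax ⟨hz, h⟩
    · exact (not_le.1 h).le.trans hz₁.2
  have hconst := Complex.eqOn_of_isPreconnected_of_isMaxOn_norm convex_halfPlane.isPreconnected
    isOpen_halfPlane hf hz₁.1 hmax'
  have h1 := (hreal 0 _ hlt).and self_mem_nhdsWithin
  have := nhdsWithin_halfPlane_ofReal_neBot 0
  obtain ⟨z, hz, hz'⟩ := h1.exists
  have := hconst hz'
  simp only [Function.const] at this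
  rw [this] at hz
  exact absurd hz (not_lt.2 hz₁.2)

/-- **Phragmén–Lindelöf principle** on the upper half-plane for bounded functions: the point at
infinity may be ignored in the maximum modulus principle. -/
theorem norm_le_of_boundary_limsup_le_of_bounded {f : ℂ → ℂ} (hf : DifferentiableOn ℂ f ℂ₊)
    {C B : ℝ} (hC : 0 ≤ C) (hB : ∀ z ∈ ℂ₊, ‖f z‖ ≤ B)
    (hreal : ∀ x : ℝ, ∀ c > C, ∀ᶠ z in 𝓝[ℂ₊] (x : ℂ), ‖f z‖ < c) : ∀ z ∈ ℂ₊, ‖f z‖ ≤ C := by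
  have hone : ∀ z ∈ ℂ₊, 1 ≤ ‖z + Complex.I‖ := by
    intro z hz
    have h1 := Complex.abs_im_le_norm (z + Complex.I)
    have h2 : 0 < z.im := hz
    simp at h1
    rw [abs_of_pos (by linarith)] at h1
    linarith
  have hslit : ∀ z ∈ ℂ₊, z + Complex.I ∈ Complex.slitPlane := by
    intro z hz
    right
    have : 0 < z.im := hz
    simp; linarith
  have hnorm : ∀ κ : ℝ, ∀ z ∈ ℂ₊, ‖f z * (z + Complex.I) ^ (-(κ : ℂ))‖
      = ‖f z‖ * ‖z + Complex.I‖ ^ (-κ) := by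
    intro κ z hz
    rw [norm_mul, ← Complex.ofReal_neg, Complex.norm_cpow_real]
  have main : ∀ κ : ℝ, 0 < κ → ∀ z ∈ ℂ₊, ‖f z‖ * ‖z + Complex.I‖ ^ (-κ) ≤ C := by
    intro κ hκ z hz
    rw [← hnorm κ z hz]
    have hle1 : ∀ z ∈ ℂ₊, ‖z + Complex.I‖ ^ (-κ) ≤ 1 := fun z hz =>
      Real.rpow_le_one_of_one_le_of_nonpos (hone z hz) (by linarith)
    refine norm_le_of_boundary_limsup_le (f := fun z => f z * (z + Complex.I) ^ (-(κ : ℂ)))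
      ?_ ?_ ?_ z hz
    · refine hf.mul fun z hz => ?_
      exact (DifferentiableAt.cpow (f := fun z => z + Complex.I) (g := fun _ => -(κ : ℂ))
        (by fun_prop) (by fun_prop) (hslit z hz)).differentiableWithinAt
    · intro x c hc
      filter_upwards [hreal x c hc, self_mem_nhdsWithin] with z hz hz'
      rw [hnorm κ z hz']
      exact (mul_le_of_le_one_right (norm_nonneg _) (hle1 z hz')).trans_lt hz
    · intro c hc
      have ht : Tendsto (fun z : ℂ => B * ‖z + Complex.I‖ ^ (-κ)) (cocompact ℂ ⊓ 𝓟 ℂ₊) (𝓝 0) := by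
        have h1 : Tendsto (fun z : ℂ => ‖z + Complex.I‖) (cocompact ℂ) atTop :=
          (tendsto_norm_cocompact_atTop (E := ℂ)).comp
            (Homeomorph.addRight Complex.I).isClosedEmbedding.tendsto_cocompact
        have h2 := (tendsto_rpow_neg_atTop hκ).comp h1
        simpa using (h2.const_mul B).mono_left inf_le_left
      filter_upwards [ht.eventually (gt_mem_nhds (hC.trans_lt hc)),
        mem_inf_of_right (mem_principal_self _)] with z hz hz'
      rw [hnorm κ z hz']
      refine lt_of_le_of_lt ?_ hz
      exact mul_le_mul_of_nonneg_right (hB z hz') (by positivity)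
  intro z hz
  have ht : Tendsto (fun κ : ℝ => ‖f z‖ * ‖z + Complex.I‖ ^ (-κ)) (𝓝[>] 0) (𝓝 ‖f z‖) := by
    have hpos : 0 < ‖z + Complex.I‖ := one_pos.trans_le (hone z hz)
    have : ContinuousAt (fun κ : ℝ => ‖f z‖ * ‖z + Complex.I‖ ^ (-κ)) 0 := by
      refine continuousAt_const.mul ?_
      exact ContinuousAt.rpow continuousAt_const continuousAt_neg (Or.inl hpos.ne')
    have h2 := this.tendsto
    simp at h2
    exact h2.mono_left nhdsWithin_le_nhds
  exact le_of_tendsto ht (by filter_upwards [self_mem_nhdsWithin] with κ hκ using main κ hκ z hz)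

/-! ### Conformal maps of the upper half-plane -/

/-- `Θ` restricts to a conformal map of the upper half-plane onto `Ω`. -/
structure IsConformalOnto (Ω : Set ℂ) (Θ : ℂ → ℂ) : Prop where
  differentiableOn : DifferentiableOn ℂ Θ ℂ₊
  bijOn : BijOn Θ ℂ₊ Ω

/-- The inverse `Ω → ℂ₊` of a conformal map `Θ` of the upper half-plane onto `Ω`. -/
noncomputable def conformalInv (Θ : ℂ → ℂ) : ℂ → ℂ := Function.invFunOn Θ ℂ₊

namespace IsConformalOnto

variable {Ω : Set ℂ} {Θ : ℂ → ℂ}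

lemma mem (hΘ : IsConformalOnto Ω Θ) {z : ℂ} (hz : z ∈ ℂ₊) : Θ z ∈ Ω := hΘ.bijOn.mapsTo hz

lemma inv_mem (hΘ : IsConformalOnto Ω Θ) {w : ℂ} (hw : w ∈ Ω) : conformalInv Θ w ∈ ℂ₊ :=
  Function.invFunOn_mem (hΘ.bijOn.surjOn hw)

lemma apply_inv (hΘ : IsConformalOnto Ω Θ) {w : ℂ} (hw : w ∈ Ω) : Θ (conformalInv Θ w) = w :=
  Function.invFunOn_eq (hΘ.bijOn.surjOn hw)

lemma inv_apply (hΘ : IsConformalOnto Ω Θ) {z : ℂ} (hz : z ∈ ℂ₊) : conformalInv Θ (Θ z) = z :=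
  hΘ.bijOn.injOn (hΘ.inv_mem (hΘ.mem hz)) hz (hΘ.apply_inv (hΘ.mem hz))

lemma isOpen_image (hΘ : IsConformalOnto Ω Θ) {s : Set ℂ} (hs : s ⊆ ℂ₊) (hso : IsOpen s) :
    IsOpen (Θ '' s) := by
  have han : AnalyticOnNhd ℂ Θ ℂ₊ := hΘ.differentiableOn.analyticOnNhd isOpen_halfPlane
  rcases han.is_constant_or_isOpen convex_halfPlane.isPreconnected with ⟨w, hw⟩ | h
  · have h1 : (Complex.I : ℂ) ∈ ℂ₊ := by simp
    have h2 : (2 * Complex.I : ℂ) ∈ ℂ₊ := by simp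
    have := hΘ.bijOn.injOn h1 h2 ((hw _ h1).trans (hw _ h2).symm)
    have h3 := congrArg Complex.im this
    norm_num at h3
  · exact h s hs hso

lemma isOpen (hΘ : IsConformalOnto Ω Θ) : IsOpen Ω := by
  rw [← hΘ.bijOn.image_eq]
  exact hΘ.isOpen_image Subset.rfl isOpen_halfPlane

lemma continuousAt_inv (hΘ : IsConformalOnto Ω Θ) {w : ℂ} (hw : w ∈ Ω) :
    ContinuousAt (conformalInv Θ) w := by
  rw [ContinuousAt, tendsto_def]
  intro s hs
  have hs' : s ∩ ℂ₊ ∈ 𝓝 (conformalInv Θ w) :=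
    inter_mem hs (isOpen_halfPlane.mem_nhds (hΘ.inv_mem hw))
  obtain ⟨t, hts, hto, hwt⟩ := mem_nhds_iff.1 hs'
  have hopen := hΘ.isOpen_image (hts.trans inter_subset_right) hto
  refine mem_of_superset (hopen.mem_nhds ⟨_, hwt, hΘ.apply_inv hw⟩) ?_
  rintro _ ⟨z, hz, rfl⟩
  rw [mem_preimage, hΘ.inv_apply (hts hz).2]
  exact (hts hz).1

lemma continuousOn_inv (hΘ : IsConformalOnto Ω Θ) : ContinuousOn (conformalInv Θ) Ω :=
  fun _ hw => (hΘ.continuousAt_inv hw).continuousWithinAt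

lemma isPreconnected_inv_image (hΘ : IsConformalOnto Ω Θ) {A : Set ℂ} (hA : A ⊆ Ω)
    (hAc : IsPreconnected A) : IsPreconnected (conformalInv Θ '' A) :=
  hAc.image _ (hΘ.continuousOn_inv.mono hA)

/-- The inverse of a conformal map is holomorphic. At the (a priori possible) critical values this
follows from Riemann's theorem on removable singularities. -/
lemma differentiableOn_inv (hΘ : IsConformalOnto Ω Θ) :
    DifferentiableOn ℂ (conformalInv Θ) Ω := by
  have hreg : ∀ w ∈ Ω, deriv Θ (conformalInv Θ w) ≠ 0 →
      DifferentiableAt ℂ (conformalInv Θ) w := by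
    intro w hw hd
    have h1 : HasDerivAt Θ (deriv Θ (conformalInv Θ w)) (conformalInv Θ w) :=
      (hΘ.differentiableOn.differentiableAt
        (isOpen_halfPlane.mem_nhds (hΘ.inv_mem hw))).hasDerivAt
    refine (HasDerivAt.of_local_left_inverse (hΘ.continuousAt_inv hw) h1 hd ?_).differentiableAt
    filter_upwards [hΘ.isOpen.mem_nhds hw] with v hv using hΘ.apply_inv hv
  intro w hw
  refine DifferentiableAt.differentiableWithinAt ?_
  refine (Complex.analyticAt_of_differentiable_on_punctured_nhds_of_continuousAt ?_
    (hΘ.continuousAt_inv hw)).differentiableAt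
  have hda : AnalyticOnNhd ℂ (deriv Θ) ℂ₊ :=
    (hΘ.differentiableOn.analyticOnNhd isOpen_halfPlane).deriv
  have hz₀ := hΘ.inv_mem hw
  have hev : ∀ᶠ z in 𝓝[≠] (conformalInv Θ w), deriv Θ z ≠ 0 := by
    rcases (hda _ hz₀).eventually_eq_zero_or_eventually_ne_zero with h | h
    · exfalso
      have h0 := hda.eqOn_zero_of_preconnected_of_eventuallyEq_zero
        convex_halfPlane.isPreconnected hz₀ h
      have h1 : (Complex.I : ℂ) ∈ ℂ₊ := by simp
      have h2 : (2 * Complex.I : ℂ) ∈ ℂ₊ := by simp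
      have h12 := isOpen_halfPlane.is_const_of_deriv_eq_zero convex_halfPlane.isPreconnected
        hΘ.differentiableOn h0 h1 h2
      have h3 := congrArg Complex.im (hΘ.bijOn.injOn h1 h2 h12)
      norm_num at h3
    · exact h
  have hpunct : Tendsto (conformalInv Θ) (𝓝[≠] w) (𝓝[≠] (conformalInv Θ w)) := by
    refine tendsto_nhdsWithin_of_tendsto_nhds_of_eventually_within _
      ((hΘ.continuousAt_inv hw).tendsto.mono_left nhdsWithin_le_nhds) ?_
    filter_upwards [self_mem_nhdsWithin,
      mem_nhdsWithin_of_mem_nhds (hΘ.isOpen.mem_nhds hw)] with v hv hvΩ heq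
    apply hv
    rw [mem_singleton_iff] at heq ⊢
    rw [← hΘ.apply_inv hvΩ, heq, hΘ.apply_inv hw]
  filter_upwards [hpunct.eventually hev,
    mem_nhdsWithin_of_mem_nhds (hΘ.isOpen.mem_nhds hw)] with v hv hvΩ using hreg v hvΩ hv

/-- Precomposition with a conformal self-map of the upper half-plane. -/
lemma comp (hΘ : IsConformalOnto Ω Θ) {ψ : ℂ → ℂ} (hψ : IsConformalOnto ℂ₊ ψ) :
    IsConformalOnto Ω (Θ ∘ ψ) :=
  ⟨hΘ.differentiableOn.comp hψ.differentiableOn hψ.bijOn.mapsTo, hΘ.bijOn.comp hψ.bijOn⟩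

end IsConformalOnto

lemma isConformalOnto_add_ofReal (x : ℝ) : IsConformalOnto ℂ₊ (fun z => z + x) := by
  refine ⟨by fun_prop, ?_, ?_, ?_⟩
  · intro z hz
    have : 0 < z.im := hz
    simpa using this
  · intro z _ w _ h
    simpa using h
  · intro w hw
    have : 0 < w.im := hw
    exact ⟨w - x, by simpa using this, by simp⟩

lemma neg_inv_mem_halfPlane {z : ℂ} (hz : z ∈ ℂ₊) : -z⁻¹ ∈ ℂ₊ := by
  have h : 0 < z.im := hz
  have hz0 : z ≠ 0 := by rintro rfl; simp at h
  have : (-z⁻¹).im = z.im / Complex.normSq z := by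
    simp [Complex.inv_im, neg_div]
  rw [mem_upperHalfPlaneSet_iff, this]
  exact div_pos h (Complex.normSq_pos.2 hz0)

lemma isConformalOnto_neg_inv : IsConformalOnto ℂ₊ (fun z => -z⁻¹) := by
  refine ⟨?_, fun z hz => neg_inv_mem_halfPlane hz, ?_, ?_⟩
  · intro z hz
    have h : 0 < z.im := hz
    have hz0 : z ≠ 0 := by rintro rfl; simp at h
    exact ((differentiableAt_inv hz0).neg).differentiableWithinAt
  · intro z _ w _ h
    simpa using h
  · intro w hw
    exact ⟨-w⁻¹, neg_inv_mem_halfPlane hw, by simp [inv_neg]⟩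

/-! ### The length–area principle -/

open MeasureTheory in
/-- The area formula for an injective holomorphic function. -/
lemma lintegral_enorm_deriv_sq_eq_volume_image {f : ℂ → ℂ} {U : Set ℂ} (hU : IsOpen U)
    (hf : DifferentiableOn ℂ f U) (hinj : InjOn f U) :
    ∫⁻ z in U, ‖deriv f z‖ₑ ^ 2 = volume (f '' U) := by
  have h1 : ∀ z ∈ U, HasFDerivWithinAt f ((fderiv ℂ f z).restrictScalars ℝ) U z := fun z hz =>
    ((hf.differentiableAt (hU.mem_nhds hz)).hasFDerivAt.restrictScalars ℝ).hasFDerivWithinAt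
  have h2 := lintegral_image_eq_lintegral_abs_det_fderiv_mul volume hU.measurableSet h1 hinj
    (fun _ => 1)
  simp only [lintegral_one, Measure.restrict_apply_univ, mul_one] at h2
  rw [h2]
  refine setLIntegral_congr_fun hU.measurableSet fun z _ => ?_
  have hdet : ((fderiv ℂ f z).restrictScalars ℝ).det = ‖deriv f z‖ ^ 2 := by
    have h3 : ((fderiv ℂ f z).restrictScalars ℝ).det
        = LinearMap.det ((fderiv ℂ f z : ℂ →ₗ[ℂ] ℂ).restrictScalars ℝ) := rfl
    rw [h3, LinearMap.det_restrictScalars, LinearMap.det_ring, Algebra.norm_complex_apply,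
      Complex.normSq_eq_norm_sq]
    simp
  rw [hdet, abs_of_nonneg (by positivity), ENNReal.ofReal_pow (norm_nonneg _), ofReal_norm]

open MeasureTheory in
lemma sq_lintegral_le_measure_mul_lintegral_sq {g : ℝ → ENNReal} {s : Set ℝ} (hg : Measurable g) :
    (∫⁻ x in s, g x) ^ 2 ≤ volume s * ∫⁻ x in s, g x ^ 2 := by
  have h := ENNReal.lintegral_mul_le_Lp_mul_Lq (volume.restrict s)
    (Real.holderConjugate_iff.2 ⟨by norm_num, by norm_num⟩ : (2 : ℝ).HolderConjugate 2)
    hg.aemeasurable (aemeasurable_const (b := (1 : ENNReal)))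
  simp only [Pi.mul_apply, mul_one, ENNReal.one_rpow, lintegral_const, Measure.restrict_apply_univ,
    one_mul] at h
  have h2 := pow_le_pow_left₀ (zero_le) h 2
  rw [mul_pow, ← ENNReal.rpow_natCast, ← ENNReal.rpow_natCast, ← ENNReal.rpow_natCast,
    ← ENNReal.rpow_mul, ← ENNReal.rpow_mul] at h2
  norm_num at h2
  rw [mul_comm]
  exact h2

open MeasureTheory in
/-- **Length–area principle** (Wolff's lemma): a bounded injective holomorphic function on the upper
half-plane maps arbitrarily small semicircles about the boundary point `0` to sets of arbitrarily
small diameter. Otherwise the Cauchy–Schwarz inequality bounds the area of the image from below by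
a multiple of `∫ dr / r`. -/
theorem exists_semicircle_image_small {f : ℂ → ℂ} (hf : DifferentiableOn ℂ f ℂ₊)
    (hinj : InjOn f ℂ₊) {B : ℝ} (hB : ∀ z ∈ ℂ₊, ‖f z‖ ≤ B) {ε ρ : ℝ} (hε : 0 < ε) (hρ : 0 < ρ) :
    ∃ r ∈ Ioo 0 ρ, ∀ z ∈ ℂ₊, ∀ w ∈ ℂ₊, ‖z‖ = r → ‖w‖ = r → ‖f z - f w‖ < ε := by
  by_contra! h
  set D : ℂ → ENNReal := ℂ₊.indicator (fun z => ‖deriv f z‖ₑ ^ 2) with hD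
  have hDm : Measurable D :=
    ((measurable_deriv f).enorm.pow_const 2).indicator isOpen_halfPlane.measurableSet
  have hpm : Measurable fun p : ℝ × ℝ => Complex.polarCoord.symm p := by
    simp only [Complex.polarCoord_symm_apply]
    fun_prop
  set A : ℝ → ENNReal := fun r =>
    ∫⁻ θ in Ioo (-Real.pi) Real.pi, ENNReal.ofReal r * D (Complex.polarCoord.symm (r, θ)) with hA
  have harea : ∫⁻ r in Ioi (0 : ℝ), A r < ⊤ := by
    have h1 : ∫⁻ r in Ioi (0 : ℝ), A r = ∫⁻ z, D z := by
      rw [← Complex.lintegral_comp_polarCoord_symm]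
      change _ = ∫⁻ p in Ioi (0 : ℝ) ×ˢ Ioo (-Real.pi) Real.pi, _
      rw [Measure.volume_eq_prod, ← Measure.prod_restrict, lintegral_prod]
      · simp [hA]
      · refine Measurable.aemeasurable ?_
        simp only [smul_eq_mul]
        exact (ENNReal.measurable_ofReal.comp measurable_fst).mul (hDm.comp hpm)
    rw [h1, hD, lintegral_indicator isOpen_halfPlane.measurableSet,
      lintegral_enorm_deriv_sq_eq_volume_image isOpen_halfPlane hf hinj]
    refine (measure_mono (t := Metric.closedBall (0 : ℂ) B) ?_).trans_lt
      measure_closedBall_lt_top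
    rintro _ ⟨z, hz, rfl⟩
    simpa using hB z hz
  have hlow : ∀ r ∈ Ioo 0 ρ, ENNReal.ofReal (ε ^ 2 / Real.pi * r⁻¹) ≤ A r := by
    intro r hr
    have hr0 : 0 < r := hr.1
    set g : ℝ → ENNReal := fun θ =>
      ENNReal.ofReal r * ℂ₊.indicator (fun z => ‖deriv f z‖ₑ) (Complex.polarCoord.symm (r, θ))
      with hg
    have hgm : Measurable g := by
      refine measurable_const.mul (((measurable_deriv f).enorm.indicator
        isOpen_halfPlane.measurableSet).comp (hpm.comp (by fun_prop)))
    have hlen : ENNReal.ofReal ε ≤ ∫⁻ θ in Ioo 0 Real.pi, g θ := by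
      have hpath : ∀ α ∈ Ioo 0 Real.pi, ∀ β ∈ Ioo 0 Real.pi, α ≤ β →
          ‖f (Complex.polarCoord.symm (r, β)) - f (Complex.polarCoord.symm (r, α))‖ₑ
            ≤ ∫⁻ θ in Ioo 0 Real.pi, g θ := by
        intro α hα β hβ hαβ
        set γ : ℝ → ℂ := fun θ => Complex.polarCoord.symm (r, θ) with hγ
        have hγe : γ = fun θ : ℝ => r * (Real.cos θ + Real.sin θ * Complex.I) := by
          funext θ
          simp [hγ]
        have hsub : Icc α β ⊆ Ioo 0 Real.pi := Icc_subset_Ioo hα.1 hβ.2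
        have hγup : ∀ θ ∈ Ioo 0 Real.pi, γ θ ∈ ℂ₊ := by
          intro θ hθ
          rw [mem_upperHalfPlaneSet_iff, hγe]
          simp only [Complex.mul_im, Complex.ofReal_re, Complex.ofReal_im, Complex.add_im,
            Complex.mul_im, Complex.I_im, Complex.I_re]
          have := Real.sin_pos_of_pos_of_lt_pi hθ.1 hθ.2
          simp
          positivity
        have hγd : ∀ θ, HasDerivAt γ (r * (-Real.sin θ + Real.cos θ * Complex.I)) θ := by
          intro θ
          rw [hγe]
          have h1 := (Real.hasDerivAt_cos θ).ofReal_comp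
          have h2 := (Real.hasDerivAt_sin θ).ofReal_comp
          have := (h1.add (h2.mul_const Complex.I)).const_mul (r : ℂ)
          simpa using this
        have hγn : ∀ θ : ℝ, ‖(r * (-Real.sin θ + Real.cos θ * Complex.I) : ℂ)‖ = r := by
          intro θ
          have : (-Real.sin θ + Real.cos θ * Complex.I : ℂ)
              = Complex.I * Complex.exp (θ * Complex.I) := by
            rw [Complex.exp_mul_I]
            push_cast
            linear_combination (-Complex.sin θ) * Complex.I_mul_I
          rw [this]
          simp [Complex.norm_exp_ofReal_mul_I, abs_of_pos hr0]
        have hcd : ContDiffOn ℝ 1 (fun θ => f (γ θ)) (Icc α β) := by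
          have hfc : ContDiffOn ℝ 1 f ℂ₊ :=
            ((hf.contDiffOn isOpen_halfPlane).restrict_scalars ℝ : ContDiffOn ℝ 1 f ℂ₊)
          refine hfc.comp (ContDiff.contDiffOn ?_) fun θ hθ => hγup θ (hsub hθ)
          rw [hγe]
          have h1 : ContDiff ℝ 1 fun θ : ℝ => ((Real.cos θ : ℝ) : ℂ) :=
            Complex.ofRealCLM.contDiff.comp Real.contDiff_cos
          have h2 : ContDiff ℝ 1 fun θ : ℝ => ((Real.sin θ : ℝ) : ℂ) :=
            Complex.ofRealCLM.contDiff.comp Real.contDiff_sin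
          exact contDiff_const.mul (h1.add (h2.mul contDiff_const))
        refine (enorm_sub_le_lintegral_deriv_of_contDiffOn_Icc hcd hαβ).trans ?_
        refine le_trans ?_ (lintegral_mono_set hsub)
        refine setLIntegral_mono' measurableSet_Icc fun θ hθ => ?_
        have hup := hγup θ (hsub hθ)
        have hfd := (hf.differentiableAt (isOpen_halfPlane.mem_nhds hup)).hasDerivAt
        have hd : HasDerivAt (fun θ => f (γ θ)) _ θ := hfd.comp θ (hγd θ)
        rw [hd.deriv, enorm_mul]
        have h3 : ‖(r * (-Real.sin θ + Real.cos θ * Complex.I) : ℂ)‖ₑ = ENNReal.ofReal r := by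
          rw [← ofReal_norm, hγn]
        simp only [hg]
        rw [h3, indicator_of_mem hup, mul_comm]
      obtain ⟨z, hz, w, hw, hzr, hwr, hε'⟩ := h r hr
      have hpol : ∀ z ∈ ℂ₊, ‖z‖ = r →
          z.arg ∈ Ioo 0 Real.pi ∧ Complex.polarCoord.symm (r, z.arg) = z := by
        intro z hz hzr
        have hz' : 0 < z.im := hz
        refine ⟨⟨?_, ?_⟩, ?_⟩
        · refine lt_of_le_of_ne (Complex.arg_nonneg_iff.2 hz'.le) fun h0 => ?_
          have := (Complex.arg_eq_zero_iff.1 h0.symm).2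
          linarith
        · exact Complex.arg_lt_pi_iff.2 (Or.inr hz'.ne')
        · rw [Complex.polarCoord_symm_apply, ← hzr]
          simp
      obtain ⟨hza, hze⟩ := hpol z hz hzr
      obtain ⟨hwa, hwe⟩ := hpol w hw hwr
      rcases le_total z.arg w.arg with hle | hle
      · refine le_trans ?_ (hpath _ hza _ hwa hle)
        rw [hze, hwe, ← ofReal_norm, norm_sub_rev]
        exact ENNReal.ofReal_le_ofReal hε'
      · refine le_trans ?_ (hpath _ hwa _ hza hle)
        rw [hze, hwe, ← ofReal_norm]
        exact ENNReal.ofReal_le_ofReal hε'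
    have hcs := (pow_le_pow_left₀ zero_le hlen 2).trans
      (sq_lintegral_le_measure_mul_lintegral_sq hgm)
    have hgA : ∫⁻ θ in Ioo 0 Real.pi, g θ ^ 2 ≤ ENNReal.ofReal r * A r := by
      rw [hA]
      simp only
      rw [← lintegral_const_mul' _ _ ENNReal.ofReal_ne_top]
      refine (lintegral_mono fun θ => ?_).trans (lintegral_mono_set
        (Ioo_subset_Ioo_left (neg_nonpos.2 Real.pi_pos.le)))
      simp only [hg, hD, mul_pow]
      rw [sq (ENNReal.ofReal r), mul_assoc]
      gcongr
      by_cases hm : Complex.polarCoord.symm (r, θ) ∈ ℂ₊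
      · rw [indicator_of_mem hm, indicator_of_mem hm]
      · rw [indicator_of_notMem hm, indicator_of_notMem hm]; simp
    have hfin := hcs.trans (mul_le_mul_right hgA _)
    rw [Real.volume_Ioo, sub_zero, ← ENNReal.ofReal_pow hε.le, ← mul_assoc,
      ← ENNReal.ofReal_mul Real.pi_pos.le] at hfin
    have hpr : 0 < Real.pi * r := mul_pos Real.pi_pos hr0
    have heq : ε ^ 2 / Real.pi * r⁻¹ = ε ^ 2 / (Real.pi * r) := by field_simp
    rw [heq, ENNReal.ofReal_div_of_pos hpr]
    refine ENNReal.div_le_of_le_mul ?_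
    rwa [mul_comm] at hfin
  have hdiv : ∫⁻ r in Ioo 0 ρ, ENNReal.ofReal (ε ^ 2 / Real.pi * r⁻¹) = ⊤ := by
    by_contra hne
    have hint := (lintegral_ofReal_ne_top_iff_integrable (μ := volume.restrict (Ioo 0 ρ))
      (f := fun r : ℝ => ε ^ 2 / Real.pi * r⁻¹) (by fun_prop) ?_).1 hne
    · have h2 : IntegrableOn (fun r : ℝ => r⁻¹) (Ioo 0 ρ) := by
        have := hint.const_mul (Real.pi / ε ^ 2)
        refine this.congr (Eventually.of_forall fun r => ?_)
        have := Real.pi_pos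
        simp only
        field_simp
      have h3 : IntervalIntegrable (fun r : ℝ => r⁻¹) volume 0 ρ := by
        rw [intervalIntegrable_iff_integrableOn_Ioo_of_le hρ.le]
        exact h2
      rw [intervalIntegrable_inv_iff] at h3
      rcases h3 with h3 | h3
      · exact hρ.ne h3
      · exact h3 left_mem_uIcc
    · filter_upwards [ae_restrict_mem measurableSet_Ioo] with r hr
      have := hr.1
      have := Real.pi_pos
      simp only [Pi.zero_apply]
      positivity
  have hle : ∫⁻ r in Ioo 0 ρ, ENNReal.ofReal (ε ^ 2 / Real.pi * r⁻¹) ≤ ∫⁻ r in Ioi (0 : ℝ), A r :=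
    (setLIntegral_mono' measurableSet_Ioo hlow).trans (lintegral_mono_set Ioo_subset_Ioi_self)
  rw [hdiv] at hle
  exact absurd harea (not_lt.2 hle)

/-! ### Connectedness in comb domains -/

/-- The data of a comb: distinct positive abscissae and positive heights of the slits, of which
only finitely many exceed any given positive number. -/
structure IsComb (I : Set ℕ) (u h : ℕ → ℝ) : Prop where
  u_pos : ∀ j ∈ I, 0 < u j
  u_inj : InjOn u I
  h_pos : ∀ j ∈ I, 0 < h j
  finite : ∀ δ > 0, {j | j ∈ I ∧ δ ≤ h j}.Finite

lemma mem_combDomain {I : Set ℕ} {u h : ℕ → ℝ} {w : ℂ} :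
    w ∈ combDomain I u h ↔ 0 < w.re ∧ 0 < w.im ∧ ∀ j ∈ I, w.re = u j → h j < w.im := by
  simp only [combDomain, slit, Set.mem_sdiff, mem_ofPred_eq, mem_iUnion, not_exists, not_and, not_le]
  constructor
  · rintro ⟨⟨h1, h2⟩, h3⟩
    exact ⟨h1, h2, fun j hj hw => h3 j hj hw h2⟩
  · rintro ⟨h1, h2, h3⟩
    exact ⟨⟨h1, h2⟩, fun j hj hw _ => h3 j hj hw⟩

/-- A comb domain contains with each point the vertical ray above it. -/
lemma mem_combDomain_of_le {I : Set ℕ} {u h : ℕ → ℝ} {w z : ℂ} (hw : w ∈ combDomain I u h)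
    (hre : z.re = w.re) (him : w.im ≤ z.im) : z ∈ combDomain I u h := by
  rw [mem_combDomain] at hw ⊢
  refine ⟨hre ▸ hw.1, hw.2.1.trans_le him, fun j hj hz => ?_⟩
  exact (hw.2.2 j hj (hre ▸ hz)).trans_le him

lemma one_le_norm_add_one {w : ℂ} (hw : 0 ≤ w.re) : 1 ≤ ‖w + 1‖ := by
  have h1 := Complex.abs_re_le_norm (w + 1)
  simp at h1
  rw [abs_of_pos (by linarith)] at h1
  linarith

lemma add_one_ne_zero_of_re_nonneg {w : ℂ} (hw : 0 ≤ w.re) : w + 1 ≠ 0 := by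
  intro h
  have := one_le_norm_add_one hw
  rw [h, norm_zero] at this
  linarith

/-- A set is preconnected if each of its points can be joined inside it to a preconnected part. -/
lemma isPreconnected_of_joined {A T : Set ℂ} (hTA : T ⊆ A) (hT : IsPreconnected T)
    (h : ∀ w ∈ A, ∃ C ⊆ A, IsPreconnected C ∧ w ∈ C ∧ (C ∩ T).Nonempty) : IsPreconnected A := by
  rcases A.eq_empty_or_nonempty with rfl | ⟨w₀, hw₀⟩
  · exact isPreconnected_empty
  obtain ⟨-, -, -, -, t₀, -, ht₀⟩ := h w₀ hw₀
  refine isPreconnected_of_forall t₀ fun w hw => ?_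
  obtain ⟨C, hCA, hC, hwC, t, htC, htT⟩ := h w hw
  exact ⟨C ∪ T, union_subset hCA hTA, Or.inr ht₀, Or.inl hwC, hC.union t htC htT hT⟩

lemma isPreconnected_reProdIm {s t : Set ℝ} (hs : s.OrdConnected) (ht : t.OrdConnected) :
    IsPreconnected (s ×ℂ t) :=
  ((hs.convex.linear_preimage Complex.reLm).inter
    (ht.convex.linear_preimage Complex.imLm)).isPreconnected

namespace IsComb

variable {I : Set ℕ} {u h : ℕ → ℝ}

lemma exists_height (hc : IsComb I u h) : ∃ H : ℝ, 0 < H ∧ ∀ j ∈ I, h j < H := by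
  obtain ⟨B, hB⟩ := ((hc.finite 1 one_pos).image h).bddAbove
  refine ⟨max B 1 + 1, by positivity, fun j hj => ?_⟩
  by_cases h1 : 1 ≤ h j
  · have := hB (mem_image_of_mem h ⟨hj, h1⟩)
    linarith [le_max_left B 1]
  · linarith [le_max_right B 1]

/-- The tall slits and the imaginary axis have a positive mutual distance. -/
lemma exists_separation (hc : IsComb I u h) {δ η : ℝ} (hδ : 0 < δ) (hη : 0 < η) :
    ∃ ε > 0, ε ≤ η ∧ (∀ j ∈ I, δ ≤ h j → 4 * ε ≤ u j) ∧
      ∀ j ∈ I, ∀ k ∈ I, δ ≤ h j → δ ≤ h k → j ≠ k → 4 * ε ≤ |u j - u k| := by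
  have hfin := hc.finite δ hδ
  have hlim : ∀ c : ℝ, 0 < c → ∀ᶠ ε : ℝ in 𝓝[>] 0, 4 * ε ≤ c := by
    intro c hcpos
    have : Tendsto (fun ε : ℝ => 4 * ε) (𝓝[>] 0) (𝓝 0) := by
      have h1 : ContinuousAt (fun ε : ℝ => 4 * ε) 0 := by fun_prop
      simpa using h1.tendsto.mono_left nhdsWithin_le_nhds
    exact this.eventually (ge_mem_nhds hcpos)
  have h1 : ∀ᶠ ε : ℝ in 𝓝[>] 0, ∀ j ∈ {j | j ∈ I ∧ δ ≤ h j}, 4 * ε ≤ u j :=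
    (eventually_all_finite hfin).2 fun j hj => hlim _ (hc.u_pos j hj.1)
  have h2 : ∀ᶠ ε : ℝ in 𝓝[>] 0, ∀ j ∈ {j | j ∈ I ∧ δ ≤ h j}, ∀ k ∈ {j | j ∈ I ∧ δ ≤ h j},
      j ≠ k → 4 * ε ≤ |u j - u k| := by
    refine (eventually_all_finite hfin).2 fun j hj => (eventually_all_finite hfin).2 fun k hk => ?_
    by_cases hjk : j = k
    · simp [hjk]
    · have : 0 < |u j - u k| := abs_pos.2 (sub_ne_zero.2 fun he => hjk (hc.u_inj hj.1 hk.1 he))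
      filter_upwards [hlim _ this] with ε hε _ using hε
  obtain ⟨ε, ⟨⟨h1, h2⟩, h3⟩, h4⟩ := (((h1.and h2).and (hlim η hη)).and self_mem_nhdsWithin).exists
  have h4' : 0 < ε := h4
  exact ⟨ε, h4', by linarith, fun j hj hδj => h1 j ⟨hj, hδj⟩,
    fun j hj k hk hδj hδk hjk => h2 j ⟨hj, hδj⟩ k ⟨hk, hδk⟩ hjk⟩

/-- The part of a comb domain that lies far out is connected. -/
lemma isPreconnected_far (n : ℝ) (hc : IsComb I u h) :
    IsPreconnected {w | w ∈ combDomain I u h ∧ (n < w.re ∨ n < w.im)} := by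
  obtain ⟨H, hH0, hH⟩ := hc.exists_height
  refine isPreconnected_of_joined (T := Ioi 0 ×ℂ Ioi (max n H)) ?_
    (isPreconnected_reProdIm ordConnected_Ioi ordConnected_Ioi) ?_
  · rintro w ⟨h1, h2⟩
    have h1' : 0 < w.re := h1
    have h2' : max n H < w.im := h2
    have h3 := (le_max_right n H).trans_lt h2'
    exact ⟨mem_combDomain.2 ⟨h1', hH0.trans h3, fun j hj _ => (hH j hj).trans h3⟩,
      Or.inr ((le_max_left n H).trans_lt h2')⟩
  · rintro w ⟨hw, hn⟩
    refine ⟨{w.re} ×ℂ Ici w.im, ?_, isPreconnected_reProdIm ordConnected_singleton ordConnected_Ici,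
      by simp [Complex.mem_reProdIm], ⟨w.re, max w.im (max n H + 1)⟩, ?_, ?_⟩
    · rintro z ⟨h1, h2⟩
      have h1' : z.re = w.re := h1
      have h2' : w.im ≤ z.im := h2
      exact ⟨mem_combDomain_of_le hw h1' h2', hn.imp (fun h => h1' ▸ h) fun h => h.trans_le h2'⟩
    · simp [Complex.mem_reProdIm]
    · simp only [Complex.mem_reProdIm, mem_Ioi]
      exact ⟨(mem_combDomain.1 hw).1, lt_max_of_lt_right (lt_add_one _)⟩

/-- The part of a comb domain in a large box is connected. -/
lemma isPreconnected_near {H n : ℝ} (hH0 : 0 < H) (hH : ∀ j ∈ I, h j < H)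
    (hn : H < n) :
    IsPreconnected {w | w ∈ combDomain I u h ∧ w.re ≤ n ∧ w.im ≤ n} := by
  refine isPreconnected_of_joined (T := Ioc 0 n ×ℂ Icc H n) ?_
    (isPreconnected_reProdIm ordConnected_Ioc ordConnected_Icc) ?_
  · rintro w ⟨h1, h2⟩
    have h1' : w.re ∈ Ioc 0 n := h1
    have h2' : w.im ∈ Icc H n := h2
    exact ⟨mem_combDomain.2 ⟨h1'.1, hH0.trans_le h2'.1, fun j hj _ => (hH j hj).trans_le h2'.1⟩,
      h1'.2, h2'.2⟩
  · rintro w ⟨hw, hr, hi⟩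
    refine ⟨{w.re} ×ℂ Icc w.im n, ?_,
      isPreconnected_reProdIm ordConnected_singleton ordConnected_Icc,
      by simp [Complex.mem_reProdIm, hi], ⟨w.re, n⟩, ?_, ?_⟩
    · rintro z ⟨h1, h2⟩
      have h1' : z.re = w.re := h1
      have h2' : z.im ∈ Icc w.im n := h2
      exact ⟨mem_combDomain_of_le hw h1' h2'.1, h1' ▸ hr, h2'.2⟩
    · simp [Complex.mem_reProdIm, hi]
    · simp [Complex.mem_reProdIm, hn.le, (mem_combDomain.1 hw).1, hr]

/-- Every sufficiently small disc is contained in a small set whose complement in the comb domain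
is connected. At small heights this set is a half-strip; at larger heights it is a square, small
enough to meet at most one of the slits of that height, so that each point below it can be joined
to infinity by passing it on one side. -/
theorem exists_small_nonseparating (hc : IsComb I u h) {η : ℝ} (hη : 0 < η) :
    ∃ ε > 0, ∀ p : ℂ, ∃ K : Set ℂ, (∀ w ∈ combDomain I u h, ‖w - p‖ < ε → w ∈ K) ∧
      (∀ w ∈ K, ∀ w' ∈ K, ‖w - w'‖ ≤ η) ∧ IsPreconnected (combDomain I u h \ K) := by
  obtain ⟨ε, hε, hεη, htall, hsep⟩ := hc.exists_separation (δ := η / 8) (η := η / 8)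
    (by positivity) (by positivity)
  obtain ⟨H, hH0, hH⟩ := hc.exists_height
  refine ⟨ε, hε, fun p => ?_⟩
  have hre : ∀ w : ℂ, ‖w - p‖ < ε → |w.re - p.re| < ε := fun w hw => by
    simpa using (Complex.abs_re_le_norm (w - p)).trans_lt hw
  have him : ∀ w : ℂ, ‖w - p‖ < ε → |w.im - p.im| < ε := fun w hw => by
    simpa using (Complex.abs_im_le_norm (w - p)).trans_lt hw
  have hnorm : ∀ w w' : ℂ, ‖w - w'‖ ≤ |w.re - w'.re| + |w.im - w'.im| := fun w w' => by
    simpa using Complex.norm_le_abs_re_add_abs_im (w - w')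
  set Y := max H (p.im + η) with hY
  have htop : ∀ K : Set ℂ, (∀ w ∈ K, w.im < p.im + η) →
      Ioi 0 ×ℂ Ioi Y ⊆ combDomain I u h \ K := by
    rintro K hK w ⟨h1, h2⟩
    have h1' : 0 < w.re := h1
    have h2' : Y < w.im := h2
    have h3 := (le_max_left _ _).trans_lt h2'
    refine ⟨mem_combDomain.2 ⟨h1', hH0.trans h3, fun j hj _ => (hH j hj).trans h3⟩, fun hwK => ?_⟩
    exact absurd (hK w hwK) (not_lt.2 ((le_max_right _ _).trans h2'.le))
  have hray : ∀ (K : Set ℂ) (w : ℂ), w ∈ combDomain I u h →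
      (∀ z : ℂ, z.re = w.re → w.im ≤ z.im → z ∉ K) →
      ∃ C ⊆ combDomain I u h \ K, IsPreconnected C ∧ w ∈ C ∧ (C ∩ Ioi 0 ×ℂ Ioi Y).Nonempty := by
    intro K w hw hwK
    refine ⟨{w.re} ×ℂ Ici w.im, ?_, isPreconnected_reProdIm ordConnected_singleton ordConnected_Ici,
      by simp [Complex.mem_reProdIm], ⟨w.re, max w.im (Y + 1)⟩, ?_, ?_⟩
    · rintro z ⟨h1, h2⟩
      exact ⟨mem_combDomain_of_le hw h1 h2, hwK z h1 h2⟩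
    · simp [Complex.mem_reProdIm]
    · simp only [Complex.mem_reProdIm, mem_Ioi]
      exact ⟨(mem_combDomain.1 hw).1, lt_max_of_lt_right (lt_add_one _)⟩
  rcases lt_or_ge p.im (η / 8 + ε) with hlow | hhigh
  · by_cases hp0 : p.im ≤ -ε
    · -- The disc about `p` does not meet the upper half-plane.
      refine ⟨∅, fun w hw hwp => ?_, by simp, ?_⟩
      · have := abs_lt.1 (him w hwp)
        have := (mem_combDomain.1 hw).2.1
        linarith
      · refine isPreconnected_of_joined (htop ∅ (by simp))
          (isPreconnected_reProdIm ordConnected_Ioi ordConnected_Ioi) ?_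
        exact fun w hw => hray ∅ w hw.1 (by simp)
    rw [not_le] at hp0
    refine ⟨{w | |w.re - p.re| < ε ∧ 0 < w.im ∧ w.im < η / 8 + 2 * ε}, ?_, ?_, ?_⟩
    · intro w hw hwp
      have := abs_lt.1 (him w hwp)
      exact ⟨hre w hwp, (mem_combDomain.1 hw).2.1, by linarith⟩
    · rintro w ⟨h1, h2, h3⟩ w' ⟨h1', h2', h3'⟩
      refine (hnorm w w').trans ?_
      have e1 : |w.re - w'.re| ≤ 2 * ε := by
        rw [abs_lt] at h1 h1'
        rw [abs_le]
        constructor <;> linarith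
      have e2 : |w.im - w'.im| ≤ η / 8 + 2 * ε := by
        rw [abs_le]
        constructor <;> linarith
      linarith
    · refine isPreconnected_of_joined (htop _ ?_)
        (isPreconnected_reProdIm ordConnected_Ioi ordConnected_Ioi) ?_
      · rintro w ⟨-, -, h3⟩
        linarith
      · rintro w ⟨hw, hwK⟩
        refine hray _ w hw fun z hz1 hz2 hzK => hwK ?_
        exact ⟨hz1 ▸ hzK.1, (mem_combDomain.1 hw).2.1, hz2.trans_lt hzK.2.2⟩
  · set K : Set ℂ := {w | |w.re - p.re| < ε ∧ |w.im - p.im| < ε} with hK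
    refine ⟨K, fun w hw hwp => ⟨hre w hwp, him w hwp⟩, ?_, ?_⟩
    · rintro w ⟨h1, h2⟩ w' ⟨h1', h2'⟩
      refine (hnorm w w').trans ?_
      have e1 : |w.re - w'.re| ≤ 2 * ε := by
        rw [abs_lt] at h1 h1'
        rw [abs_le]
        constructor <;> linarith
      have e2 : |w.im - w'.im| ≤ 2 * ε := by
        rw [abs_lt] at h2 h2'
        rw [abs_le]
        constructor <;> linarith
      linarith
    · refine isPreconnected_of_joined (htop _ ?_)
        (isPreconnected_reProdIm ordConnected_Ioi ordConnected_Ioi) ?_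
      · rintro w ⟨-, h2⟩
        rw [abs_lt] at h2
        linarith
      rintro w ⟨hw, hwK⟩
      by_cases hbelow : |w.re - p.re| < ε ∧ w.im ≤ p.im - ε
      swap
      · refine hray _ w hw fun z hz1 hz2 hzK => ?_
        by_cases h1 : |w.re - p.re| < ε
        · have h2 : p.im - ε < w.im := by
            by_contra! h2
            exact hbelow ⟨h1, h2⟩
          have h3 := abs_lt.1 hzK.2
          exact hwK ⟨h1, abs_lt.2 ⟨by linarith, by linarith⟩⟩
        · exact h1 (hz1 ▸ hzK.1)
      obtain ⟨hw1, hw2⟩ := hbelow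
      rw [abs_lt] at hw1
      set y := p.im - ε with hy
      have hyη : η / 8 ≤ y := by linarith
      -- Pass the square on the left if a slit prevents passing it on the right.
      have hside : ∃ x₁ : ℝ, 0 < x₁ ∧ |x₁ - p.re| = ε ∧
          ∀ x ∈ uIcc w.re x₁, ∀ j ∈ I, x = u j → h j < y := by
        by_cases hT : ∃ k ∈ I, w.re < u k ∧ u k ≤ p.re + ε ∧ y ≤ h k
        · obtain ⟨k, hk, hk1, hk2, hk3⟩ := hT
          have hk4 := htall k hk (hyη.trans hk3)
          refine ⟨p.re - ε, by linarith, by simp [abs_of_pos hε], fun x hx j hj hxj => ?_⟩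
          rw [uIcc_of_ge (by linarith)] at hx
          by_contra! hjy
          by_cases hjk : j = k
          · rw [hjk] at hxj
            linarith [hx.2]
          · have h1 := hsep j hj k hk (hyη.trans hjy) (hyη.trans hk3) hjk
            have h2 : |u j - u k| ≤ 2 * ε := by
              rw [abs_le, ← hxj]
              constructor <;> linarith [hx.1, hx.2]
            linarith
        · push Not at hT
          have hw0 := (mem_combDomain.1 hw).1
          refine ⟨p.re + ε, by linarith, by simp [abs_of_pos hε], fun x hx j hj hxj => ?_⟩
          rw [uIcc_of_le (by linarith)] at hx
          rcases hx.1.lt_or_eq with h1 | h1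
          · exact hT j hj (hxj ▸ h1) (hxj ▸ hx.2)
          · exact ((mem_combDomain.1 hw).2.2 j hj (h1.trans hxj)).trans_le hw2
      obtain ⟨x₁, hx₁0, hx₁ε, hx₁⟩ := hside
      have hw0 := mem_combDomain.1 hw
      have hcorner : (⟨x₁, y⟩ : ℂ) ∈ combDomain I u h := mem_combDomain.2
        ⟨hx₁0, by simpa using by linarith, fun j hj hj' => hx₁ x₁ right_mem_uIcc j hj hj'⟩
      obtain ⟨C, hC, hCc, hwC, hCT⟩ := hray K ⟨x₁, y⟩ hcorner
        (fun z hz1 _ hzK => by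
          have h1 := hzK.1
          have hz1' : z.re = x₁ := hz1
          rw [hz1', hx₁ε] at h1
          exact lt_irrefl _ h1)
      have hnotK : ∀ z : ℂ, z.im ≤ y → z ∉ K := fun z hz hzK => by
        have := abs_lt.1 hzK.2
        linarith
      refine ⟨{w.re} ×ℂ Icc w.im y ∪ (uIcc w.re x₁ ×ℂ {y} ∪ C), ?_, ?_, ?_, ?_⟩
      · refine union_subset ?_ (union_subset ?_ hC)
        · rintro z ⟨h1, h2⟩
          have h2' : z.im ∈ Icc w.im y := h2
          exact ⟨mem_combDomain_of_le hw h1 h2'.1, hnotK z h2'.2⟩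
        · rintro z ⟨h1, h2⟩
          have h1' : z.re ∈ uIcc w.re x₁ := h1
          have h2' : z.im = y := h2
          refine ⟨mem_combDomain.2 ⟨?_, by linarith, fun j hj hzj => ?_⟩, hnotK z h2'.le⟩
          · exact (lt_min hw0.1 hx₁0).trans_le h1'.1
          · rw [h2']
            exact hx₁ z.re h1' j hj hzj
      · refine IsPreconnected.union ⟨w.re, y⟩ ?_ ?_
          (isPreconnected_reProdIm ordConnected_singleton ordConnected_Icc)
          (IsPreconnected.union ⟨x₁, y⟩ ?_ hwC
            (isPreconnected_reProdIm ordConnected_uIcc ordConnected_singleton) hCc)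
        · simp [Complex.mem_reProdIm, hw2]
        · left; simp [Complex.mem_reProdIm]
        · simp [Complex.mem_reProdIm]
      · left
        simp [Complex.mem_reProdIm, hw2]
      · exact hCT.mono (inter_subset_inter_left _ (subset_union_right.trans subset_union_right))

/-- The analogue of `IsComb.exists_small_nonseparating` for the chart `w ↦ (w + 1)⁻¹` of the Riemann
sphere near the closed right half-plane, in which infinity is a point like any other. -/
theorem exists_small_nonseparating_inv (hc : IsComb I u h) {η : ℝ} (hη : 0 < η) :
    ∃ ε > 0, ∀ S ⊆ combDomain I u h, (∀ w ∈ S, ∀ w' ∈ S, ‖(w + 1)⁻¹ - (w' + 1)⁻¹‖ < ε) →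
      ∃ K : Set ℂ, S ⊆ K ∧
        (∀ w ∈ combDomain I u h ∩ K, ∀ w' ∈ combDomain I u h ∩ K,
          ‖(w + 1)⁻¹ - (w' + 1)⁻¹‖ ≤ η) ∧
        IsPreconnected (combDomain I u h \ K) := by
  obtain ⟨H, hH0, hH⟩ := hc.exists_height
  obtain ⟨ε', hε', hcut⟩ := hc.exists_small_nonseparating hη
  set R := max (H + 1) (2 / η) with hR
  have hHR : H < R := lt_of_lt_of_le (lt_add_one H) (le_max_left _ _)
  have hR0 : 0 < R := hH0.trans hHR
  set A := 2 * R + 1 with hA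
  have hA1 : 1 ≤ A := by linarith
  have hre0 : ∀ w ∈ combDomain I u h, 0 ≤ w.re := fun w hw => (mem_combDomain.1 hw).1.le
  have hdiff : ∀ w ∈ combDomain I u h, ∀ w' ∈ combDomain I u h,
      ‖(w + 1)⁻¹ - (w' + 1)⁻¹‖ * (‖w + 1‖ * ‖w' + 1‖) = ‖w - w'‖ := by
    intro w hw w' hw'
    have h1 := add_one_ne_zero_of_re_nonneg (hre0 w hw)
    have h2 := add_one_ne_zero_of_re_nonneg (hre0 w' hw')
    rw [inv_sub_inv h1 h2, norm_div, norm_mul, div_mul_cancel₀]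
    · rw [norm_sub_rev]; congr 1; ring
    · exact mul_ne_zero (norm_ne_zero_iff.2 h1) (norm_ne_zero_iff.2 h2)
  refine ⟨min (1 / (2 * A)) (ε' / (2 * A ^ 2)), by positivity, fun S hS hSε => ?_⟩
  by_cases hfar : ∀ w ∈ S, R < w.re ∨ R < w.im
  · refine ⟨{w | R < w.re ∨ R < w.im}, hfar, ?_, ?_⟩
    · have hsmall : ∀ w ∈ combDomain I u h ∩ {w | R < w.re ∨ R < w.im}, ‖(w + 1)⁻¹‖ ≤ 1 / R := by
        rintro w ⟨hw, hwR⟩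
        rw [norm_inv, ← one_div]
        refine one_div_le_one_div_of_le hR0 ?_
        have hw0 := mem_combDomain.1 hw
        rcases hwR with h1 | h1
        · have := Complex.re_le_norm (w + 1)
          simp at this
          linarith
        · have := (le_abs_self _).trans (Complex.abs_im_le_norm (w + 1))
          simp at this
          linarith
      intro w hw w' hw'
      have h1 := hsmall w hw
      have h2 := hsmall w' hw'
      have h3 : 2 / R ≤ η := by
        rw [div_le_iff₀ hR0]
        have := le_max_right (H + 1) (2 / η)
        rw [← hR, div_le_iff₀ hη] at this
        linarith
      have h4 := norm_sub_le (w + 1)⁻¹ (w' + 1)⁻¹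
      have h5 : 1 / R + 1 / R = 2 / R := by ring
      linarith
    · convert isPreconnected_near (u := u) hH0 hH hHR using 1
      ext w
      simp only [Set.mem_sdiff, mem_ofPred_eq, not_or, not_lt]
  · push Not at hfar
    obtain ⟨p, hpS, hp1, hp2⟩ := hfar
    have hpΩ := hS hpS
    have hpA : ‖p + 1‖ ≤ A := by
      have h1 := Complex.norm_le_abs_re_add_abs_im (p + 1)
      have h2 := mem_combDomain.1 hpΩ
      simp only [Complex.add_re, Complex.one_re, Complex.add_im, Complex.one_im, add_zero] at h1
      rw [abs_of_pos (by linarith), abs_of_pos h2.2.1] at h1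
      linarith
    obtain ⟨K, hK1, hK2, hK3⟩ := hcut p
    refine ⟨K, fun w hw => hK1 w (hS hw) ?_, ?_, hK3⟩
    · have h1 := hSε w hw p hpS
      have h2 := hdiff w (hS hw) p hpΩ
      have h3 : ‖(w + 1)⁻¹ - (p + 1)⁻¹‖ < 1 / (2 * A) := h1.trans_le (min_le_left _ _)
      have h4 : ‖(w + 1)⁻¹ - (p + 1)⁻¹‖ < ε' / (2 * A ^ 2) := h1.trans_le (min_le_right _ _)
      have h5 : ‖w + 1‖ ≤ ‖w - p‖ + ‖p + 1‖ := by
        have := norm_add_le (w - p) (p + 1)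
        rwa [show w - p + (p + 1) = w + 1 by ring] at this
      have hw1 : 0 < ‖w + 1‖ := one_pos.trans_le (one_le_norm_add_one (hre0 w (hS hw)))
      have h6 : ‖w - p‖ ≤ ‖w + 1‖ / 2 := by
        rw [← h2]
        calc ‖(w + 1)⁻¹ - (p + 1)⁻¹‖ * (‖w + 1‖ * ‖p + 1‖)
            ≤ 1 / (2 * A) * (‖w + 1‖ * A) := by gcongr
          _ = ‖w + 1‖ / 2 := by field_simp
      have h7 : ‖w + 1‖ ≤ 2 * A := by linarith
      rw [← h2]
      calc ‖(w + 1)⁻¹ - (p + 1)⁻¹‖ * (‖w + 1‖ * ‖p + 1‖)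
          ≤ ‖(w + 1)⁻¹ - (p + 1)⁻¹‖ * (2 * A * A) := by gcongr
        _ < ε' / (2 * A ^ 2) * (2 * A * A) := by gcongr
        _ = ε' := by field_simp
    · rintro w ⟨hw, hwK⟩ w' ⟨hw', hwK'⟩
      refine le_trans ?_ (hK2 w hwK w' hwK')
      rw [← hdiff w hw w' hw']
      refine le_mul_of_one_le_right (norm_nonneg _) ?_
      exact one_le_mul_of_one_le_of_one_le (one_le_norm_add_one (hre0 w hw))
        (one_le_norm_add_one (hre0 w' hw'))

end IsComb

/-! ### Boundary values of conformal maps onto comb domains -/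

lemma exists_mem_norm_eq {A : Set ℂ} (hA : IsPreconnected A) {c : ℂ} {r : ℝ} {z w : ℂ}
    (hz : z ∈ A) (hw : w ∈ A) (hzr : ‖z - c‖ ≤ r) (hwr : r ≤ ‖w - c‖) : ∃ ζ ∈ A, ‖ζ - c‖ = r := by
  have := hA.intermediate_value hz hw (f := fun ζ => ‖ζ - c‖) (by fun_prop) ⟨hzr, hwr⟩
  obtain ⟨ζ, h1, h2⟩ := this
  exact ⟨ζ, h1, h2⟩

/-- A conformal map of the upper half-plane onto a comb domain has a limit at the boundary point
`0`, in the Riemann sphere. Small semicircles about `0` are mapped to small crosscuts, and the side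
of the crosscut which is the image of the half-disc is contained in a small set. -/
lemma IsConformalOnto.exists_tendsto_inv_zero {I : Set ℕ} {u h : ℕ → ℝ} {Θ : ℂ → ℂ}
    (hΘ : IsConformalOnto (combDomain I u h) Θ) (hc : IsComb I u h) :
    ∃ q, Tendsto (fun z => (Θ z + 1)⁻¹) (𝓝[ℂ₊] 0) (𝓝 q) := by
  have := nhdsWithin_halfPlane_neBot (z := 0) (by simp)
  set f : ℂ → ℂ := fun z => (Θ z + 1)⁻¹ with hf
  have hre : ∀ z ∈ ℂ₊, 0 ≤ (Θ z).re := fun z hz => (mem_combDomain.1 (hΘ.mem hz)).1.le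
  have hne : ∀ z ∈ ℂ₊, Θ z + 1 ≠ 0 := fun z hz => add_one_ne_zero_of_re_nonneg (hre z hz)
  have hfd : DifferentiableOn ℂ f ℂ₊ := (hΘ.differentiableOn.add_const 1).inv hne
  have hinj : InjOn f ℂ₊ := by
    intro z hz w hw hzw
    exact hΘ.bijOn.injOn hz hw (by simpa [hf] using hzw)
  have hB : ∀ z ∈ ℂ₊, ‖f z‖ ≤ 1 := by
    intro z hz
    rw [hf]
    simp only [norm_inv]
    exact inv_le_one_of_one_le₀ (one_le_norm_add_one (hre z hz))
  have h1 : (Complex.I : ℂ) ∈ ℂ₊ := by simp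
  have h2 : (2 * Complex.I : ℂ) ∈ ℂ₊ := by simp
  have hd : 0 < ‖f Complex.I - f (2 * Complex.I)‖ := by
    rw [norm_pos_iff, sub_ne_zero]
    intro he
    have h3 := congrArg Complex.im (hinj h1 h2 he)
    norm_num at h3
  rw [← cauchy_map_iff_exists_tendsto, Metric.cauchy_iff]
  refine ⟨inferInstance, fun η hη => ?_⟩
  obtain ⟨ε, hε, hcut⟩ := hc.exists_small_nonseparating_inv
    (η := min (η / 2) (‖f Complex.I - f (2 * Complex.I)‖ / 2)) (by positivity)
  obtain ⟨r, hr, hrs⟩ := exists_semicircle_image_small hfd hinj hB hε one_pos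
  obtain ⟨K, hSK, hK, hKc⟩ := hcut (Θ '' {z | z ∈ ℂ₊ ∧ ‖z‖ = r})
    (by rintro _ ⟨z, hz, rfl⟩; exact hΘ.mem hz.1)
    (by rintro _ ⟨z, hz, rfl⟩ _ ⟨w, hw, rfl⟩; exact hrs z hz.1 w hw.1 hz.2 hw.2)
  have hfar : ∃ ζ ∈ ℂ₊, 1 ≤ ‖ζ‖ ∧ Θ ζ ∉ K := by
    by_contra! hcon
    have h3 := hK _ ⟨hΘ.mem h1, hcon _ h1 (by simp)⟩ _ ⟨hΘ.mem h2, hcon _ h2 (by simp)⟩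
    have h4 := h3.trans (min_le_right _ _)
    simp only [hf] at h4 hd
    linarith
  obtain ⟨ζ, hζ, hζ1, hζK⟩ := hfar
  have hin : ∀ z ∈ ℂ₊, ‖z‖ < r → Θ z ∈ K := by
    intro z hz hzr
    by_contra hzK
    have hpre := hΘ.isPreconnected_inv_image (A := combDomain I u h \ K)
      (fun w hw => hw.1) hKc
    obtain ⟨ξ, ⟨w, hw, rfl⟩, hξr⟩ := exists_mem_norm_eq hpre (c := 0) (r := r)
      ⟨Θ z, ⟨hΘ.mem hz, hzK⟩, hΘ.inv_apply hz⟩ ⟨Θ ζ, ⟨hΘ.mem hζ, hζK⟩, hΘ.inv_apply hζ⟩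
      (by simpa using hzr.le) (by simpa using hr.2.le.trans hζ1)
    refine hw.2 (hSK ⟨_, ⟨hΘ.inv_mem hw.1, by simpa using hξr⟩, hΘ.apply_inv hw.1⟩)
  refine ⟨f '' (ℂ₊ ∩ Metric.ball 0 r), image_mem_map ?_, ?_⟩
  · exact inter_mem self_mem_nhdsWithin (mem_nhdsWithin_of_mem_nhds (Metric.ball_mem_nhds _ hr.1))
  · rintro _ ⟨z, ⟨hz, hzr⟩, rfl⟩ _ ⟨w, ⟨hw, hwr⟩, rfl⟩
    have h3 := hK _ ⟨hΘ.mem hz, hin z hz (by simpa using hzr)⟩ _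
      ⟨hΘ.mem hw, hin w hw (by simpa using hwr)⟩
    rw [dist_eq_norm]
    have h4 := h3.trans (min_le_left _ _)
    simp only [hf]
    linarith

lemma tendsto_cocompact_of_tendsto_inv_add_one {α : Type*} {l : Filter α} {f : α → ℂ}
    (hf : Tendsto (fun z => (f z + 1)⁻¹) l (𝓝 0)) (hne : ∀ᶠ z in l, f z + 1 ≠ 0) :
    Tendsto f l (cocompact ℂ) := by
  have h1 : Tendsto (fun z => (f z + 1)⁻¹) l (𝓝[≠] 0) :=
    tendsto_nhdsWithin_of_tendsto_nhds_of_eventually_within _ hf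
      (hne.mono fun z hz => inv_ne_zero hz)
  have h2 := Filter.tendsto_inv₀_nhdsNE_zero.comp h1
  rw [Metric.cobounded_eq_cocompact] at h2
  have h3 := (Homeomorph.addRight (-1 : ℂ)).isClosedEmbedding.tendsto_cocompact.comp h2
  refine h3.congr fun z => ?_
  simp

lemma tendsto_inv_add_one_cocompact : Tendsto (fun w : ℂ => (w + 1)⁻¹) (cocompact ℂ) (𝓝 0) := by
  have h3 := (Homeomorph.addRight (1 : ℂ)).isClosedEmbedding.tendsto_cocompact
  rw [← Metric.cobounded_eq_cocompact] at h3 ⊢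
  exact Filter.tendsto_inv₀_cobounded.comp h3

lemma tendsto_neg_inv_cocompact :
    Tendsto (fun z : ℂ => -z⁻¹) (cocompact ℂ ⊓ 𝓟 ℂ₊) (𝓝[ℂ₊] 0) := by
  refine tendsto_nhdsWithin_of_tendsto_nhds_of_eventually_within _ ?_ ?_
  · rw [← Metric.cobounded_eq_cocompact]
    simpa using (Filter.tendsto_inv₀_cobounded (α := ℂ)).neg.mono_left inf_le_left
  · filter_upwards [mem_inf_of_right (mem_principal_self _)] with z hz
      using neg_inv_mem_halfPlane hz

instance cocompact_inf_halfPlane_neBot : (cocompact ℂ ⊓ 𝓟 ℂ₊).NeBot := by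
  rw [inf_principal_neBot_iff]
  intro U hU
  rw [← Metric.cobounded_eq_cocompact, (Filter.hasBasis_cobounded_norm (E := ℂ)).mem_iff] at hU
  obtain ⟨R, -, hR⟩ := hU
  refine ⟨((|R| + 1 : ℝ) : ℂ) * Complex.I, hR ?_, ?_⟩
  · simp only [mem_ofPred_eq, norm_mul, Complex.norm_real, Complex.norm_I, mul_one, Real.norm_eq_abs]
    rw [abs_of_pos (by positivity)]
    linarith [le_abs_self R]
  · simp only [mem_ofPred_eq, Complex.mul_im, Complex.ofReal_re, Complex.I_im, mul_one,
      Complex.ofReal_im, zero_mul, add_zero]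
    positivity

/-- A conformal map of the upper half-plane which extends continuously to the real axis and maps
the point at infinity, and no other boundary point, to infinity. -/
structure IsProperConformalOnto (Ω : Set ℂ) (Θ : ℂ → ℂ) : Prop extends IsConformalOnto Ω Θ where
  exists_tendsto : ∀ x : ℝ, ∃ w, Tendsto Θ (𝓝[ℂ₊] (x : ℂ)) (𝓝 w)
  tendsto_cocompact : Tendsto Θ (cocompact ℂ ⊓ 𝓟 ℂ₊) (cocompact ℂ)

/-- The extension of `f` from the open to the closed upper half-plane by its limits; it is
meaningful at the boundary points where the limit exists. -/
noncomputable def boundaryExt (f : ℂ → ℂ) : ℂ → ℂ := extendFrom ℂ₊ f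

lemma DifferentiableOn.boundaryExt_of_mem {f : ℂ → ℂ} (hf : DifferentiableOn ℂ f ℂ₊) {z : ℂ}
    (hz : z ∈ ℂ₊) : boundaryExt f z = f z :=
  extendFrom_eq (subset_closure hz) (hf z hz).continuousWithinAt

lemma DifferentiableOn.continuousOn_boundaryExt {f : ℂ → ℂ} (hf : DifferentiableOn ℂ f ℂ₊)
    (hlim : ∀ x : ℝ, ∃ w, Tendsto f (𝓝[ℂ₊] (x : ℂ)) (𝓝 w)) :
    ContinuousOn (boundaryExt f) {z : ℂ | 0 ≤ z.im} := by
  refine continuousOn_extendFrom closure_halfPlane.ge fun z hz => ?_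
  rcases (show 0 ≤ z.im from hz).lt_or_eq with h0 | h0
  · exact ⟨f z, (hf z h0).continuousWithinAt⟩
  · have : z = (z.re : ℂ) := Complex.ext (by simp) (by simp [← h0])
    rw [this]
    exact hlim z.re

/-- A conformal map onto a comb domain whose boundary values tend to infinity at `-∞` extends
continuously to the real axis and maps the point at infinity, and no other boundary point, to
infinity. If infinity were the boundary value at a real point `x₀`, then for each `r > 0` also at
`x₀ + r` or `x₀ - r`, because the part of the comb domain far out is connected, and therefore on a
whole half-line. -/
theorem IsConformalOnto.isProper {I : Set ℕ} {u h : ℕ → ℝ} {Θ : ℂ → ℂ}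
    (hΘ : IsConformalOnto (combDomain I u h) Θ) (hc : IsComb I u h) {g : ℝ → ℂ}
    (hg : ∀ᶠ x : ℝ in atBot, Tendsto Θ (𝓝[ℂ₊] (x : ℂ)) (𝓝 (g x)))
    (hginf : Tendsto g atBot (cocompact ℂ)) : IsProperConformalOnto (combDomain I u h) Θ := by
  have hre : ∀ z ∈ ℂ₊, 0 ≤ (Θ z).re := fun z hz => (mem_combDomain.1 (hΘ.mem hz)).1.le
  have hne : ∀ z ∈ ℂ₊, Θ z + 1 ≠ 0 := fun z hz => add_one_ne_zero_of_re_nonneg (hre z hz)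
  set f : ℂ → ℂ := fun z => (Θ z + 1)⁻¹ with hf
  have hfd : DifferentiableOn ℂ f ℂ₊ := (hΘ.differentiableOn.add_const 1).inv hne
  have hgne : ∀ᶠ x : ℝ in atBot, g x + 1 ≠ 0 := by
    filter_upwards [hg] with x hx
    refine add_one_ne_zero_of_re_nonneg ?_
    refine ge_of_tendsto ((Complex.continuous_re.tendsto _).comp hx) ?_
    filter_upwards [self_mem_nhdsWithin] with z hz using hre z hz
  have hgf : ∀ᶠ x : ℝ in atBot, Tendsto f (𝓝[ℂ₊] (x : ℂ)) (𝓝 (g x + 1)⁻¹) := by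
    filter_upwards [hg, hgne] with x hx hx' using (hx.add_const 1).inv₀ hx'
  have hlim : ∀ x : ℝ, ∃ q, Tendsto f (𝓝[ℂ₊] (x : ℂ)) (𝓝 q) := by
    intro x
    obtain ⟨q, hq⟩ := (hΘ.comp (isConformalOnto_add_ofReal x)).exists_tendsto_inv_zero hc
    refine ⟨q, ?_⟩
    have h1 : Tendsto (fun z : ℂ => z - x) (𝓝[ℂ₊] (x : ℂ)) (𝓝[ℂ₊] 0) := by
      refine tendsto_nhdsWithin_of_tendsto_nhds_of_eventually_within _ ?_ ?_
      · have : ContinuousAt (fun z : ℂ => z - x) x := by fun_prop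
        simpa using this.tendsto.mono_left nhdsWithin_le_nhds
      · filter_upwards [self_mem_nhdsWithin] with z hz
        have hz' : 0 < z.im := hz
        simpa using hz'
    refine (hq.comp h1).congr fun z => ?_
    simp [hf]
  have hinf : Tendsto f (cocompact ℂ ⊓ 𝓟 ℂ₊) (𝓝 0) := by
    obtain ⟨q, hq⟩ := (hΘ.comp isConformalOnto_neg_inv).exists_tendsto_inv_zero hc
    have h1 : Tendsto f (cocompact ℂ ⊓ 𝓟 ℂ₊) (𝓝 q) := by
      refine (hq.comp tendsto_neg_inv_cocompact).congr fun z => ?_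
      simp [hf]
    suffices q = 0 by rwa [this] at h1
    have hq' : Tendsto (fun x => (g x + 1)⁻¹) atBot (𝓝 q) := by
      rw [Metric.tendsto_nhds]
      intro ε hε
      have h2 := h1.eventually (Metric.closedBall_mem_nhds q (half_pos hε))
      rw [eventually_inf_principal, ← Metric.cobounded_eq_cocompact,
        (Filter.hasBasis_cobounded_norm (E := ℂ)).eventually_iff] at h2
      obtain ⟨R, -, hR⟩ := h2
      filter_upwards [hgf, eventually_lt_atBot (-|R| - 1)] with x hx hxR
      have hmem : ∀ᶠ z in 𝓝[ℂ₊] (x : ℂ), f z ∈ Metric.closedBall q (ε / 2) := by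
        have h3 : {z : ℂ | R < ‖z‖} ∈ 𝓝 (x : ℂ) := by
          refine (isOpen_lt continuous_const continuous_norm).mem_nhds ?_
          simp only [mem_ofPred_eq, Complex.norm_real, Real.norm_eq_abs]
          have := neg_le_abs x
          linarith [le_abs_self R]
        filter_upwards [self_mem_nhdsWithin, mem_nhdsWithin_of_mem_nhds h3] with z hz hz'
          using hR hz'.le hz
      have := Metric.isClosed_closedBall.mem_of_tendsto hx hmem
      exact (Metric.mem_closedBall.1 this).trans_lt (by linarith)
    exact tendsto_nhds_unique hq' (tendsto_inv_add_one_cocompact.comp hginf)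
  have hnz : ∀ x₀ : ℝ, ¬ Tendsto f (𝓝[ℂ₊] (x₀ : ℂ)) (𝓝 0) := by
    intro x₀ hx₀
    set fh := boundaryExt f with hfh
    have hfhc : ContinuousOn fh {z : ℂ | 0 ≤ z.im} := hfd.continuousOn_boundaryExt hlim
    have hfh_im : ∀ z ∈ ℂ₊, fh z = f z := fun z hz => hfd.boundaryExt_of_mem hz
    have hfh_re : ∀ x : ℝ, Tendsto f (𝓝[ℂ₊] (x : ℂ)) (𝓝 (fh x)) := fun x =>
      tendsto_extendFrom (hlim x)
    have hcross : ∀ r > 0, fh (x₀ + r : ℝ) = 0 ∨ fh (x₀ - r : ℝ) = 0 := by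
      intro r hr
      by_contra! hcon
      have hcomp : IsCompact (Metric.sphere (x₀ : ℂ) r ∩ {z : ℂ | 0 ≤ z.im}) :=
        (isCompact_sphere _ _).inter_right (isClosed_le continuous_const Complex.continuous_im)
      have hnon : (Metric.sphere (x₀ : ℂ) r ∩ {z : ℂ | 0 ≤ z.im}).Nonempty :=
        ⟨(x₀ + r : ℝ), by simp [hr.le], by simp⟩
      obtain ⟨ξ, hξ, hmin⟩ := hcomp.exists_isMinOn hnon (hfhc.mono inter_subset_right).norm
      have hξ0 : 0 < ‖fh ξ‖ := by
        rw [norm_pos_iff]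
        rcases (show 0 ≤ ξ.im from hξ.2).lt_or_eq with h0 | h0
        · rw [hfh_im ξ h0]
          exact inv_ne_zero (hne ξ h0)
        · have hξr : ξ = (ξ.re : ℂ) := Complex.ext (by simp) (by simp [← h0])
          have h1 : |ξ.re - x₀| = r := by
            have := hξ.1
            rw [mem_sphere_iff_norm, hξr, ← Complex.ofReal_sub, Complex.norm_real] at this
            exact this
          rw [hξr]
          rcases eq_or_eq_neg_of_abs_eq h1 with h2 | h2
          · rw [show ξ.re = x₀ + r by linarith]; exact hcon.1
          · rw [show ξ.re = x₀ - r by linarith]; exact hcon.2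
      set n := 1 / ‖fh ξ‖ with hn
      have hn0 : 0 < n := by positivity
      have hsmall : ∀ w ∈ combDomain I u h, (n < w.re ∨ n < w.im) → ‖(w + 1)⁻¹‖ < ‖fh ξ‖ := by
        intro w hw hwn
        have hw0 := mem_combDomain.1 hw
        have h1 : n < ‖w + 1‖ := by
          rcases hwn with h1 | h1
          · have := Complex.re_le_norm (w + 1)
            simp at this
            linarith
          · have := (le_abs_self _).trans (Complex.abs_im_le_norm (w + 1))
            simp at this
            linarith
        rw [norm_inv]
        have := inv_strictAnti₀ hn0 h1
        rwa [hn, one_div, inv_inv] at this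
      have hlarge : ∀ w ∈ combDomain I u h, ‖(w + 1)⁻¹‖ < 1 / (2 * n + 1) →
          n < w.re ∨ n < w.im := by
        intro w hw hwn
        by_contra! hcon'
        have hw0 := mem_combDomain.1 hw
        have h1 := Complex.norm_le_abs_re_add_abs_im (w + 1)
        simp only [Complex.add_re, Complex.one_re, Complex.add_im, Complex.one_im, add_zero] at h1
        rw [abs_of_pos (by linarith), abs_of_pos hw0.2.1] at h1
        rw [norm_inv, ← one_div] at hwn
        have h2 := lt_of_one_div_lt_one_div (one_pos.trans_le (one_le_norm_add_one hw0.1.le)) hwn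
        linarith
      have hball : Metric.ball (0 : ℂ) (1 / (2 * n + 1)) ∈ 𝓝 (0 : ℂ) :=
        Metric.ball_mem_nhds _ (by positivity)
      obtain ⟨z₁, ⟨hz₁, hz₁'⟩, hz₁r⟩ := (((hx₀.eventually hball).and self_mem_nhdsWithin).and
        (mem_nhdsWithin_of_mem_nhds (Metric.ball_mem_nhds (x₀ : ℂ) hr))).exists
      have hbig : ∀ᶠ z : ℂ in cocompact ℂ ⊓ 𝓟 ℂ₊, r < ‖z - x₀‖ := by
        have h3 := (tendsto_norm_cocompact_atTop (E := ℂ)).comp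
          (Homeomorph.addRight (-(x₀ : ℂ))).isClosedEmbedding.tendsto_cocompact
        have h4 := (h3.mono_left (inf_le_left (b := 𝓟 ℂ₊))).eventually (eventually_gt_atTop r)
        filter_upwards [h4] with z hz
        simpa [sub_eq_add_neg] using hz
      obtain ⟨z₂, ⟨hz₂, hz₂'⟩, hz₂r⟩ := (((hinf.eventually hball).and
        (mem_inf_of_right (mem_principal_self ℂ₊))).and hbig).exists
      have hpre := hΘ.isPreconnected_inv_image
        (A := {w | w ∈ combDomain I u h ∧ (n < w.re ∨ n < w.im)}) (fun w hw => hw.1)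
        (hc.isPreconnected_far n)
      have hz₁ : ‖f z₁‖ < 1 / (2 * n + 1) := mem_ball_zero_iff.1 hz₁
      have hz₂ : ‖f z₂‖ < 1 / (2 * n + 1) := mem_ball_zero_iff.1 hz₂
      have hz₁r : ‖z₁ - x₀‖ < r := mem_ball_iff_norm.1 hz₁r
      obtain ⟨ζ, ⟨w, hw, rfl⟩, hζr⟩ := exists_mem_norm_eq hpre (c := x₀) (r := r)
        ⟨Θ z₁, ⟨hΘ.mem hz₁', hlarge _ (hΘ.mem hz₁') hz₁⟩, hΘ.inv_apply hz₁'⟩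
        ⟨Θ z₂, ⟨hΘ.mem hz₂', hlarge _ (hΘ.mem hz₂') hz₂⟩, hΘ.inv_apply hz₂'⟩ hz₁r.le hz₂r.le
      have hwi := hΘ.inv_mem hw.1
      have h5 := hmin ⟨mem_sphere_iff_norm.2 hζr, (mem_upperHalfPlaneSet_iff.1 hwi).le⟩
      simp only [mem_ofPred_eq, hfh_im _ hwi, hf, hΘ.apply_inv hw.1] at h5
      exact absurd (hsmall w hw.1 hw.2) (not_lt.2 h5)
    obtain ⟨X, hX⟩ := eventually_atBot.1 (hgf.and hgne)
    set R := max (x₀ - X) 0 with hR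
    have hzero : ∀ x ∈ Ioo (x₀ + R) (x₀ + R + 1), Tendsto f (𝓝[ℂ₊] (x : ℂ)) (𝓝 0) := by
      intro x hx
      have hR1 := le_max_left (x₀ - X) 0
      have hR2 := le_max_right (x₀ - X) 0
      have hr : 0 < x - x₀ := by linarith [hx.1]
      have h2 : fh (x₀ - (x - x₀) : ℝ) ≠ 0 := by
        obtain ⟨h3, h4⟩ := hX (x₀ - (x - x₀)) (by linarith [hx.1])
        rw [tendsto_nhds_unique (hfh_re _) h3]
        exact inv_ne_zero h4
      have h5 := (hcross _ hr).resolve_right h2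
      have h6 := hfh_re x
      rw [show x₀ + (x - x₀) = x by ring] at h5
      rwa [h5] at h6
    have h7 := eqOn_const_of_tendsto_const_on_Ioo hfd (by linarith) hzero Complex.I (by simp)
    exact inv_ne_zero (hne Complex.I (by simp)) h7
  refine ⟨hΘ, fun x => ?_, ?_⟩
  · obtain ⟨q, hq⟩ := hlim x
    have hq0 : q ≠ 0 := by
      rintro rfl
      exact hnz x hq
    refine ⟨q⁻¹ - 1, ((hq.inv₀ hq0).sub_const 1).congr' ?_⟩
    filter_upwards [self_mem_nhdsWithin] with z hz
    simp [hf]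
  · refine tendsto_cocompact_of_tendsto_inv_add_one hinf ?_
    filter_upwards [mem_inf_of_right (mem_principal_self _)] with z hz using hne z hz

namespace IsProperConformalOnto

variable {Ω : Set ℂ} {Θ : ℂ → ℂ}

lemma tendsto_boundaryExt (hΘ : IsProperConformalOnto Ω Θ) (x : ℝ) :
    Tendsto Θ (𝓝[ℂ₊] (x : ℂ)) (𝓝 (boundaryExt Θ x)) :=
  tendsto_extendFrom (hΘ.exists_tendsto x)

lemma boundaryExt_of_mem (hΘ : IsProperConformalOnto Ω Θ) {z : ℂ} (hz : z ∈ ℂ₊) :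
    boundaryExt Θ z = Θ z :=
  hΘ.differentiableOn.boundaryExt_of_mem hz

lemma continuousOn_boundaryExt (hΘ : IsProperConformalOnto Ω Θ) :
    ContinuousOn (boundaryExt Θ) {z : ℂ | 0 ≤ z.im} :=
  hΘ.differentiableOn.continuousOn_boundaryExt hΘ.exists_tendsto

lemma continuous_boundaryExt_ofReal (hΘ : IsProperConformalOnto Ω Θ) :
    Continuous fun x : ℝ => boundaryExt Θ x :=
  hΘ.continuousOn_boundaryExt.comp_continuous Complex.continuous_ofReal fun x => by simp

lemma boundaryExt_mem_closure (hΘ : IsProperConformalOnto Ω Θ) (x : ℝ) :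
    boundaryExt Θ x ∈ closure Ω := by
  refine mem_closure_of_tendsto (hΘ.tendsto_boundaryExt x) ?_
  filter_upwards [self_mem_nhdsWithin] with z hz using hΘ.mem hz

/-- Boundary values of a conformal map lie on the boundary of the image domain. -/
lemma boundaryExt_notMem (hΘ : IsProperConformalOnto Ω Θ) (x : ℝ) : boundaryExt Θ x ∉ Ω := by
  intro hx
  have h1 := (hΘ.continuousAt_inv hx).tendsto.comp (hΘ.tendsto_boundaryExt x)
  have h2 : Tendsto (fun z : ℂ => z) (𝓝[ℂ₊] (x : ℂ)) (𝓝 (conformalInv Θ (boundaryExt Θ x))) := by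
    refine h1.congr' ?_
    filter_upwards [self_mem_nhdsWithin] with z hz using hΘ.inv_apply hz
  have h3 := tendsto_nhds_unique h2 (tendsto_id.mono_left nhdsWithin_le_nhds)
  have h4 : 0 < (conformalInv Θ (boundaryExt Θ x)).im := hΘ.inv_mem hx
  rw [h3] at h4
  simp at h4

/-- A point of the closed half-plane with boundary value outside the image domain is real. -/
lemma im_eq_zero_of_boundaryExt_notMem (hΘ : IsProperConformalOnto Ω Θ) {z : ℂ} (hz : 0 ≤ z.im)
    (h : boundaryExt Θ z ∉ Ω) : z.im = 0 := by
  by_contra hne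
  have hz' : z ∈ ℂ₊ := lt_of_le_of_ne hz (Ne.symm hne)
  rw [hΘ.boundaryExt_of_mem hz'] at h
  exact h (hΘ.mem hz')

/-- Points of the closed half-plane with bounded images are bounded. -/
lemma exists_norm_le (hΘ : IsProperConformalOnto Ω Θ) (R : ℝ) :
    ∃ R', ∀ z : ℂ, 0 ≤ z.im → ‖boundaryExt Θ z‖ ≤ R → ‖z‖ ≤ R' := by
  have h1 := (tendsto_norm_cocompact_atTop.comp hΘ.tendsto_cocompact).eventually
    (eventually_gt_atTop (R + 1))
  rw [eventually_inf_principal, ← Metric.cobounded_eq_cocompact,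
    (Filter.hasBasis_cobounded_norm (E := ℂ)).eventually_iff] at h1
  obtain ⟨R', -, hR'⟩ := h1
  refine ⟨R', fun z hz hzR => ?_⟩
  by_contra! hlt
  have := nhdsWithin_halfPlane_neBot hz
  have hcont : Tendsto Θ (𝓝[ℂ₊] z) (𝓝 (boundaryExt Θ z)) := by
    have h2 := (hΘ.continuousOn_boundaryExt z hz).mono
      (fun w (hw : w ∈ ℂ₊) => (le_of_lt hw : (0 : ℝ) ≤ w.im))
    refine h2.tendsto.congr' ?_
    filter_upwards [self_mem_nhdsWithin] with w hw using hΘ.boundaryExt_of_mem hw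
  have h3 : R + 1 ≤ ‖boundaryExt Θ z‖ := by
    refine ge_of_tendsto hcont.norm ?_
    filter_upwards [self_mem_nhdsWithin, mem_nhdsWithin_of_mem_nhds
      ((isOpen_lt continuous_const continuous_norm).mem_nhds hlt)] with w hw hw'
    exact (hR' (le_of_lt hw') hw).le
  linarith

/-- Every finite boundary point of the image domain is a boundary value. -/
lemma exists_boundaryExt_eq (hΘ : IsProperConformalOnto Ω Θ) {p : ℂ} (hp : p ∈ closure Ω)
    (hpΩ : p ∉ Ω) : ∃ x : ℝ, boundaryExt Θ x = p := by
  obtain ⟨R', hR'⟩ := hΘ.exists_norm_le (‖p‖ + 1)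
  have hS : IsCompact (Metric.closedBall (0 : ℂ) R' ∩ {z : ℂ | 0 ≤ z.im}) :=
    (isCompact_closedBall _ _).inter_right (isClosed_le continuous_const Complex.continuous_im)
  have himg := hS.image_of_continuousOn (hΘ.continuousOn_boundaryExt.mono inter_subset_right)
  have hmem : p ∈ boundaryExt Θ '' (Metric.closedBall (0 : ℂ) R' ∩ {z : ℂ | 0 ≤ z.im}) := by
    rw [← himg.isClosed.closure_eq, Metric.mem_closure_iff]
    intro ε hε
    obtain ⟨w, hw, hwp⟩ := Metric.mem_closure_iff.1 hp (min ε 1) (by positivity)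
    have hz := hΘ.inv_mem hw
    have hzw : boundaryExt Θ (conformalInv Θ w) = w := by
      rw [hΘ.boundaryExt_of_mem hz, hΘ.apply_inv hw]
    refine ⟨w, ⟨conformalInv Θ w, ⟨?_, (mem_upperHalfPlaneSet_iff.1 hz).le⟩, hzw⟩,
      hwp.trans_le (min_le_left _ _)⟩
    rw [mem_closedBall_zero_iff]
    refine hR' _ (mem_upperHalfPlaneSet_iff.1 hz).le ?_
    rw [hzw]
    have h1 : ‖w - p‖ ≤ 1 := by
      rw [← dist_eq_norm, dist_comm]
      exact hwp.le.trans (min_le_right _ _)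
    have h2 := norm_add_le (w - p) p
    rw [sub_add_cancel] at h2
    linarith
  obtain ⟨z, ⟨-, hz0⟩, hz⟩ := hmem
  have him := hΘ.im_eq_zero_of_boundaryExt_notMem hz0 (by rwa [hz])
  refine ⟨z.re, ?_⟩
  rw [← hz]
  congr 1
  exact Complex.ext (by simp) (by simp [him])

lemma not_boundaryExt_const (hΘ : IsProperConformalOnto Ω Θ) {α β : ℝ} (hαβ : α < β) (c : ℂ) :
    ¬ ∀ x ∈ Ioo α β, boundaryExt Θ x = c := by
  intro hcon
  have h := eqOn_const_of_tendsto_const_on_Ioo hΘ.differentiableOn hαβ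
    (fun x hx => by simpa [hcon x hx] using hΘ.tendsto_boundaryExt x)
  have h1 : (Complex.I : ℂ) ∈ ℂ₊ := by simp
  have h2 : (2 * Complex.I : ℂ) ∈ ℂ₊ := by simp
  have h3 := congrArg Complex.im (hΘ.bijOn.injOn h1 h2 ((h _ h1).trans (h _ h2).symm))
  norm_num at h3

/-- If arbitrarily small neighbourhoods of a compact set `C` of boundary points contain connected
subsets of `Ω` which come, under `Θ`, from points arbitrarily near to `x₁` and `x₂`, then all
boundary values between `x₁` and `x₂` lie in `C`: the preimages of these connected sets cross every
vertical line in between. -/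
theorem boundaryExt_mem_of_crossing (hΘ : IsProperConformalOnto Ω Θ) {C : Set ℂ} (hC : IsCompact C)
    (hCΩ : ∀ c ∈ C, c ∉ Ω) {x₁ x₂ : ℝ}
    (h : ∀ ε > 0, ∃ A ⊆ Ω, IsPreconnected A ∧ (∀ w ∈ A, ∃ c ∈ C, dist w c ≤ ε) ∧
      (∃ᶠ z in 𝓝[ℂ₊] (x₁ : ℂ), Θ z ∈ A) ∧ ∃ᶠ z in 𝓝[ℂ₊] (x₂ : ℂ), Θ z ∈ A)
    {x : ℝ} (hx : x ∈ Ioo x₁ x₂) : boundaryExt Θ x ∈ C := by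
  obtain ⟨B, hB⟩ := hC.isBounded.exists_norm_le
  obtain ⟨R', hR'⟩ := hΘ.exists_norm_le (B + 1)
  have hS : IsCompact (Metric.closedBall (0 : ℂ) R' ∩ {z : ℂ | 0 ≤ z.im ∧ z.re = x}) := by
    refine (isCompact_closedBall _ _).inter_right ?_
    exact (isClosed_le continuous_const Complex.continuous_im).inter
      (isClosed_eq Complex.continuous_re continuous_const)
  have hcross : ∀ ε > 0, ε ≤ 1 → ∃ ζ ∈ Metric.closedBall (0 : ℂ) R' ∩ {z : ℂ | 0 ≤ z.im ∧ z.re = x},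
      ∃ c ∈ C, dist (boundaryExt Θ ζ) c ≤ ε := by
    intro ε hε hε1
    obtain ⟨A, hAΩ, hA, hAC, hf1, hf2⟩ := h ε hε
    have hlt : {z : ℂ | z.re < x} ∈ 𝓝 (x₁ : ℂ) :=
      (isOpen_lt Complex.continuous_re continuous_const).mem_nhds (by simpa using hx.1)
    have hgt : {z : ℂ | x < z.re} ∈ 𝓝 (x₂ : ℂ) :=
      (isOpen_lt continuous_const Complex.continuous_re).mem_nhds (by simpa using hx.2)
    obtain ⟨z₁, hz₁A, hz₁, hz₁x⟩ := (hf1.and_eventually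
      ((eventually_mem_nhdsWithin (s := ℂ₊)).and (mem_nhdsWithin_of_mem_nhds hlt))).exists
    obtain ⟨z₂, hz₂A, hz₂, hz₂x⟩ := (hf2.and_eventually
      ((eventually_mem_nhdsWithin (s := ℂ₊)).and (mem_nhdsWithin_of_mem_nhds hgt))).exists
    obtain ⟨ζ, ⟨w, hw, rfl⟩, hζ⟩ := (hΘ.isPreconnected_inv_image hAΩ hA).intermediate_value
      ⟨Θ z₁, hz₁A, hΘ.inv_apply hz₁⟩ ⟨Θ z₂, hz₂A, hΘ.inv_apply hz₂⟩
      Complex.continuous_re.continuousOn ⟨le_of_lt hz₁x, le_of_lt hz₂x⟩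
    have hi := hΘ.inv_mem (hAΩ hw)
    have hw' : boundaryExt Θ (conformalInv Θ w) = w := by
      rw [hΘ.boundaryExt_of_mem hi, hΘ.apply_inv (hAΩ hw)]
    obtain ⟨c, hc, hwc⟩ := hAC w hw
    refine ⟨conformalInv Θ w, ⟨?_, (mem_upperHalfPlaneSet_iff.1 hi).le, hζ⟩, c, hc, by rwa [hw']⟩
    rw [mem_closedBall_zero_iff]
    refine hR' _ (mem_upperHalfPlaneSet_iff.1 hi).le ?_
    rw [hw']
    have h1 := hB c hc
    have h2 := norm_add_le (w - c) c
    rw [sub_add_cancel, ← dist_eq_norm] at h2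
    linarith
  obtain ⟨ζ₁, hζ₁, c₁, hc₁, -⟩ := hcross 1 one_pos le_rfl
  obtain ⟨ζ, hζ, hmin⟩ := hS.exists_isMinOn ⟨ζ₁, hζ₁⟩
    ((Metric.continuous_infDist_pt C).comp_continuousOn
      (hΘ.continuousOn_boundaryExt.mono fun z hz => hz.2.1))
  have hζC : boundaryExt Θ ζ ∈ C := by
    rw [hC.isClosed.mem_iff_infDist_zero ⟨c₁, hc₁⟩]
    refine le_antisymm (le_of_forall_pos_le_add fun ε hε => ?_) Metric.infDist_nonneg
    obtain ⟨ξ, hξ, c, hc, hd⟩ := hcross (min ε 1) (by positivity) (min_le_right _ _)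
    have h1 : Metric.infDist (boundaryExt Θ ζ) C ≤ Metric.infDist (boundaryExt Θ ξ) C := hmin hξ
    have h2 := Metric.infDist_le_dist_of_mem (x := boundaryExt Θ ξ) hc
    have h3 := hd.trans (min_le_left _ _)
    linarith
  have him := hΘ.im_eq_zero_of_boundaryExt_notMem hζ.2.1 (hCΩ _ hζC)
  have hζx : ζ = (x : ℂ) := Complex.ext (by simp [hζ.2.2]) (by simp [him])
  rwa [hζx] at hζC

lemma mem_slitPreimage_iff (hΘ : IsProperConformalOnto Ω Θ) {s t x : ℝ} :
    x ∈ slitPreimage Θ s t ↔ boundaryExt Θ x ∈ slit s t := by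
  constructor
  · rintro ⟨w, hw, h⟩
    rwa [tendsto_nhds_unique (hΘ.tendsto_boundaryExt x) h]
  · exact fun h => ⟨_, h, hΘ.tendsto_boundaryExt x⟩

end IsProperConformalOnto

/-! ### The preimages of the slits -/

lemma slit_notMem_combDomain {I : Set ℕ} {u h : ℕ → ℝ} {j : ℕ} (hj : j ∈ I) {p : ℂ}
    (hp : p ∈ slit (u j) (h j)) : p ∉ combDomain I u h := fun hcon =>
  absurd ((mem_combDomain.1 hcon).2.2 j hj hp.1) (not_lt.2 hp.2.2)

lemma nonneg_of_mem_closure_combDomain {I : Set ℕ} {u h : ℕ → ℝ} {p : ℂ}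
    (hp : p ∈ closure (combDomain I u h)) : 0 ≤ p.re ∧ 0 ≤ p.im := by
  have hcl : IsClosed {w : ℂ | 0 ≤ w.re ∧ 0 ≤ w.im} :=
    (isClosed_le continuous_const Complex.continuous_re).inter
      (isClosed_le continuous_const Complex.continuous_im)
  refine closure_minimal (fun w hw => ?_) hcl hp
  have := mem_combDomain.1 hw
  exact ⟨this.1.le, this.2.1.le⟩

lemma exists_slit_of_notMem_combDomain {I : Set ℕ} {u h : ℕ → ℝ} {p : ℂ}
    (hp : p ∉ combDomain I u h) (hre : 0 < p.re) (him : 0 < p.im) :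
    ∃ j ∈ I, p ∈ slit (u j) (h j) := by
  rw [mem_combDomain] at hp
  push Not at hp
  obtain ⟨j, hj, h1, h2⟩ := hp hre him
  exact ⟨j, hj, h1, him, h2⟩

lemma disjoint_slit {I : Set ℕ} {u h : ℕ → ℝ} (hc : IsComb I u h) {j k : ℕ} (hj : j ∈ I)
    (hk : k ∈ I) {p : ℂ} (hpj : p ∈ slit (u j) (h j)) (hpk : p ∈ slit (u k) (h k)) : j = k :=
  hc.u_inj hj hk (hpj.1.symm.trans hpk.1)

namespace IsComb

variable {I : Set ℕ} {u h : ℕ → ℝ}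

/-- A slit is a two-sided boundary arc of the comb domain. -/
lemma slit_subset_closure (hc : IsComb I u h) {j : ℕ} (hj : j ∈ I) {p : ℂ}
    (hp : p ∈ slit (u j) (h j)) : p ∈ closure (combDomain I u h) := by
  obtain ⟨ε, hε, -, -, hsep⟩ := hc.exists_separation (δ := p.im) (η := 1) hp.2.1 one_pos
  have hlim : Tendsto (fun t : ℝ => p + (t : ℂ)) (𝓝[>] 0) (𝓝 p) := by
    have : ContinuousAt (fun t : ℝ => p + (t : ℂ)) 0 := by fun_prop
    simpa using this.tendsto.mono_left nhdsWithin_le_nhds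
  refine mem_closure_of_tendsto hlim ?_
  filter_upwards [Ioo_mem_nhdsGT hε] with t ht
  have hpu := hp.1
  rw [mem_combDomain]
  refine ⟨by simpa [hpu] using by linarith [hc.u_pos j hj, ht.1], by simpa using hp.2.1,
    fun k hk hkt => ?_⟩
  simp only [Complex.add_re, Complex.ofReal_re, Complex.add_im, Complex.ofReal_im, add_zero]
    at hkt ⊢
  by_contra! hcon
  have hjk : j ≠ k := by
    rintro rfl
    linarith [ht.1]
  have h1 := hsep j hj k hk hp.2.2 hcon hjk
  rw [← hkt, hpu, show u j - (u j + t) = -t by ring, abs_neg, abs_of_pos ht.1] at h1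
  linarith [ht.2]

/-- Boundary points of the comb domain near a point of a slit belong to that slit. -/
lemma eventually_mem_slit (hc : IsComb I u h) {j : ℕ} (hj : j ∈ I) {p : ℂ}
    (hp : p ∈ slit (u j) (h j)) :
    ∀ᶠ w in 𝓝 p, w ∉ combDomain I u h → w ∈ slit (u j) (h j) := by
  have hp0 : 0 < p.im / 2 := half_pos hp.2.1
  obtain ⟨ε, hε, -, -, hsep⟩ := hc.exists_separation (δ := p.im / 2) (η := 1) hp0 one_pos
  have h1 : ∀ᶠ w : ℂ in 𝓝 p, p.im / 2 < w.im :=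
    Complex.continuous_im.continuousAt.eventually (lt_mem_nhds (by linarith))
  have h2 : ∀ᶠ w : ℂ in 𝓝 p, 0 < w.re :=
    Complex.continuous_re.continuousAt.eventually (lt_mem_nhds (by
      rw [hp.1]
      exact hc.u_pos j hj))
  have h3 : ∀ᶠ w : ℂ in 𝓝 p, |p.re - w.re| < ε := by
    have : ContinuousAt (fun w : ℂ => |p.re - w.re|) p := by fun_prop
    exact this.eventually (gt_mem_nhds (by simpa using hε))
  filter_upwards [h1, h2, h3] with w hw1 hw2 hw3 hw
  obtain ⟨k, hk, hwk⟩ := exists_slit_of_notMem_combDomain hw hw2 (hp0.trans hw1)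
  suffices j = k by rwa [this]
  by_contra hjk
  have h4 := hsep j hj k hk (by linarith [hp.2.2]) (hw1.le.trans hwk.2.2) hjk
  rw [← hp.1, ← hwk.1] at h4
  linarith

/-- The part of a comb domain in a narrow rectangle about the upper part of a slit is connected. -/
lemma isPreconnected_around_slit {j : ℕ} {v ε : ℝ} (hv : 0 < v)
    (hvh : v ≤ h j) (hε : 0 < ε) (hεu : 4 * ε ≤ u j)
    (hsep : ∀ k ∈ I, v ≤ h k → j ≠ k → 4 * ε ≤ |u j - u k|) :
    IsPreconnected (combDomain I u h ∩ Ioo (u j - ε) (u j + ε) ×ℂ Ioo (v - ε) (h j + ε)) := by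
  refine isPreconnected_of_joined (T := Ioo (u j - ε) (u j + ε) ×ℂ Ioo (h j) (h j + ε)) ?_
    (isPreconnected_reProdIm ordConnected_Ioo ordConnected_Ioo) ?_
  · rintro w ⟨h1, h2⟩
    have h1' : w.re ∈ Ioo (u j - ε) (u j + ε) := h1
    have h2' : w.im ∈ Ioo (h j) (h j + ε) := h2
    refine ⟨mem_combDomain.2 ⟨by linarith [h1'.1], by linarith [h2'.1], fun k hk hwk => ?_⟩, h1',
      by linarith [h2'.1], h2'.2⟩
    by_contra! hcon
    by_cases hjk : j = k
    · rw [← hjk] at hcon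
      linarith [h2'.1]
    · have h3 := hsep k hk (by linarith [h2'.1]) hjk
      have h4 : |u j - u k| ≤ ε := by
        rw [← hwk, abs_le]
        constructor <;> linarith [h1'.1, h1'.2]
      linarith
  · rintro w ⟨hw, h1, h2⟩
    have h1' : w.re ∈ Ioo (u j - ε) (u j + ε) := h1
    have h2' : w.im ∈ Ioo (v - ε) (h j + ε) := h2
    refine ⟨{w.re} ×ℂ Ico w.im (h j + ε), ?_,
      isPreconnected_reProdIm ordConnected_singleton ordConnected_Ico,
      by simp [Complex.mem_reProdIm, h2'.2], ⟨w.re, max w.im (h j + ε / 2)⟩, ?_, ?_⟩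
    · rintro z ⟨h3, h4⟩
      have h3' : z.re = w.re := h3
      have h4' : z.im ∈ Ico w.im (h j + ε) := h4
      refine ⟨mem_combDomain_of_le hw h3' h4'.1, ?_, ?_⟩
      · rw [← h3'] at h1'
        exact h1'
      · exact ⟨h2'.1.trans_le h4'.1, h4'.2⟩
    · simp only [Complex.mem_reProdIm, mem_singleton_iff, mem_Ico, le_max_left, true_and]
      exact max_lt h2'.2 (by linarith)
    · simp only [Complex.mem_reProdIm]
      exact ⟨h1', lt_max_of_lt_right (by linarith), max_lt h2'.2 (by linarith)⟩

/-- The boundary preimage of a slit is a bounded open interval with the endpoints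
`gapLeft` and `gapRight`. -/
theorem slitPreimage_eq_Ioo (hc : IsComb I u h) {Θ : ℂ → ℂ}
    (hΘ : IsProperConformalOnto (combDomain I u h) Θ) {j : ℕ} (hj : j ∈ I) :
    gapLeft Θ (u j) (h j) < gapRight Θ (u j) (h j) ∧
      slitPreimage Θ (u j) (h j) = Ioo (gapLeft Θ (u j) (h j)) (gapRight Θ (u j) (h j)) := by
  set S := slitPreimage Θ (u j) (h j) with hS
  have hmem : ∀ x, x ∈ S ↔ boundaryExt Θ x ∈ slit (u j) (h j) := fun x =>
    hΘ.mem_slitPreimage_iff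
  have hne : S.Nonempty := by
    have hp : (⟨u j, h j⟩ : ℂ) ∈ slit (u j) (h j) := ⟨rfl, hc.h_pos j hj, le_rfl⟩
    obtain ⟨x, hx⟩ := hΘ.exists_boundaryExt_eq (hc.slit_subset_closure hj hp)
      (slit_notMem_combDomain hj hp)
    exact ⟨x, (hmem x).2 (hx ▸ hp)⟩
  have hopen : IsOpen S := by
    rw [isOpen_iff_mem_nhds]
    intro x hx
    have h1 := hΘ.continuous_boundaryExt_ofReal.continuousAt.eventually
      (hc.eventually_mem_slit hj ((hmem x).1 hx))
    filter_upwards [h1] with y hy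
    exact (hmem y).2 (hy (hΘ.boundaryExt_notMem y))
  have hbdd : ∃ R, ∀ x ∈ S, |x| ≤ R := by
    obtain ⟨R, hR⟩ := hΘ.exists_norm_le (|u j| + |h j|)
    refine ⟨R, fun x hx => ?_⟩
    have h1 := hR x (by simp) ?_
    · simpa using h1
    · have h2 := (hmem x).1 hx
      refine (Complex.norm_le_abs_re_add_abs_im _).trans ?_
      rw [h2.1]
      gcongr
      exact h2.2.1.le
      exact h2.2.2
  obtain ⟨R, hR⟩ := hbdd
  have hbelow : BddBelow S := ⟨-R, fun x hx => (abs_le.1 (hR x hx)).1⟩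
  have habove : BddAbove S := ⟨R, fun x hx => (abs_le.1 (hR x hx)).2⟩
  have hord : S.OrdConnected := by
    refine ordConnected_of_Ioo fun x₁ hx₁ x₂ hx₂ _ x hx => ?_
    have hp₁ := (hmem x₁).1 hx₁
    have hp₂ := (hmem x₂).1 hx₂
    set v := min (boundaryExt Θ x₁).im (boundaryExt Θ x₂).im with hv
    have hv0 : 0 < v := lt_min hp₁.2.1 hp₂.2.1
    have hvh : v ≤ h j := (min_le_left _ _).trans hp₁.2.2
    have hCslit : {u j} ×ℂ Icc v (h j) ⊆ slit (u j) (h j) := fun w hw =>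
      ⟨hw.1, hv0.trans_le hw.2.1, hw.2.2⟩
    refine (hmem x).2 (hCslit (hΘ.boundaryExt_mem_of_crossing (C := {u j} ×ℂ Icc v (h j))
      (isCompact_singleton.reProdIm isCompact_Icc)
      (fun c hcC => slit_notMem_combDomain hj (hCslit hcC)) (fun η hη => ?_) hx))
    obtain ⟨ε, hε, hεη, htall, hsep⟩ := hc.exists_separation hv0 (half_pos hη)
    refine ⟨_, inter_subset_left, isPreconnected_around_slit hv0 hvh hε (htall j hj hvh)
      (fun k hk hvk hjk => hsep j hj k hk hvh hvk hjk), ?_, ?_⟩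
    · rintro w ⟨-, h1, h2⟩
      have h1' : w.re ∈ Ioo (u j - ε) (u j + ε) := h1
      have h2' : w.im ∈ Ioo (v - ε) (h j + ε) := h2
      refine ⟨⟨u j, max v (min w.im (h j))⟩, ⟨rfl, le_max_left _ _, max_le hvh (min_le_right _ _)⟩,
        ?_⟩
      rw [dist_eq_norm]
      refine (Complex.norm_le_abs_re_add_abs_im _).trans ?_
      have e1 : |(w - ⟨u j, max v (min w.im (h j))⟩ : ℂ).re| ≤ ε := by
        simp only [Complex.sub_re]
        rw [abs_le]
        constructor <;> linarith [h1'.1, h1'.2]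
      have e2 : |(w - ⟨u j, max v (min w.im (h j))⟩ : ℂ).im| ≤ ε := by
        simp only [Complex.sub_im]
        rw [abs_le]
        rcases le_total w.im (h j) with h3 | h3
        · rw [min_eq_left h3]
          rcases le_total v w.im with h4 | h4
          · rw [max_eq_right h4]; constructor <;> linarith
          · rw [max_eq_left h4]; constructor <;> linarith [h2'.1]
        · rw [min_eq_right h3, max_eq_right hvh]
          constructor <;> linarith [h2'.2]
      linarith
    · have hnhds : ∀ p ∈ slit (u j) (h j), v ≤ p.im →
          Ioo (u j - ε) (u j + ε) ×ℂ Ioo (v - ε) (h j + ε) ∈ 𝓝 p := by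
        intro p hp hvp
        refine (isOpen_Ioo.reProdIm isOpen_Ioo).mem_nhds ⟨?_, ?_⟩
        · have hpu := hp.1
          exact ⟨by linarith, by linarith⟩
        · exact ⟨by linarith, by linarith [hp.2.2]⟩
      have hfreq : ∀ y : ℝ, boundaryExt Θ y ∈ slit (u j) (h j) → v ≤ (boundaryExt Θ y).im →
          ∃ᶠ z in 𝓝[ℂ₊] (y : ℂ),
            Θ z ∈ combDomain I u h ∩ Ioo (u j - ε) (u j + ε) ×ℂ Ioo (v - ε) (h j + ε) := by
        intro y hy hvy
        refine Eventually.frequently ?_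
        filter_upwards [hΘ.tendsto_boundaryExt y (hnhds _ hy hvy), self_mem_nhdsWithin] with z h1 h2
          using ⟨hΘ.mem h2, h1⟩
      exact ⟨hfreq x₁ hp₁ (min_le_left _ _), hfreq x₂ hp₂ (min_le_right _ _)⟩
  have hsub : S ⊆ Ioo (sInf S) (sSup S) := by
    intro x hx
    obtain ⟨ε, hε, hball⟩ := Metric.isOpen_iff.1 hopen x hx
    have h1 : x - ε / 2 ∈ S := hball (by simp [abs_of_pos hε, hε])
    have h2 : x + ε / 2 ∈ S := hball (by simp [abs_of_pos hε, hε])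
    exact ⟨(csInf_le hbelow h1).trans_lt (by linarith), lt_of_lt_of_le (by linarith)
      (le_csSup habove h2)⟩
  have hsup : Ioo (sInf S) (sSup S) ⊆ S :=
    IsConnected.Ioo_csInf_csSup_subset ⟨hne, hord.isPreconnected⟩ hbelow habove
  refine ⟨?_, hsub.antisymm hsup⟩
  obtain ⟨x, hx⟩ := hne
  exact (hsub hx).1.trans (hsub hx).2

/-- High up on the imaginary axis, boundary points of the comb domain are simple: they are boundary
values at one real point only. -/
lemma exists_forall_boundaryExt_injective (hc : IsComb I u h) {Θ : ℂ → ℂ}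
    (hΘ : IsProperConformalOnto (combDomain I u h) Θ) :
    ∃ V : ℝ, ∀ v > V, ∀ x₁ x₂ : ℝ, boundaryExt Θ x₁ = v * Complex.I →
      boundaryExt Θ x₂ = v * Complex.I → x₁ = x₂ := by
  obtain ⟨H, hH0, hH⟩ := hc.exists_height
  refine ⟨H, fun v hv => ?_⟩
  suffices hlt : ∀ x₁ x₂ : ℝ, x₁ < x₂ → boundaryExt Θ x₁ = v * Complex.I →
      boundaryExt Θ x₂ ≠ v * Complex.I by
    intro x₁ x₂ h1 h2
    rcases lt_trichotomy x₁ x₂ with h3 | h3 | h3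
    · exact absurd h2 (hlt x₁ x₂ h3 h1)
    · exact h3
    · exact absurd h1 (hlt x₂ x₁ h3 h2)
  intro x₁ x₂ hlt h1 h2
  refine hΘ.not_boundaryExt_const hlt (v * Complex.I) fun x hx => ?_
  refine hΘ.boundaryExt_mem_of_crossing (C := {(v * Complex.I : ℂ)}) isCompact_singleton ?_
    (fun η hη => ?_) hx
  · rintro c rfl hcon
    have := (mem_combDomain.1 hcon).1
    simp at this
  set ε := min (η / 2) (v - H) with hεd
  have hε : 0 < ε := lt_min (half_pos hη) (by linarith)
  have hε1 : ε ≤ η / 2 := min_le_left _ _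
  have hε2 : ε ≤ v - H := min_le_right _ _
  refine ⟨Ioo 0 ε ×ℂ Ioo (v - ε) (v + ε), ?_,
    isPreconnected_reProdIm ordConnected_Ioo ordConnected_Ioo, ?_, ?_⟩
  · rintro w ⟨h3, h4⟩
    have h3' : w.re ∈ Ioo 0 ε := h3
    have h4' : w.im ∈ Ioo (v - ε) (v + ε) := h4
    exact mem_combDomain.2 ⟨h3'.1, by linarith [h4'.1], fun j hj _ => by
      linarith [h4'.1, hH j hj]⟩
  · rintro w ⟨h3, h4⟩
    have h3' : w.re ∈ Ioo 0 ε := h3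
    have h4' : w.im ∈ Ioo (v - ε) (v + ε) := h4
    refine ⟨_, rfl, ?_⟩
    rw [dist_eq_norm]
    refine (Complex.norm_le_abs_re_add_abs_im _).trans ?_
    have e1 : |(w - v * Complex.I).re| ≤ ε := by
      simp only [Complex.sub_re, Complex.mul_re, Complex.ofReal_re, Complex.I_re, mul_zero,
        Complex.ofReal_im, Complex.I_im, mul_one, sub_self, sub_zero]
      rw [abs_of_pos h3'.1]
      exact h3'.2.le
    have e2 : |(w - v * Complex.I).im| ≤ ε := by
      simp only [Complex.sub_im, Complex.mul_im, Complex.ofReal_re, Complex.I_im, mul_one,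
        Complex.ofReal_im, Complex.I_re, mul_zero, add_zero]
      rw [abs_le]
      constructor <;> linarith [h4'.1, h4'.2]
    linarith
  · have hfreq : ∀ y : ℝ, boundaryExt Θ y = v * Complex.I →
        ∃ᶠ z in 𝓝[ℂ₊] (y : ℂ), Θ z ∈ Ioo 0 ε ×ℂ Ioo (v - ε) (v + ε) := by
      intro y hy
      refine Eventually.frequently ?_
      have h3 : Iio ε ×ℂ Ioo (v - ε) (v + ε) ∈ 𝓝 (boundaryExt Θ y) := by
        refine (isOpen_Iio.reProdIm isOpen_Ioo).mem_nhds ?_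
        rw [hy]
        simp [Complex.mem_reProdIm, hε]
      filter_upwards [hΘ.tendsto_boundaryExt y h3, self_mem_nhdsWithin] with z h4 h5
      exact ⟨⟨(mem_combDomain.1 (hΘ.mem h5)).1, h4.1⟩, h4.2⟩
    exact ⟨hfreq x₁ h1, hfreq x₂ h2⟩

end IsComb

/-! ### The comparison map and its boundary values -/

section comparisonMap

variable {Ω Ω' : Set ℂ} {Θ Θ' : ℂ → ℂ}

lemma comparisonMap_mem (hΘ : IsProperConformalOnto Ω Θ) (hΘ' : IsProperConformalOnto Ω' Θ')
    (hsub : Ω ⊆ Ω') {z : ℂ} (hz : z ∈ ℂ₊) : comparisonMap Θ' Θ z ∈ ℂ₊ :=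
  hΘ'.inv_mem (hsub (hΘ.mem hz))

lemma apply_comparisonMap (hΘ : IsProperConformalOnto Ω Θ) (hΘ' : IsProperConformalOnto Ω' Θ')
    (hsub : Ω ⊆ Ω') {z : ℂ} (hz : z ∈ ℂ₊) : Θ' (comparisonMap Θ' Θ z) = Θ z :=
  hΘ'.apply_inv (hsub (hΘ.mem hz))

lemma differentiableOn_comparisonMap (hΘ : IsProperConformalOnto Ω Θ)
    (hΘ' : IsProperConformalOnto Ω' Θ') (hsub : Ω ⊆ Ω') :
    DifferentiableOn ℂ (comparisonMap Θ' Θ) ℂ₊ :=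
  hΘ'.differentiableOn_inv.comp hΘ.differentiableOn fun _ hz => hsub (hΘ.mem hz)

lemma tendsto_comparisonMap_cocompact (hΘ : IsProperConformalOnto Ω Θ)
    (hΘ' : IsProperConformalOnto Ω' Θ') (hsub : Ω ⊆ Ω') :
    Tendsto (comparisonMap Θ' Θ) (cocompact ℂ ⊓ 𝓟 ℂ₊) (cocompact ℂ) := by
  rw [hasBasis_cocompact.tendsto_right_iff]
  intro K hK
  have hK' : IsCompact (boundaryExt Θ' '' (K ∩ {z : ℂ | 0 ≤ z.im})) :=
    (hK.inter_right (isClosed_le continuous_const Complex.continuous_im)).image_of_continuousOn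
      (hΘ'.continuousOn_boundaryExt.mono inter_subset_right)
  filter_upwards [hΘ.tendsto_cocompact hK'.compl_mem_cocompact,
    mem_inf_of_right (mem_principal_self _)] with z hz hz' hzK
  have h1 := comparisonMap_mem hΘ hΘ' hsub hz'
  refine hz ⟨_, ⟨hzK, (mem_upperHalfPlaneSet_iff.1 h1).le⟩, ?_⟩
  rw [hΘ'.boundaryExt_of_mem h1, apply_comparisonMap hΘ hΘ' hsub hz']

/-- The comparison map `Θ'⁻¹ ∘ Θ` extends continuously to the real axis. If there were two cluster
points at `x`, then `Θ'` would be constant between them. -/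
theorem exists_tendsto_comparisonMap (hΘ : IsProperConformalOnto Ω Θ)
    (hΘ' : IsProperConformalOnto Ω' Θ') (hsub : Ω ⊆ Ω') (x : ℝ) :
    ∃ ζ : ℂ, 0 ≤ ζ.im ∧ Tendsto (comparisonMap Θ' Θ) (𝓝[ℂ₊] (x : ℂ)) (𝓝 ζ) ∧
      boundaryExt Θ' ζ = boundaryExt Θ x := by
  set φ := comparisonMap Θ' Θ with hφ
  set p := boundaryExt Θ x with hp
  have hlim := hΘ.tendsto_boundaryExt x
  by_cases hpΩ : p ∈ Ω'
  · have hi := hΘ'.inv_mem hpΩ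
    refine ⟨conformalInv Θ' p, (mem_upperHalfPlaneSet_iff.1 hi).le,
      (hΘ'.continuousAt_inv hpΩ).tendsto.comp hlim, ?_⟩
    rw [hΘ'.boundaryExt_of_mem hi, hΘ'.apply_inv hpΩ]
  obtain ⟨R', hR'⟩ := hΘ'.exists_norm_le (‖p‖ + 1)
  set S := Metric.closedBall (0 : ℂ) R' ∩ {z : ℂ | 0 ≤ z.im} with hSd
  have hS : IsCompact S :=
    (isCompact_closedBall _ _).inter_right (isClosed_le continuous_const Complex.continuous_im)
  have hφS : ∀ᶠ z in 𝓝[ℂ₊] (x : ℂ), φ z ∈ S := by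
    have h1 : ∀ᶠ z in 𝓝[ℂ₊] (x : ℂ), ‖Θ z‖ < ‖p‖ + 1 :=
      hlim.norm.eventually (gt_mem_nhds (lt_add_one _))
    filter_upwards [h1, self_mem_nhdsWithin] with z hz hz'
    have h2 := comparisonMap_mem hΘ hΘ' hsub hz'
    refine ⟨?_, (mem_upperHalfPlaneSet_iff.1 h2).le⟩
    rw [mem_closedBall_zero_iff]
    refine hR' _ (mem_upperHalfPlaneSet_iff.1 h2).le ?_
    rw [hΘ'.boundaryExt_of_mem h2, apply_comparisonMap hΘ hΘ' hsub hz']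
    exact hz.le
  have hcl : ∀ ζ ∈ S, MapClusterPt ζ (𝓝[ℂ₊] (x : ℂ)) φ → boundaryExt Θ' ζ = p := by
    intro ζ hζ hcl
    obtain ⟨U, hU, hUζ⟩ := mapClusterPt_iff_ultrafilter.1 hcl
    have h1 : Tendsto φ U (𝓝[{z : ℂ | 0 ≤ z.im}] ζ) := by
      refine tendsto_nhdsWithin_of_tendsto_nhds_of_eventually_within _ hUζ ?_
      exact hU (hφS.mono fun z hz => hz.2)
    have h2 := (hΘ'.continuousOn_boundaryExt ζ hζ.2).tendsto.comp h1
    refine tendsto_nhds_unique h2 ((hlim.mono_left hU).congr' ?_)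
    refine hU ?_
    filter_upwards [self_mem_nhdsWithin] with z hz
    rw [Function.comp_apply, hΘ'.boundaryExt_of_mem (comparisonMap_mem hΘ hΘ' hsub hz),
      apply_comparisonMap hΘ hΘ' hsub hz]
  have hreal : ∀ ζ ∈ S, MapClusterPt ζ (𝓝[ℂ₊] (x : ℂ)) φ → ζ = (ζ.re : ℂ) := by
    intro ζ hζ h
    have := hΘ'.im_eq_zero_of_boundaryExt_notMem hζ.2 (by rwa [hcl ζ hζ h])
    exact Complex.ext (by simp) (by simp [this])
  have huniq : ∀ ζ ∈ S, ∀ ζ' ∈ S, MapClusterPt ζ (𝓝[ℂ₊] (x : ℂ)) φ →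
      MapClusterPt ζ' (𝓝[ℂ₊] (x : ℂ)) φ → ¬ ζ.re < ζ'.re := by
    intro ζ hζ ζ' hζ' h h' hlt
    refine hΘ'.not_boundaryExt_const hlt p fun t ht => ?_
    refine hΘ'.boundaryExt_mem_of_crossing (C := {p}) isCompact_singleton
      (by rintro c rfl; exact hpΩ) (fun ε hε => ?_) ht
    obtain ⟨δ, hδ, hδs⟩ := Metric.mem_nhdsWithin_iff.1
      (hlim (Metric.closedBall_mem_nhds p hε))
    refine ⟨Θ '' (Metric.ball (x : ℂ) δ ∩ ℂ₊), ?_, ?_, ?_, ?_⟩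
    · rintro _ ⟨z, hz, rfl⟩
      exact hsub (hΘ.mem hz.2)
    · exact ((convex_ball _ _).inter convex_halfPlane).isPreconnected.image _
        (hΘ.differentiableOn.continuousOn.mono inter_subset_right)
    · rintro _ ⟨z, hz, rfl⟩
      exact ⟨p, rfl, hδs hz⟩
    · have hfreq : ∀ ξ ∈ S, MapClusterPt ξ (𝓝[ℂ₊] (x : ℂ)) φ →
          ∃ᶠ z in 𝓝[ℂ₊] (ξ.re : ℂ), Θ' z ∈ Θ '' (Metric.ball (x : ℂ) δ ∩ ℂ₊) := by
        intro ξ hξ hξc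
        rw [← hreal ξ hξ hξc, frequently_nhdsWithin_iff, frequently_iff]
        intro U hU
        obtain ⟨y, hyU, hyb, hy⟩ := ((mapClusterPt_iff_frequently.1 hξc U hU).and_eventually
          ((eventually_mem_set.2 (mem_nhdsWithin_of_mem_nhds
            (Metric.ball_mem_nhds (x : ℂ) hδ))).and eventually_mem_nhdsWithin)).exists
        exact ⟨φ y, hyU, ⟨y, ⟨hyb, hy⟩, (apply_comparisonMap hΘ hΘ' hsub hy).symm⟩,
          comparisonMap_mem hΘ hΘ' hsub hy⟩
      exact ⟨hfreq ζ hζ h, hfreq ζ' hζ' h'⟩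
  obtain ⟨ζ, hζ, hζc⟩ := hS.exists_mapClusterPt_of_frequently hφS.frequently
  refine ⟨ζ, hζ.2, hS.le_nhds_of_unique_clusterPt hφS fun ζ' hζ' hζc' => ?_, hcl ζ hζ hζc⟩
  have h1 := huniq ζ hζ ζ' hζ' hζc hζc'
  have h2 := huniq ζ' hζ' ζ hζ hζc' hζc
  rw [hreal ζ hζ hζc, hreal ζ' hζ' hζc', le_antisymm (not_lt.1 h1) (not_lt.1 h2)]

lemma tendsto_boundaryExt_comparisonMap (hΘ : IsProperConformalOnto Ω Θ)
    (hΘ' : IsProperConformalOnto Ω' Θ') (hsub : Ω ⊆ Ω') (x : ℝ) :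
    Tendsto (comparisonMap Θ' Θ) (𝓝[ℂ₊] (x : ℂ)) (𝓝 (boundaryExt (comparisonMap Θ' Θ) x)) :=
  tendsto_extendFrom ((exists_tendsto_comparisonMap hΘ hΘ' hsub x).imp fun _ h => h.2.1)

lemma boundaryExt_comparisonMap (hΘ : IsProperConformalOnto Ω Θ)
    (hΘ' : IsProperConformalOnto Ω' Θ') (hsub : Ω ⊆ Ω') (x : ℝ) :
    0 ≤ (boundaryExt (comparisonMap Θ' Θ) x).im ∧
      boundaryExt Θ' (boundaryExt (comparisonMap Θ' Θ) x) = boundaryExt Θ x := by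
  obtain ⟨ζ, h0, h1, h2⟩ := exists_tendsto_comparisonMap hΘ hΘ' hsub x
  rw [tendsto_nhds_unique (tendsto_boundaryExt_comparisonMap hΘ hΘ' hsub x) h1]
  exact ⟨h0, h2⟩

/-- Where the boundary value of `Θ` is a boundary point of the larger domain too, the boundary value
of the comparison map is real. -/
lemma boundaryExt_comparisonMap_eq_ofReal (hΘ : IsProperConformalOnto Ω Θ)
    (hΘ' : IsProperConformalOnto Ω' Θ') (hsub : Ω ⊆ Ω') {x : ℝ} (hx : boundaryExt Θ x ∉ Ω') :
    boundaryExt (comparisonMap Θ' Θ) x = ((boundaryExt (comparisonMap Θ' Θ) x).re : ℂ) := by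
  obtain ⟨h0, h1⟩ := boundaryExt_comparisonMap hΘ hΘ' hsub x
  have := hΘ'.im_eq_zero_of_boundaryExt_notMem h0 (by rwa [h1])
  exact Complex.ext (by simp) (by simp [this])

lemma continuous_boundaryExt_comparisonMap (hΘ : IsProperConformalOnto Ω Θ)
    (hΘ' : IsProperConformalOnto Ω' Θ') (hsub : Ω ⊆ Ω') :
    Continuous fun x : ℝ => boundaryExt (comparisonMap Θ' Θ) x :=
  ((differentiableOn_comparisonMap hΘ hΘ' hsub).continuousOn_boundaryExt fun x =>
    ⟨_, tendsto_boundaryExt_comparisonMap hΘ hΘ' hsub x⟩).comp_continuous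
      Complex.continuous_ofReal fun x => by simp

end comparisonMap

/-! ### Asymptotics at `-∞` -/

lemma ofReal_cpow_half_of_neg {x : ℝ} (hx : x < 0) :
    (x : ℂ) ^ (1 / 2 : ℂ) = (√(-x) : ℝ) * Complex.I := by
  rw [Complex.ofReal_cpow_of_nonpos hx.le]
  have h1 : (-(x : ℂ)) ^ (1 / 2 : ℂ) = (√(-x) : ℝ) := by
    rw [Real.sqrt_eq_rpow, Complex.ofReal_cpow (by linarith)]
    push_cast
    rfl
  rw [h1]
  congr 1
  rw [show (Real.pi : ℂ) * Complex.I * (1 / 2 : ℂ) = Real.pi / 2 * Complex.I by ring,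
    Complex.exp_pi_div_two_mul_I]

/-- Under the normalization at `-∞`, the boundary values near `-∞` are on the imaginary axis. -/
lemma IsComb.boundaryExt_atBot {I : Set ℕ} {u h : ℕ → ℝ} (hc : IsComb I u h) {Θ : ℂ → ℂ}
    (hΘ : IsProperConformalOnto (combDomain I u h) Θ)
    (hasy : (fun x : ℝ => boundaryExt Θ x) ~[atBot] fun x : ℝ => (x : ℂ) ^ (1 / 2 : ℂ)) :
    (∀ᶠ x : ℝ in atBot, (boundaryExt Θ x).re = 0) ∧
      Tendsto (fun x : ℝ => (boundaryExt Θ x).im) atBot atTop ∧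
      Tendsto (fun x : ℝ => (boundaryExt Θ x).im / √(-x)) atBot (𝓝 1) := by
  have hne : ∀ᶠ x : ℝ in atBot, (x : ℂ) ^ (1 / 2 : ℂ) ≠ 0 := by
    filter_upwards [eventually_lt_atBot 0] with x hx
    rw [ofReal_cpow_half_of_neg hx]
    have : 0 < √(-x) := Real.sqrt_pos.2 (by linarith)
    exact mul_ne_zero (by exact_mod_cast this.ne') Complex.I_ne_zero
  have h1 := (isEquivalent_iff_tendsto_one hne).1 hasy
  have h2 : Tendsto (fun x : ℝ => (boundaryExt Θ x).im / √(-x)) atBot (𝓝 1) := by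
    have h3 := (Complex.continuous_im.tendsto _).comp (h1.mul_const Complex.I)
    simp only [one_mul, Complex.I_im] at h3
    refine h3.congr' ?_
    filter_upwards [eventually_lt_atBot 0] with x hx
    simp only [Function.comp_apply, Pi.div_apply, ofReal_cpow_half_of_neg hx]
    have h4 : (√(-x) : ℂ) ≠ 0 := by
      exact_mod_cast (Real.sqrt_pos.2 (by linarith : 0 < -x)).ne'
    rw [show boundaryExt Θ x / ((√(-x) : ℂ) * Complex.I) * Complex.I
      = boundaryExt Θ x / (√(-x) : ℂ) by field_simp [Complex.I_ne_zero]]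
    rw [Complex.div_ofReal_im]
  have h3 : Tendsto (fun x : ℝ => (boundaryExt Θ x).im) atBot atTop := by
    have hs : Tendsto (fun x : ℝ => √(-x)) atBot atTop :=
      Real.tendsto_sqrt_atTop.comp tendsto_neg_atBot_atTop
    refine (h2.pos_mul_atTop one_pos hs).congr' ?_
    filter_upwards [eventually_lt_atBot 0] with x hx
    exact div_mul_cancel₀ _ (Real.sqrt_pos.2 (by linarith : 0 < -x)).ne'
  refine ⟨?_, h3, h2⟩
  obtain ⟨H, hH0, hH⟩ := hc.exists_height
  filter_upwards [h3.eventually_gt_atTop H] with x hx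
  by_contra hne0
  have hre := (nonneg_of_mem_closure_combDomain (hΘ.boundaryExt_mem_closure x)).1
  obtain ⟨j, hj, hjs⟩ := exists_slit_of_notMem_combDomain (hΘ.boundaryExt_notMem x)
    (lt_of_le_of_ne hre (Ne.symm hne0)) (hH0.trans hx)
  linarith [hjs.2.2, hH j hj]

/-- The comparison map of two normalized maps satisfies `φ(x) / x → 1` as `x → -∞`, in the sense of
boundary values. -/
theorem tendsto_comparisonMap_div_atBot {I I' : Set ℕ} {u h : ℕ → ℝ} (hc : IsComb I u h)
    (hc' : IsComb I' u h) {Θ Θ' : ℂ → ℂ} (hΘ : IsProperConformalOnto (combDomain I u h) Θ)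
    (hΘ' : IsProperConformalOnto (combDomain I' u h) Θ')
    (hsub : combDomain I u h ⊆ combDomain I' u h)
    (hasy : (fun x : ℝ => boundaryExt Θ x) ~[atBot] fun x : ℝ => (x : ℂ) ^ (1 / 2 : ℂ))
    (hasy' : (fun x : ℝ => boundaryExt Θ' x) ~[atBot] fun x : ℝ => (x : ℂ) ^ (1 / 2 : ℂ)) :
    Tendsto (fun x : ℝ => boundaryExt (comparisonMap Θ' Θ) x / x) atBot (𝓝 1) := by
  obtain ⟨hre, him, hratio⟩ := hc.boundaryExt_atBot hΘ hasy
  obtain ⟨hre', him', hratio'⟩ := hc'.boundaryExt_atBot hΘ' hasy'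
  obtain ⟨V, hV⟩ := hc'.exists_forall_boundaryExt_injective hΘ'
  set y : ℝ → ℝ := fun x => (boundaryExt (comparisonMap Θ' Θ) x).re with hy
  have hpt : ∀ (f : ℂ → ℂ) (x : ℝ), (boundaryExt f x).re = 0 →
      boundaryExt f x = (boundaryExt f x).im * Complex.I := by
    intro f x hx
    exact Complex.ext (by simp [hx]) (by simp)
  have hyr : ∀ᶠ x : ℝ in atBot, boundaryExt (comparisonMap Θ' Θ) x = (y x : ℂ) ∧
      boundaryExt Θ' (y x) = boundaryExt Θ x := by
    filter_upwards [hre] with x hx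
    have h1 := boundaryExt_comparisonMap_eq_ofReal hΘ hΘ' hsub (x := x) (fun hcon => by
      have := (mem_combDomain.1 hcon).1
      linarith)
    refine ⟨h1, ?_⟩
    have h2 := (boundaryExt_comparisonMap hΘ hΘ' hsub x).2
    rw [h1] at h2
    exact h2
  obtain ⟨X', hX'⟩ := eventually_atBot.1 hre'
  have hybot : Tendsto y atBot atBot := by
    rw [tendsto_atBot]
    intro X
    set X'' := min X X' with hX''
    -- By the intermediate value theorem, the points high up on the imaginary axis are boundary
    -- values of `Θ'` to the left of `X''`; as they are simple, they have no other preimage.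
    have hivt := isPreconnected_Iic.intermediate_value_Ici (a := X'') (s := Iic X'')
      (f := fun t : ℝ => (boundaryExt Θ' t).im) (l := atBot) (mem_Iic.2 le_rfl)
      (le_principal_iff.2 (Iic_mem_atBot X''))
      (Complex.continuous_im.comp hΘ'.continuous_boundaryExt_ofReal).continuousOn him'
    filter_upwards [hyr, hre, him.eventually_gt_atTop V,
      him.eventually_ge_atTop (boundaryExt Θ' X'').im] with x hx1 hx2 hx3 hx4
    obtain ⟨t, ht, hte⟩ := hivt hx4
    have ht' : t ≤ X'' := ht
    have h1 : boundaryExt Θ' t = (boundaryExt Θ x).im * Complex.I := by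
      have h2 := hpt Θ' t (hX' t (ht'.trans (min_le_right _ _)))
      simp only at hte
      rwa [hte] at h2
    have h2 : boundaryExt Θ' (y x) = (boundaryExt Θ x).im * Complex.I := by
      rw [hx1.2]
      exact hpt Θ x hx2
    rw [hV _ hx3 _ _ h2 h1]
    exact ht'.trans (min_le_left _ _)
  have h1 := hratio'.comp hybot
  have h2 := (hratio.div h1 one_ne_zero).pow 2
  have h3 : Tendsto (fun x : ℝ => y x / x) atBot (𝓝 1) := by
    simp only [div_one, one_pow] at h2
    refine h2.congr' ?_
    filter_upwards [hyr, eventually_lt_atBot 0, hybot.eventually_lt_atBot 0,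
      him.eventually_gt_atTop 0] with x hx1 hx2 hx3 hx4
    simp only [Function.comp_apply, Pi.div_apply, hx1.2]
    have e1 : √(-x) ^ 2 = -x := Real.sq_sqrt (by linarith)
    have e2 : √(-y x) ^ 2 = -y x := Real.sq_sqrt (by linarith)
    rw [div_div_div_cancel_left' _ _ hx4.ne', div_pow, e1, e2, neg_div_neg_eq]
  have h4 : Tendsto (fun x : ℝ => ((y x / x : ℝ) : ℂ)) atBot (𝓝 ((1 : ℝ) : ℂ)) :=
    (Complex.continuous_ofReal.tendsto _).comp h3
  rw [Complex.ofReal_one] at h4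
  refine h4.congr' ?_
  filter_upwards [hyr] with x hx
  rw [hx.1]
  push_cast
  rfl

/-! ### The angular derivative at infinity -/

/-- The conformal map `q ↦ (√q - 1) / (√q + 1)` of the plane slit along the negative axis onto the
unit disc. -/
noncomputable def slitPlaneToDisc (q : ℂ) : ℂ :=
  (Complex.exp (Complex.log q / 2) - 1) / (Complex.exp (Complex.log q / 2) + 1)

lemma re_exp_half_log_pos {q : ℂ} (hq : q ∈ Complex.slitPlane) :
    0 < (Complex.exp (Complex.log q / 2)).re := by
  rw [Complex.exp_re]
  refine mul_pos (Real.exp_pos _) (Real.cos_pos_of_mem_Ioo ?_)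
  have h1 := Complex.mem_slitPlane_iff_arg.1 hq
  have h2 : (Complex.log q / 2).im = q.arg / 2 := by
    rw [show (2 : ℂ) = ((2 : ℝ) : ℂ) by norm_num, Complex.div_ofReal_im, Complex.log_im]
  rw [h2]
  have h3 := Complex.neg_pi_lt_arg q
  have h4 := lt_of_le_of_ne (Complex.arg_le_pi q) h1.1
  constructor <;> linarith

lemma exp_half_log_add_one_ne_zero {q : ℂ} (hq : q ∈ Complex.slitPlane) :
    Complex.exp (Complex.log q / 2) + 1 ≠ 0 :=
  add_one_ne_zero_of_re_nonneg (re_exp_half_log_pos hq).le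

lemma differentiableAt_slitPlaneToDisc {q : ℂ} (hq : q ∈ Complex.slitPlane) :
    DifferentiableAt ℂ slitPlaneToDisc q := by
  have h1 : DifferentiableAt ℂ (fun q => Complex.exp (Complex.log q / 2)) q :=
    ((Complex.differentiableAt_log hq).div_const 2).cexp
  exact (h1.sub_const 1).div (h1.add_const 1) (exp_half_log_add_one_ne_zero hq)

lemma norm_slitPlaneToDisc_le {q : ℂ} (hq : q ∈ Complex.slitPlane) : ‖slitPlaneToDisc q‖ ≤ 1 := by
  have h0 := re_exp_half_log_pos hq
  rw [slitPlaneToDisc, norm_div]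
  refine div_le_one_of_le₀ ?_ (norm_nonneg _)
  rw [Complex.norm_def, Complex.norm_def]
  refine Real.sqrt_le_sqrt ?_
  simp only [Complex.normSq_apply, Complex.sub_re, Complex.sub_im, Complex.add_re, Complex.add_im,
    Complex.one_re, Complex.one_im]
  nlinarith

lemma slitPlaneToDisc_one : slitPlaneToDisc 1 = 0 := by
  simp [slitPlaneToDisc]

/-- The inverse of `slitPlaneToDisc`. -/
lemma sq_div_slitPlaneToDisc {q : ℂ} (hq : q ∈ Complex.slitPlane) :
    ((1 + slitPlaneToDisc q) / (1 - slitPlaneToDisc q)) ^ 2 = q := by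
  have h1 := exp_half_log_add_one_ne_zero hq
  have h2 : Complex.exp (Complex.log q / 2) ^ 2 = q := by
    rw [← Complex.exp_nat_mul]
    push_cast
    rw [mul_div_cancel₀ _ two_ne_zero]
    exact Complex.exp_log (Complex.slitPlane_ne_zero hq)
  have h3 : (1 + slitPlaneToDisc q) / (1 - slitPlaneToDisc q) = Complex.exp (Complex.log q / 2) := by
    rw [slitPlaneToDisc]
    field_simp
    ring
  rw [h3, h2]

lemma add_I_div_add_I_mem_slitPlane {a b : ℂ} (ha : 0 ≤ a.im) (hb : 0 ≤ b.im) :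
    (a + Complex.I) / (b + Complex.I) ∈ Complex.slitPlane := by
  have hb1 : b + Complex.I ≠ 0 := fun h => by
    have := congrArg Complex.im h
    simp at this
    linarith
  by_contra hcon
  rw [Complex.mem_slitPlane_iff, not_or, not_lt, not_not] at hcon
  have h1 : (a + Complex.I) / (b + Complex.I) * (b + Complex.I) = a + Complex.I :=
    div_mul_cancel₀ _ hb1
  have h2 := congrArg Complex.im h1
  rw [Complex.mul_im, hcon.2] at h2
  simp at h2
  nlinarith [hcon.1]

/-- **Lindelöf's theorem** for the difference quotient at infinity: if a holomorphic self-map `φ` of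
the upper half-plane satisfies `φ(x) / x → 1` along the negative axis, then also along the imaginary
axis. The quotient `(φ(z) + i) / (z + i)` avoids the negative axis; mapping its range into the unit
disc, one compares it with the harmonic measure of a half-line `(-∞, -R)`. -/
theorem tendsto_div_imaginary_axis {φ : ℂ → ℂ} (hd : DifferentiableOn ℂ φ ℂ₊)
    (hm : ∀ z ∈ ℂ₊, φ z ∈ ℂ₊) (hlim : ∀ x : ℝ, ∃ w, Tendsto φ (𝓝[ℂ₊] (x : ℂ)) (𝓝 w))
    (hasy : Tendsto (fun x : ℝ => boundaryExt φ x / x) atBot (𝓝 1)) :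
    Tendsto (fun y : ℝ => φ (y * Complex.I) / (y * Complex.I)) atTop (𝓝 1) := by
  have hlim' : ∀ x : ℝ, Tendsto φ (𝓝[ℂ₊] (x : ℂ)) (𝓝 (boundaryExt φ x)) := fun x =>
    tendsto_extendFrom (hlim x)
  have him : ∀ x : ℝ, 0 ≤ (boundaryExt φ x).im := fun x =>
    ge_of_tendsto ((Complex.continuous_im.tendsto _).comp (hlim' x)) (by
      filter_upwards [self_mem_nhdsWithin] with z hz using (mem_upperHalfPlaneSet_iff.1 (hm z hz)).le)
  have hzI : ∀ z : ℂ, 0 ≤ z.im → z + Complex.I ≠ 0 := fun z hz h => by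
    have := congrArg Complex.im h
    simp at this
    linarith
  set q : ℂ → ℂ := fun z => (φ z + Complex.I) / (z + Complex.I) with hq
  set qb : ℝ → ℂ := fun x => (boundaryExt φ x + Complex.I) / (x + Complex.I) with hqb
  have hqs : ∀ z ∈ ℂ₊, q z ∈ Complex.slitPlane := fun z hz =>
    add_I_div_add_I_mem_slitPlane (mem_upperHalfPlaneSet_iff.1 (hm z hz)).le
      (mem_upperHalfPlaneSet_iff.1 hz).le
  have hqbs : ∀ x : ℝ, qb x ∈ Complex.slitPlane := fun x =>
    add_I_div_add_I_mem_slitPlane (him x) (by simp)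
  set T : ℂ → ℂ := fun z => slitPlaneToDisc (q z) with hT
  have hTd : DifferentiableOn ℂ T ℂ₊ := by
    intro z hz
    have h1 : DifferentiableWithinAt ℂ q ℂ₊ z :=
      ((hd z hz).add_const _).div (by fun_prop) (hzI z (mem_upperHalfPlaneSet_iff.1 hz).le)
    exact (differentiableAt_slitPlaneToDisc (hqs z hz)).comp_differentiableWithinAt z h1
  have hT1 : ∀ z ∈ ℂ₊, ‖T z‖ ≤ 1 := fun z hz => norm_slitPlaneToDisc_le (hqs z hz)
  have hTlim : ∀ x : ℝ, Tendsto T (𝓝[ℂ₊] (x : ℂ)) (𝓝 (slitPlaneToDisc (qb x))) := by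
    intro x
    refine (differentiableAt_slitPlaneToDisc (hqbs x)).continuousAt.tendsto.comp ?_
    refine ((hlim' x).add_const _).div ?_ (hzI x (by simp))
    exact ((continuous_id.add continuous_const).tendsto _).mono_left nhdsWithin_le_nhds
  have hqb1 : Tendsto qb atBot (𝓝 1) := by
    have hx : Tendsto (fun x : ℝ => (Complex.I / (x : ℂ))) atBot (𝓝 0) := by
      have h1 : Tendsto (fun x : ℝ => ((x⁻¹ : ℝ) : ℂ)) atBot (𝓝 ((0 : ℝ) : ℂ)) :=
        (Complex.continuous_ofReal.tendsto _).comp tendsto_inv_atBot_zero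
      have h2 := h1.const_mul Complex.I
      simp only [Complex.ofReal_zero, mul_zero, Complex.ofReal_inv] at h2
      exact h2
    have h3 := (hasy.add hx).div (hx.const_add 1) (by simp)
    simp only [add_zero, div_one] at h3
    refine h3.congr' ?_
    filter_upwards [eventually_lt_atBot 0] with x hx0
    have hx0' : (x : ℂ) ≠ 0 := by exact_mod_cast hx0.ne
    have h4 := hzI x (by simp)
    simp only [hqb, Pi.div_apply]
    rw [← add_div, one_add_div hx0', div_div_div_cancel_right₀ hx0']
  have hTb0 : Tendsto (fun x => ‖slitPlaneToDisc (qb x)‖) atBot (𝓝 0) := by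
    have h1 := ((differentiableAt_slitPlaneToDisc Complex.one_mem_slitPlane).continuousAt.tendsto.comp
      hqb1).norm
    simpa [slitPlaneToDisc_one] using h1
  -- The two-constants estimate: `L * arg (z + R) / π` is `L` on `(-∞, -R)` and `0` on `(-R, ∞)`.
  have hbound : ∀ L : ℝ, 0 < L → ∃ R : ℝ, ∀ z ∈ ℂ₊,
      ‖T z‖ * Real.exp (L / Real.pi * (z + R).arg) ≤ 1 := by
    intro L hL
    obtain ⟨X, hX⟩ := eventually_atBot.1 (hTb0.eventually (gt_mem_nhds (Real.exp_pos (-L))))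
    set R := -X with hR
    have hnorm : ∀ z ∈ ℂ₊, ‖T z * Complex.exp (-Complex.I * (L / Real.pi) * Complex.log (z + R))‖
        = ‖T z‖ * Real.exp (L / Real.pi * (z + R).arg) := by
      intro z hz
      rw [norm_mul, Complex.norm_exp]
      congr 2
      rw [← Complex.ofReal_div]
      simp [Complex.mul_re, Complex.log_im]
    have hslit : ∀ z ∈ ℂ₊, z + R ∈ Complex.slitPlane := fun z hz => by
      right
      have : 0 < z.im := hz
      simp only [Complex.add_im, Complex.ofReal_im, add_zero]
      exact this.ne'
    have hLπ : 0 < L / Real.pi := div_pos hL Real.pi_pos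
    have hexpL : ∀ z : ℂ, Real.exp (L / Real.pi * (z + R).arg) ≤ Real.exp L := by
      intro z
      refine Real.exp_le_exp.2 ?_
      have := mul_le_mul_of_nonneg_left (Complex.arg_le_pi (z + R)) hLπ.le
      rwa [div_mul_cancel₀ _ Real.pi_ne_zero] at this
    refine ⟨R, fun z hz => ?_⟩
    rw [← hnorm z hz]
    refine norm_le_of_boundary_limsup_le_of_bounded
      (f := fun z => T z * Complex.exp (-Complex.I * (L / Real.pi) * Complex.log (z + R)))
      (B := Real.exp L) ?_ zero_le_one ?_ ?_ z hz
    · intro z hz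
      refine (hTd z hz).mul (DifferentiableAt.differentiableWithinAt ?_)
      exact (((differentiableAt_id.add_const _).clog (hslit z hz)).const_mul _).cexp
    · intro z hz
      rw [hnorm z hz]
      exact (mul_le_of_le_one_left (Real.exp_pos _).le (hT1 z hz)).trans (hexpL z)
    · intro x c hc
      rcases le_or_gt x X with hx | hx
      · have h1 : ‖slitPlaneToDisc (qb x)‖ < c * Real.exp (-L) :=
          (hX x hx).trans (lt_mul_of_one_lt_left (Real.exp_pos _) hc)
        filter_upwards [(hTlim x).norm.eventually (gt_mem_nhds h1), self_mem_nhdsWithin]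
          with z hz hz'
        rw [hnorm z hz']
        calc ‖T z‖ * Real.exp (L / Real.pi * (z + R).arg) ≤ ‖T z‖ * Real.exp L :=
              mul_le_mul_of_nonneg_left (hexpL z) (norm_nonneg _)
          _ < c * Real.exp (-L) * Real.exp L := mul_lt_mul_of_pos_right hz (Real.exp_pos _)
          _ = c := by rw [mul_assoc, ← Real.exp_add]; simp
      · have hxR : (x : ℂ) + R ∈ Complex.slitPlane := by
          left
          simp only [Complex.add_re, Complex.ofReal_re]
          linarith
        have h1 : ContinuousAt (fun z : ℂ => Real.exp (L / Real.pi * (z + R).arg)) x := by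
          have h2 : ContinuousAt (fun z : ℂ => (z + R).arg) x :=
            ContinuousAt.comp (f := fun z : ℂ => z + R) (Complex.continuousAt_arg hxR) (by fun_prop)
          exact (continuousAt_const.mul h2).rexp
        have h3 : Real.exp (L / Real.pi * ((x : ℂ) + R).arg) < c := by
          have : ((x : ℂ) + R).arg = 0 := by
            rw [← Complex.ofReal_add, Complex.arg_ofReal_of_nonneg (by linarith)]
          rw [this]
          simpa using hc
        filter_upwards [(h1.eventually (gt_mem_nhds h3)).filter_mono nhdsWithin_le_nhds,
          self_mem_nhdsWithin] with z hz hz'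
        rw [hnorm z hz']
        exact (mul_le_of_le_one_left (Real.exp_pos _).le (hT1 z hz')).trans_lt hz
  have hTi : Tendsto (fun y : ℝ => T (y * Complex.I)) atTop (𝓝 0) := by
    rw [tendsto_zero_iff_norm_tendsto_zero, Metric.tendsto_nhds]
    intro δ hδ
    set L := max (4 * -Real.log (δ / 2)) 1 with hLd
    have hL : 0 < L := lt_max_of_lt_right one_pos
    obtain ⟨R, hR⟩ := hbound L hL
    have harg : ∀ᶠ y : ℝ in atTop, Real.pi / 4 ≤ ((y * Complex.I + R : ℂ)).arg := by
      have h1 : Tendsto (fun y : ℝ => (Complex.I + ((R * y⁻¹ : ℝ) : ℂ))) atTop (𝓝 Complex.I) := by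
        have h2 : Tendsto (fun y : ℝ => ((R * y⁻¹ : ℝ) : ℂ)) atTop (𝓝 ((R * 0 : ℝ) : ℂ)) :=
          (Complex.continuous_ofReal.tendsto _).comp (tendsto_inv_atTop_zero.const_mul R)
        simpa using h2.const_add Complex.I
      have h3 := (Complex.continuousAt_arg (x := Complex.I) (Or.inr (by simp))).tendsto.comp h1
      rw [Complex.arg_I] at h3
      have h4 : Real.pi / 4 < Real.pi / 2 := by linarith [Real.pi_pos]
      filter_upwards [h3.eventually (lt_mem_nhds h4), eventually_gt_atTop 0] with y hy hy0
      have h5 : (y * Complex.I + R : ℂ) = (y : ℂ) * (Complex.I + ((R * y⁻¹ : ℝ) : ℂ)) := by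
        have : (y : ℂ) ≠ 0 := by exact_mod_cast hy0.ne'
        push_cast
        field_simp
      rw [h5, Complex.arg_real_mul _ hy0]
      exact hy.le
    filter_upwards [harg, eventually_gt_atTop 0] with y hy hy0
    have hmem : (y * Complex.I : ℂ) ∈ ℂ₊ := by
      rw [mem_upperHalfPlaneSet_iff]
      simpa using hy0
    have h1 := hR _ hmem
    have h2 : Real.exp (L / 4) ≤ Real.exp (L / Real.pi * (y * Complex.I + R : ℂ).arg) := by
      refine Real.exp_le_exp.2 ?_
      have := mul_le_mul_of_nonneg_left hy (div_pos hL Real.pi_pos).le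
      have h3 : L / Real.pi * (Real.pi / 4) = L / 4 := by
        field_simp
      rwa [h3] at this
    have h3 : ‖T (y * Complex.I)‖ * Real.exp (L / 4) ≤ 1 :=
      (mul_le_mul_of_nonneg_left h2 (norm_nonneg _)).trans h1
    have h4 : 2 / δ ≤ Real.exp (L / 4) := by
      rw [← Real.exp_log (by positivity : 0 < 2 / δ)]
      refine Real.exp_le_exp.2 ?_
      have h5 : Real.log (2 / δ) = -Real.log (δ / 2) := by
        rw [← Real.log_inv, inv_div]
      have := le_max_left (4 * -Real.log (δ / 2)) 1
      rw [h5]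
      linarith
    have h5 : ‖T (y * Complex.I)‖ * (2 / δ) ≤ 1 :=
      (mul_le_mul_of_nonneg_left h4 (norm_nonneg _)).trans h3
    rw [mul_div_assoc', div_le_one hδ] at h5
    simp only [dist_zero_right, norm_norm]
    linarith
  have hqi : Tendsto (fun y : ℝ => q (y * Complex.I)) atTop (𝓝 1) := by
    have h1 := ((hTi.const_add 1).div (hTi.const_sub 1) (by simp)).pow 2
    simp only [add_zero, sub_zero, div_one, one_pow] at h1
    refine h1.congr' ?_
    filter_upwards [eventually_gt_atTop 0] with y hy0
    exact sq_div_slitPlaneToDisc (hqs _ (by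
      rw [mem_upperHalfPlaneSet_iff]
      simpa using hy0))
  have hinv : Tendsto (fun y : ℝ => ((y : ℂ))⁻¹) atTop (𝓝 0) := by
    have h1 : Tendsto (fun y : ℝ => ((y⁻¹ : ℝ) : ℂ)) atTop (𝓝 ((0 : ℝ) : ℂ)) :=
      (Complex.continuous_ofReal.tendsto _).comp tendsto_inv_atTop_zero
    simpa using h1
  have h1 := (hqi.mul (hinv.const_add 1)).sub hinv
  simp only [add_zero, mul_one, sub_zero] at h1
  refine h1.congr' ?_
  filter_upwards [eventually_gt_atTop 0] with y hy0
  have hy : (y : ℂ) ≠ 0 := by exact_mod_cast hy0.ne'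
  have hy1 : (y : ℂ) * Complex.I + Complex.I ≠ 0 := hzI _ (by simpa using hy0.le)
  have hy2 : (y : ℂ) + 1 ≠ 0 := by
    intro h
    apply hy1
    rw [← add_one_mul, h, zero_mul]
  simp only [hq]
  rw [← add_one_mul] at *
  field_simp
  ring

/-- **Julia's lemma** at infinity: a holomorphic self-map of the upper half-plane with
`φ(i y) / (i y) → 1` does not decrease imaginary parts. -/
theorem im_le_im_of_tendsto_div {φ : ℂ → ℂ} (hd : DifferentiableOn ℂ φ ℂ₊)
    (hm : ∀ z ∈ ℂ₊, φ z ∈ ℂ₊) (hlim : ∀ x : ℝ, ∃ w, Tendsto φ (𝓝[ℂ₊] (x : ℂ)) (𝓝 w))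
    (hi : Tendsto (fun y : ℝ => φ (y * Complex.I) / (y * Complex.I)) atTop (𝓝 1)) {z : ℂ}
    (hz : z ∈ ℂ₊) : z.im ≤ (φ z).im := by
  have hlim' : ∀ x : ℝ, Tendsto φ (𝓝[ℂ₊] (x : ℂ)) (𝓝 (boundaryExt φ x)) := fun x =>
    tendsto_extendFrom (hlim x)
  have him : ∀ z : ℂ, 0 ≤ z.im → 0 ≤ (boundaryExt φ z).im := by
    intro z hz
    rcases hz.lt_or_eq with h | h
    · rw [hd.boundaryExt_of_mem h]
      exact (mem_upperHalfPlaneSet_iff.1 (hm z h)).le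
    · have hzr : z = (z.re : ℂ) := Complex.ext (by simp) (by simp [← h])
      rw [hzr]
      refine ge_of_tendsto ((Complex.continuous_im.tendsto _).comp (hlim' z.re)) ?_
      filter_upwards [self_mem_nhdsWithin] with w hw
        using (mem_upperHalfPlaneSet_iff.1 (hm w hw)).le
  have key : ∀ ε > 0, ε ≤ 1 → (1 - ε) * z.im ≤ (φ z).im := by
    intro ε hε hε1
    set f : ℂ → ℂ := fun ζ => Complex.exp (Complex.I * (boundaryExt φ (Complex.I * ζ)
      - (1 - ε : ℝ) * (Complex.I * ζ))) with hf
    have hfn : ∀ ζ, ‖f ζ‖ = Real.exp ((1 - ε) * ζ.re - (boundaryExt φ (Complex.I * ζ)).im) := by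
      intro ζ
      rw [hf, Complex.norm_exp]
      congr 1
      simp [Complex.mul_re, Complex.mul_im]
    have hmaps : MapsTo (fun ζ : ℂ => Complex.I * ζ) {ζ : ℂ | 0 < ζ.re} ℂ₊ := by
      intro ζ hζ
      have : 0 < ζ.re := hζ
      rw [mem_upperHalfPlaneSet_iff]
      simpa using this
    have hfd : DiffContOnCl ℂ f {ζ : ℂ | 0 < ζ.re} := by
      constructor
      · have h1 : DifferentiableOn ℂ (fun ζ : ℂ => boundaryExt φ (Complex.I * ζ)) {ζ | 0 < ζ.re} := by
          have h2 : DifferentiableOn ℂ (fun ζ : ℂ => φ (Complex.I * ζ)) {ζ | 0 < ζ.re} :=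
            hd.comp (by fun_prop) hmaps
          exact h2.congr fun ζ hζ => hd.boundaryExt_of_mem (hmaps hζ)
        have h3 : DifferentiableOn ℂ (fun ζ : ℂ => ((1 - ε : ℝ) : ℂ) * (Complex.I * ζ))
            {ζ | 0 < ζ.re} := by fun_prop
        exact ((h1.sub h3).const_mul Complex.I).cexp
      · rw [Complex.closure_setOfPred_lt_re]
        have h1 : ContinuousOn (fun ζ : ℂ => boundaryExt φ (Complex.I * ζ)) {ζ | 0 ≤ ζ.re} := by
          refine (hd.continuousOn_boundaryExt hlim).comp (by fun_prop) ?_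
          intro ζ hζ
          have : 0 ≤ ζ.re := hζ
          simpa using this
        have h3 : ContinuousOn (fun ζ : ℂ => ((1 - ε : ℝ) : ℂ) * (Complex.I * ζ))
            {ζ | 0 ≤ ζ.re} := by fun_prop
        exact ((h1.sub h3).const_smul Complex.I).cexp
    have hexp : ∃ c < (2 : ℝ), ∃ B : ℝ, f =O[Bornology.cobounded ℂ ⊓ 𝓟 {ζ | 0 < ζ.re}]
        fun ζ => Real.exp (B * ‖ζ‖ ^ c) := by
      refine ⟨1, by norm_num, 1, IsBigO.of_bound 1 ?_⟩
      filter_upwards [mem_inf_of_right (mem_principal_self _)] with ζ hζ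
      have hζ' : 0 < ζ.re := hζ
      rw [hfn, one_mul, one_mul, Real.rpow_one, Real.norm_eq_abs, Real.abs_exp]
      refine Real.exp_le_exp.2 ?_
      have h1 := him (Complex.I * ζ) (mem_upperHalfPlaneSet_iff.1 (hmaps hζ)).le
      have h2 := Complex.re_le_norm ζ
      nlinarith
    have hre : IsBoundedUnder (· ≤ ·) atTop fun x : ℝ => ‖f x‖ := by
      have h1 := (Complex.continuous_re.tendsto _).comp hi
      have h2 : ∀ᶠ y : ℝ in atTop, 1 - ε < (φ (y * Complex.I) / (y * Complex.I)).re :=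
        h1.eventually (lt_mem_nhds (by simpa using hε))
      refine isBoundedUnder_of_eventually_le (a := 1) ?_
      filter_upwards [h2, eventually_gt_atTop 0] with y hy hy0
      have hmem : (Complex.I * y : ℂ) ∈ ℂ₊ := hmaps (by simpa using hy0)
      rw [hfn, hd.boundaryExt_of_mem hmem, mul_comm Complex.I]
      refine Real.exp_le_one_iff.2 ?_
      have h3 : (φ (y * Complex.I) / (y * Complex.I)).re = (φ (y * Complex.I)).im / y := by
        rw [div_mul_eq_div_div, Complex.div_I, ← neg_mul]
        simp [Complex.mul_re, Complex.div_ofReal_im]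
      rw [h3, lt_div_iff₀ hy0] at hy
      simp only [Complex.ofReal_re]
      linarith
    have himag : ∀ x : ℝ, ‖f (x * Complex.I)‖ ≤ 1 := by
      intro x
      rw [hfn]
      refine Real.exp_le_one_iff.2 ?_
      have h1 := him (Complex.I * (x * Complex.I)) (by simp)
      have h2 : ((x : ℂ) * Complex.I).re = 0 := by simp
      rw [h2]
      linarith
    have hz' : 0 < z.im := hz
    have hfin := PhragmenLindelof.right_half_plane_of_bounded_on_real hfd hexp hre himag
      (z := -Complex.I * z) (by simpa using hz'.le)
    have hzz : Complex.I * (-Complex.I * z) = z := by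
      rw [← mul_assoc, mul_neg, Complex.I_mul_I]
      ring
    rw [hfn, hzz, hd.boundaryExt_of_mem hz, Real.exp_le_one_iff] at hfin
    have h1 : (-Complex.I * z).re = z.im := by simp
    rw [h1] at hfin
    linarith
  have hz' : 0 < z.im := hz
  by_contra! hlt
  have h1 := key (min 1 ((z.im - (φ z).im) / (2 * z.im)))
    (lt_min one_pos (div_pos (by linarith) (by linarith))) (min_le_left _ _)
  have h2 := mul_le_mul_of_nonneg_right
    (min_le_right 1 ((z.im - (φ z).im) / (2 * z.im))) hz'.le
  have h3 : (z.im - (φ z).im) / (2 * z.im) * z.im = (z.im - (φ z).im) / 2 := by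
    field_simp
  linarith

/-! ### The angle subtended by an interval -/

/-- The angle under which the interval `[α, β]` is seen from the point `w` of the upper half-plane;
divided by `π`, this is the harmonic measure of the interval. -/
noncomputable def viewAngle (α β : ℝ) (w : ℂ) : ℝ := (w - β).arg - (w - α).arg

lemma sub_ofReal_mem_slitPlane {w : ℂ} (hw : w ∈ ℂ₊) (α : ℝ) : w - α ∈ Complex.slitPlane := by
  have : 0 < w.im := hw
  right
  simpa using this.ne'

lemma arg_sub_ofReal {w : ℂ} (hw : w ∈ ℂ₊) (α : ℝ) :
    (w - α).arg = Real.pi / 2 + Real.arctan ((α - w.re) / w.im) := by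
  have hw' : 0 < w.im := hw
  set t := Real.arctan ((α - w.re) / w.im) with ht
  have hc : 0 < Real.cos t := Real.cos_arctan_pos _
  have h1 : (α - w.re) * Real.cos t = w.im * Real.sin t := by
    have h2 : Real.tan t = (α - w.re) / w.im := Real.tan_arctan _
    rw [Real.tan_eq_sin_div_cos, div_eq_div_iff hc.ne' hw'.ne'] at h2
    linarith
  have h2 : w - α = ((w.im / Real.cos t : ℝ) : ℂ) *
      (Complex.cos ((Real.pi / 2 + t : ℝ) : ℂ) + Complex.sin ((Real.pi / 2 + t : ℝ) : ℂ) *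
        Complex.I) := by
    rw [← Complex.ofReal_cos, ← Complex.ofReal_sin, add_comm (Real.pi / 2), Real.cos_add_pi_div_two,
      Real.sin_add_pi_div_two]
    apply Complex.ext
    · rw [Complex.re_ofReal_mul]
      simp only [Complex.sub_re, Complex.ofReal_re, Complex.ofReal_im, Complex.add_re,
        Complex.mul_re, Complex.I_re, Complex.I_im]
      field_simp
      linarith
    · rw [Complex.im_ofReal_mul]
      simp only [Complex.sub_im, Complex.ofReal_re, Complex.ofReal_im, Complex.add_im,
        Complex.mul_im, Complex.I_re, Complex.I_im]
      field_simp
      ring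
  rw [h2, Complex.arg_mul_cos_add_sin_mul_I (div_pos hw' hc)]
  have := Real.arctan_mem_Ioo ((α - w.re) / w.im)
  constructor <;> linarith [this.1, this.2, Real.pi_pos]

lemma viewAngle_eq {w : ℂ} (hw : w ∈ ℂ₊) (α β : ℝ) :
    viewAngle α β w =
      Real.arctan ((β - w.re) / w.im) - Real.arctan ((α - w.re) / w.im) := by
  rw [viewAngle, arg_sub_ofReal hw, arg_sub_ofReal hw]
  ring

lemma viewAngle_nonneg {w : ℂ} (hw : w ∈ ℂ₊) {α β : ℝ} (hαβ : α ≤ β) : 0 ≤ viewAngle α β w := by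
  have hw' : 0 < w.im := hw
  rw [viewAngle_eq hw, sub_nonneg]
  exact Real.arctan_strictMono.monotone (by gcongr)

lemma viewAngle_lt_pi {w : ℂ} (hw : w ∈ ℂ₊) (α β : ℝ) : viewAngle α β w < Real.pi := by
  rw [viewAngle_eq hw]
  linarith [Real.arctan_lt_pi_div_two ((β - w.re) / w.im),
    Real.neg_pi_div_two_lt_arctan ((α - w.re) / w.im)]

lemma arctan_sub_arctan_le {s t : ℝ} (h : s ≤ t) : Real.arctan t - Real.arctan s ≤ t - s := by
  have hm : Monotone fun x : ℝ => x - Real.arctan x := by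
    refine monotone_of_hasDerivAt_nonneg (f' := fun x => 1 - 1 / (1 + x ^ 2))
      (fun x => (hasDerivAt_id x).sub (Real.hasDerivAt_arctan x)) fun x => ?_
    have : 1 / (1 + x ^ 2) ≤ 1 := by
      rw [div_le_one (by positivity)]
      nlinarith [sq_nonneg x]
    simpa using this
  have := hm h
  simp only at this
  linarith

lemma viewAngle_le_div {w : ℂ} (hw : w ∈ ℂ₊) {α β : ℝ} (hαβ : α ≤ β) :
    viewAngle α β w ≤ (β - α) / w.im := by
  have hw' : 0 < w.im := hw
  rw [viewAngle_eq hw]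
  refine (arctan_sub_arctan_le (by gcongr)).trans_eq ?_
  rw [← sub_div]
  ring

/-- Disjoint intervals are seen under a total angle of at most `π`. -/
lemma sum_viewAngle_le_pi {ι : Type*} {A : Finset ι} {α β : ι → ℝ} (hαβ : ∀ j ∈ A, α j ≤ β j)
    (hdisj : (A : Set ι).PairwiseDisjoint fun j => Ioo (α j) (β j)) {w : ℂ} (hw : w ∈ ℂ₊) :
    ∑ j ∈ A, viewAngle (α j) (β j) w ≤ Real.pi := by
  have hw' : 0 < w.im := hw
  set T : ℝ → ℝ := fun s => Real.arctan ((s - w.re) / w.im) with hT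
  have hsub : ∀ j, Ioo (T (α j)) (T (β j)) ⊆
      (fun t => w.re + w.im * Real.tan t) ⁻¹' Ioo (α j) (β j) := by
    rintro j t ⟨h1, h2⟩
    have ht1 : -(Real.pi / 2) < t := (Real.neg_pi_div_two_lt_arctan _).trans h1
    have ht2 : t < Real.pi / 2 := h2.trans (Real.arctan_lt_pi_div_two _)
    rw [← Real.arctan_tan ht1 ht2] at h1 h2
    have h3 := Real.arctan_strictMono.lt_iff_lt.1 h1
    have h4 := Real.arctan_strictMono.lt_iff_lt.1 h2
    rw [div_lt_iff₀ hw'] at h3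
    rw [lt_div_iff₀ hw'] at h4
    constructor <;> linarith
  have hd : (A : Set ι).PairwiseDisjoint fun j => Ioo (T (α j)) (T (β j)) :=
    fun i hi j hj hij => ((hdisj hi hj hij).preimage _).mono (hsub i) (hsub j)
  have h1 := MeasureTheory.measure_biUnion_finset (μ := MeasureTheory.volume) hd
    fun _ _ => measurableSet_Ioo
  have h2 : MeasureTheory.volume (⋃ j ∈ A, Ioo (T (α j)) (T (β j))) ≤
      MeasureTheory.volume (Ioo (-(Real.pi / 2)) (Real.pi / 2)) := by
    refine MeasureTheory.measure_mono (iUnion₂_subset fun j _ => ?_)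
    exact Ioo_subset_Ioo (Real.neg_pi_div_two_lt_arctan _).le (Real.arctan_lt_pi_div_two _).le
  simp only [Real.volume_Ioo] at h1 h2
  rw [h1, ← ENNReal.ofReal_sum_of_nonneg] at h2
  · rw [ENNReal.ofReal_le_ofReal_iff (by linarith [Real.pi_pos])] at h2
    rw [Finset.sum_congr rfl fun j _ => viewAngle_eq hw (α j) (β j)]
    linarith
  · intro j hj
    rw [← viewAngle_eq hw]
    exact viewAngle_nonneg hw (hαβ j hj)

lemma tendsto_arg_sub_of_lt {β x : ℝ} (hx : x < β) :
    Tendsto (fun w : ℂ => (w - β).arg) (𝓝[ℂ₊] (x : ℂ)) (𝓝 Real.pi) := by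
  have h1 := Complex.tendsto_arg_nhdsWithin_im_nonneg_of_re_neg_of_im_zero (z := (x : ℂ) - β)
    (by simpa using hx) (by simp)
  refine h1.comp (tendsto_nhdsWithin_of_tendsto_nhds_of_eventually_within _ ?_ ?_)
  · exact ((continuous_id.sub continuous_const).tendsto _).mono_left nhdsWithin_le_nhds
  · filter_upwards [self_mem_nhdsWithin] with w hw
    have : 0 < w.im := hw
    simpa using this.le

lemma tendsto_arg_sub_of_gt {α x : ℝ} (hx : α < x) :
    Tendsto (fun w : ℂ => (w - α).arg) (𝓝[ℂ₊] (x : ℂ)) (𝓝 0) := by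
  have h1 : ContinuousAt (fun w : ℂ => (w - α).arg) x := by
    refine ContinuousAt.comp (f := fun w : ℂ => w - α) (Complex.continuousAt_arg ?_) (by fun_prop)
    left
    simpa using hx
  have h2 := h1.tendsto
  rw [← Complex.ofReal_sub, Complex.arg_ofReal_of_nonneg (by linarith)] at h2
  exact h2.mono_left nhdsWithin_le_nhds

lemma tendsto_viewAngle_of_mem {α β x : ℝ} (hx : x ∈ Ioo α β) :
    Tendsto (viewAngle α β) (𝓝[ℂ₊] (x : ℂ)) (𝓝 Real.pi) := by
  have h := (tendsto_arg_sub_of_lt hx.2).sub (tendsto_arg_sub_of_gt hx.1)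
  rwa [sub_zero] at h

lemma tendsto_viewAngle_of_notMem {α β x : ℝ} (hαβ : α ≤ β) (hx : x ∉ Icc α β) :
    Tendsto (viewAngle α β) (𝓝[ℂ₊] (x : ℂ)) (𝓝 0) := by
  rw [mem_Icc, not_and_or, not_le, not_le] at hx
  rcases hx with hx | hx
  · have h := (tendsto_arg_sub_of_lt (hx.trans_le hαβ)).sub (tendsto_arg_sub_of_lt hx)
    rwa [sub_self] at h
  · have h := (tendsto_arg_sub_of_gt hx).sub (tendsto_arg_sub_of_gt (hαβ.trans_lt hx))
    rwa [sub_self] at h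

/-- The angle is the argument of a single quotient, which is close to `1` near infinity. -/
lemma viewAngle_eq_arg {w : ℂ} (hw : w ∈ ℂ₊) {α β : ℝ} (hαβ : α ≤ β) :
    viewAngle α β w = (1 + (α - β) / (w - α)).arg := by
  have hα := Complex.slitPlane_ne_zero (sub_ofReal_mem_slitPlane hw α)
  have hβ := Complex.slitPlane_ne_zero (sub_ofReal_mem_slitPlane hw β)
  have h1 : 1 + ((α : ℂ) - β) / (w - α) = (w - β) * (w - α)⁻¹ := by
    field_simp
    ring
  have hinv : ((w - α)⁻¹).arg = -(w - α).arg := by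
    rw [Complex.arg_inv, if_neg (Complex.mem_slitPlane_iff_arg.1 (sub_ofReal_mem_slitPlane hw α)).1]
  rw [h1, (Complex.arg_mul_eq_add_arg_iff hβ (inv_ne_zero hα)).2, hinv, viewAngle, sub_eq_add_neg]
  rw [hinv, ← sub_eq_add_neg]
  have h2 := viewAngle_nonneg hw hαβ
  have h3 := viewAngle_lt_pi hw α β
  rw [viewAngle] at h2 h3
  exact ⟨by linarith [Real.pi_pos], h3.le⟩

lemma tendsto_viewAngle_cocompact {α β : ℝ} (hαβ : α ≤ β) :
    Tendsto (viewAngle α β) (cocompact ℂ ⊓ 𝓟 ℂ₊) (𝓝 0) := by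
  have h1 : Tendsto (fun w : ℂ => w - α) (cocompact ℂ) (cocompact ℂ) :=
    (Homeomorph.subRight (α : ℂ)).isClosedEmbedding.tendsto_cocompact
  have h2 : Tendsto (fun w : ℂ => 1 + ((α : ℂ) - β) / (w - α)) (cocompact ℂ) (𝓝 1) := by
    have h3 := ((tendsto_inv₀_cobounded (α := ℂ)).comp
      (by rwa [← Metric.cobounded_eq_cocompact] at h1)).const_mul ((α : ℂ) - β)
    rw [Metric.cobounded_eq_cocompact] at h3
    simpa [div_eq_mul_inv] using h3.const_add 1
  have h4 := (Complex.continuousAt_arg Complex.one_mem_slitPlane).tendsto.comp h2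
  rw [Complex.arg_one] at h4
  refine (h4.mono_left inf_le_left).congr' ?_
  filter_upwards [mem_inf_of_right (mem_principal_self _)] with w hw
  rw [viewAngle_eq_arg hw hαβ]
  rfl

/-- If `φ(i y) / (i y) → 1`, then the angle under which `[α, β]` is seen from `φ(i y)` is
asymptotically its length divided by `y`. -/
lemma tendsto_mul_viewAngle {φ : ℂ → ℂ} (hm : ∀ z ∈ ℂ₊, φ z ∈ ℂ₊)
    (hi : Tendsto (fun y : ℝ => φ (y * Complex.I) / (y * Complex.I)) atTop (𝓝 1)) {α β : ℝ}
    (hαβ : α ≤ β) :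
    Tendsto (fun y : ℝ => y * viewAngle α β (φ (y * Complex.I))) atTop (𝓝 (β - α)) := by
  have hinv : Tendsto (fun y : ℝ => ((y : ℂ))⁻¹) atTop (𝓝 0) := by
    have h1 : Tendsto (fun y : ℝ => ((y⁻¹ : ℝ) : ℂ)) atTop (𝓝 ((0 : ℝ) : ℂ)) :=
      (Complex.continuous_ofReal.tendsto _).comp tendsto_inv_atTop_zero
    simpa using h1
  have h1 : Tendsto (fun y : ℝ => (y : ℂ) * (((α : ℂ) - β) / (φ (y * Complex.I) - α))) atTop
      (𝓝 ((β - α) * Complex.I)) := by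
    have h2 := ((hi.mul_const Complex.I).sub (hinv.const_mul (α : ℂ))).inv₀ (by simp)
    have h3 := h2.const_mul ((α : ℂ) - β)
    have h4 : ((α : ℂ) - β) * (1 * Complex.I - α * 0)⁻¹ = (β - α) * Complex.I := by
      simp
      ring
    rw [h4] at h3
    refine h3.congr' ?_
    filter_upwards [eventually_gt_atTop 0] with y hy
    have hy' : (y : ℂ) ≠ 0 := by exact_mod_cast hy.ne'
    have hmem : (y * Complex.I : ℂ) ∈ ℂ₊ := by
      rw [mem_upperHalfPlaneSet_iff]
      simpa using hy
    have h5 := Complex.slitPlane_ne_zero (sub_ofReal_mem_slitPlane (hm _ hmem) α)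
    have h6 : φ (y * Complex.I) / (y * Complex.I) * Complex.I - α * (y : ℂ)⁻¹
        = (φ (y * Complex.I) - α) / y := by
      field_simp [Complex.I_ne_zero]
    rw [h6, inv_div, mul_div_assoc', mul_div_assoc', mul_comm]
  have h2 := (Complex.continuous_im.tendsto _).comp
    (Complex.tendsto_mul_log_one_add_of_tendsto h1)
  have h3 : (((β : ℂ) - α) * Complex.I).im = β - α := by simp
  rw [h3] at h2
  refine h2.congr' ?_
  filter_upwards [eventually_gt_atTop 0] with y hy
  have hmem : (y * Complex.I : ℂ) ∈ ℂ₊ := by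
    rw [mem_upperHalfPlaneSet_iff]
    simpa using hy
  rw [Function.comp_apply, Complex.im_ofReal_mul, Complex.log_im, viewAngle_eq_arg (hm _ hmem) hαβ]

/-! ### Comparison of harmonic measures -/

section harmonicMeasure

variable {φ : ℂ → ℂ} {A : Finset ℕ} {α β : ℕ → ℝ} {G : Set ℕ} {a b : ℕ → ℝ}

/-- Let `φ` be a holomorphic self-map of the upper half-plane that fixes infinity and whose boundary
values off the intervals `(a k, b k)` are real and outside the intervals `[α j, β j]`. By the
maximum principle, the harmonic measure of the second system of intervals at `φ z` is at most that
of the first one at `z`. As the `[α j, β j]` have a positive distance to the image of the complement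
of the `(a k, b k)`, finitely many `(a k, b k)` suffice, up to an error `ε`. -/
theorem exists_sum_viewAngle_comp_le (hd : DifferentiableOn ℂ φ ℂ₊) (hm : ∀ z ∈ ℂ₊, φ z ∈ ℂ₊)
    (hinf : Tendsto φ (cocompact ℂ ⊓ 𝓟 ℂ₊) (cocompact ℂ)) (hαβ : ∀ j ∈ A, α j ≤ β j)
    (hdisj : (A : Set ℕ).PairwiseDisjoint fun j => Ioo (α j) (β j)) (hab : ∀ k ∈ G, a k ≤ b k)
    (hoff : ∀ x : ℝ, (∀ k ∈ G, x ∉ Ioo (a k) (b k)) → ∃ y : ℝ,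
      Tendsto φ (𝓝[ℂ₊] (x : ℂ)) (𝓝 (y : ℂ)) ∧ ∀ j ∈ A, y ∉ Icc (α j) (β j)) {ε : ℝ} (hε : 0 < ε) :
    ∃ K : Finset ℕ, (K : Set ℕ) ⊆ G ∧ ∀ z ∈ ℂ₊,
      ∑ j ∈ A, viewAngle (α j) (β j) (φ z) ≤ ∑ k ∈ K, viewAngle (a k) (b k) z + ε := by
  set V : ℂ → ℝ := fun z => ∑ j ∈ A, viewAngle (α j) (β j) (φ z) with hV
  have hVinf : Tendsto V (cocompact ℂ ⊓ 𝓟 ℂ₊) (𝓝 0) := by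
    rw [← Finset.sum_const_zero (s := A)]
    refine tendsto_finsetSum _ fun j hj => (tendsto_viewAngle_cocompact (hαβ j hj)).comp ?_
    exact tendsto_inf.2 ⟨hinf, tendsto_principal.2 (mem_inf_of_right (mem_principal.2 hm))⟩
  -- The real points near which `V` is not small form a compact set.
  set Z : Set ℝ := {x | ¬ ∀ᶠ z in 𝓝[ℂ₊] (x : ℂ), V z < ε} with hZ
  have hZclosed : IsClosed Z := by
    rw [← isOpen_compl_iff, isOpen_iff_mem_nhds]
    intro x hx
    simp only [hZ, mem_compl_iff, mem_ofPred, not_not] at hx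
    have h1 := eventually_eventually_nhds.2 (eventually_nhdsWithin_iff.1 hx)
    filter_upwards [Complex.continuous_ofReal.continuousAt.eventually h1] with y hy
    simp only [hZ, mem_compl_iff, mem_ofPred, not_not]
    exact eventually_nhdsWithin_iff.2 hy
  obtain ⟨R, hR⟩ : ∃ R : ℝ, ∀ z ∈ ℂ₊, R < ‖z‖ → V z < ε := by
    have h1 := hVinf.eventually (gt_mem_nhds hε)
    rw [eventually_inf_principal, ← Metric.cobounded_eq_cocompact,
      (hasBasis_cobounded_norm (E := ℂ)).eventually_iff] at h1
    obtain ⟨R, -, hR⟩ := h1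
    exact ⟨R, fun z hz hz' => hR (show R ≤ ‖z‖ from hz'.le) hz⟩
  have hZsub : Z ⊆ Metric.closedBall 0 R := by
    intro x hx
    by_contra hcon
    rw [mem_closedBall_zero_iff, not_le] at hcon
    refine hx ?_
    have h1 : ∀ᶠ z in 𝓝 (x : ℂ), R < ‖z‖ :=
      continuous_norm.continuousAt.eventually (lt_mem_nhds (by simpa using hcon))
    filter_upwards [h1.filter_mono nhdsWithin_le_nhds, self_mem_nhdsWithin] with z hz hz'
      using hR z hz' hz
  have hZc : IsCompact Z := (isCompact_closedBall _ _).of_isClosed_subset hZclosed hZsub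
  have hZG : Z ⊆ ⋃ k ∈ G, Ioo (a k) (b k) := by
    intro x hx
    by_contra hcon
    simp only [mem_iUnion, not_exists] at hcon
    obtain ⟨y, hy, hyA⟩ := hoff x fun k hk => hcon k hk
    refine hx (Tendsto.eventually ?_ (gt_mem_nhds hε))
    rw [← Finset.sum_const_zero (s := A)]
    refine tendsto_finsetSum _ fun j hj =>
      (tendsto_viewAngle_of_notMem (hαβ j hj) (hyA j hj)).comp ?_
    refine tendsto_nhdsWithin_of_tendsto_nhds_of_eventually_within _ hy ?_
    filter_upwards [self_mem_nhdsWithin] with z hz using hm z hz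
  obtain ⟨K, hKG, hK⟩ : ∃ K : Finset ℕ, (K : Set ℕ) ⊆ G ∧ Z ⊆ ⋃ k ∈ K, Ioo (a k) (b k) := by
    obtain ⟨K, hKG, hKf, hK⟩ := hZc.elim_finite_subcover_image (fun k _ => isOpen_Ioo) hZG
    exact ⟨hKf.toFinset, by simpa using hKG, by simpa using hK⟩
  refine ⟨K, hKG, fun z hz => ?_⟩
  set P : ℂ → ℝ := fun z => ∑ k ∈ K, viewAngle (a k) (b k) z with hP
  have hP0 : ∀ z ∈ ℂ₊, 0 ≤ P z := fun z hz =>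
    Finset.sum_nonneg fun k hk => viewAngle_nonneg hz (hab k (hKG hk))
  set f : ℂ → ℂ := fun z => Complex.exp (-Complex.I *
    (∑ j ∈ A, (Complex.log (φ z - β j) - Complex.log (φ z - α j))
      - ∑ k ∈ K, (Complex.log (z - b k) - Complex.log (z - a k)))) with hf
  have hfn : ∀ z, ‖f z‖ = Real.exp (V z - P z) := by
    intro z
    rw [hf, Complex.norm_exp]
    congr 1
    rw [neg_mul, Complex.neg_re, Complex.I_mul_re, neg_neg, Complex.sub_im, Complex.im_sum,
      Complex.im_sum]
    simp only [Complex.sub_im, Complex.log_im, hV, hP, viewAngle]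
  have hfd : DifferentiableOn ℂ f ℂ₊ := by
    refine (DifferentiableOn.const_mul (DifferentiableOn.sub ?_ ?_) _).cexp
    · refine DifferentiableOn.fun_sum fun j _ => DifferentiableOn.sub ?_ ?_
      · exact (hd.sub_const _).clog fun z hz => sub_ofReal_mem_slitPlane (hm z hz) _
      · exact (hd.sub_const _).clog fun z hz => sub_ofReal_mem_slitPlane (hm z hz) _
    · refine DifferentiableOn.fun_sum fun j _ => DifferentiableOn.sub ?_ ?_
      · exact (differentiableOn_id.sub_const _).clog fun z hz => sub_ofReal_mem_slitPlane hz _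
      · exact (differentiableOn_id.sub_const _).clog fun z hz => sub_ofReal_mem_slitPlane hz _
  have hfle : ∀ c > Real.exp ε, ∀ z ∈ ℂ₊, V z < ε → ‖f z‖ < c := by
    intro c hc z hz hzV
    rw [hfn]
    exact (Real.exp_le_exp.2 (by linarith [hP0 z hz])).trans_lt hc
  have hmax := norm_le_of_boundary_limsup_le hfd (C := Real.exp ε) ?_ ?_ z hz
  · rw [hfn, Real.exp_le_exp] at hmax
    linarith
  · intro x c hc
    by_cases hx : x ∈ Z
    · obtain ⟨k, hk, hxk⟩ : ∃ k ∈ K, x ∈ Ioo (a k) (b k) := by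
        simpa only [mem_iUnion, exists_prop] using hK hx
      have h1 := (tendsto_viewAngle_of_mem hxk).eventually
        (lt_mem_nhds (show Real.pi - ε < Real.pi by linarith))
      filter_upwards [h1, self_mem_nhdsWithin] with w hw hw'
      rw [hfn]
      refine (Real.exp_le_exp.2 ?_).trans_lt hc
      have h2 := sum_viewAngle_le_pi hαβ hdisj (hm w hw')
      have h3 := Finset.single_le_sum (f := fun k => viewAngle (a k) (b k) w)
        (fun k hk => viewAngle_nonneg hw' (hab k (hKG hk))) hk
      simp only [hV, hP]
      linarith
    · simp only [hZ, mem_ofPred, not_not] at hx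
      filter_upwards [hx, self_mem_nhdsWithin] with w hw hw' using hfle c hc w hw' hw
  · intro c hc
    filter_upwards [hVinf.eventually (gt_mem_nhds hε), mem_inf_of_right (mem_principal_self _)]
      with w hw hw' using hfle c hc w hw' hw

/-- The comparison of harmonic measures, read off at `i y` for `y → ∞`, is a comparison of
lengths. -/
theorem sum_length_le_tsum (hd : DifferentiableOn ℂ φ ℂ₊) (hm : ∀ z ∈ ℂ₊, φ z ∈ ℂ₊)
    (hinf : Tendsto φ (cocompact ℂ ⊓ 𝓟 ℂ₊) (cocompact ℂ))
    (hi : Tendsto (fun y : ℝ => φ (y * Complex.I) / (y * Complex.I)) atTop (𝓝 1))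
    (hαβ : ∀ j ∈ A, α j ≤ β j)
    (hdisj : (A : Set ℕ).PairwiseDisjoint fun j => Ioo (α j) (β j)) (hab : ∀ k ∈ G, a k ≤ b k)
    (hoff : ∀ x : ℝ, (∀ k ∈ G, x ∉ Ioo (a k) (b k)) → ∃ y : ℝ,
      Tendsto φ (𝓝[ℂ₊] (x : ℂ)) (𝓝 (y : ℂ)) ∧ ∀ j ∈ A, y ∉ Icc (α j) (β j)) :
    ∑ j ∈ A, ENNReal.ofReal (β j - α j) ≤ ∑' k : G, ENNReal.ofReal (b k - a k) := by
  rcases eq_or_ne (∑' k : G, ENNReal.ofReal (b k - a k)) ⊤ with hS | hS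
  · rw [hS]
    exact le_top
  set S := (∑' k : G, ENNReal.ofReal (b k - a k)).toReal with hSd
  have hKS : ∀ K : Finset ℕ, (K : Set ℕ) ⊆ G → ∑ k ∈ K, (b k - a k) ≤ S := by
    intro K hK
    rw [hSd, ← ENNReal.ofReal_le_iff_le_toReal hS,
      ENNReal.ofReal_sum_of_nonneg fun k hk => sub_nonneg.2 (hab k (hK hk)),
      tsum_subtype G fun k => ENNReal.ofReal (b k - a k)]
    refine le_trans (Finset.sum_le_sum fun k hk => ?_) (ENNReal.sum_le_tsum K)
    rw [indicator_of_mem (hK hk)]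
  have key : ∀ z ∈ ℂ₊, ∑ j ∈ A, viewAngle (α j) (β j) (φ z) ≤ S / z.im := by
    intro z hz
    have hz' : 0 < z.im := hz
    refine le_of_forall_pos_le_add fun ε hε => ?_
    obtain ⟨K, hKG, hK⟩ := exists_sum_viewAngle_comp_le hd hm hinf hαβ hdisj hab hoff hε
    refine (hK z hz).trans (add_le_add_left ?_ ε)
    calc ∑ k ∈ K, viewAngle (a k) (b k) z ≤ ∑ k ∈ K, (b k - a k) / z.im :=
          Finset.sum_le_sum fun k hk => viewAngle_le_div hz (hab k (hKG hk))
      _ = (∑ k ∈ K, (b k - a k)) / z.im := (Finset.sum_div _ _ _).symm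
      _ ≤ S / z.im := div_le_div_of_nonneg_right (hKS K hKG) hz'.le
  have hlim : Tendsto (fun y : ℝ => ∑ j ∈ A, y * viewAngle (α j) (β j) (φ (y * Complex.I))) atTop
      (𝓝 (∑ j ∈ A, (β j - α j))) :=
    tendsto_finsetSum _ fun j hj => tendsto_mul_viewAngle hm hi (hαβ j hj)
  rw [← ENNReal.ofReal_sum_of_nonneg fun j hj => sub_nonneg.2 (hαβ j hj),
    ENNReal.ofReal_le_iff_le_toReal hS]
  refine le_of_tendsto hlim ?_
  filter_upwards [eventually_gt_atTop 0] with y hy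
  have hmem : (y * Complex.I : ℂ) ∈ ℂ₊ := by
    rw [mem_upperHalfPlaneSet_iff]
    simpa using hy
  have h1 := key _ hmem
  have h2 : (y * Complex.I : ℂ).im = y := by simp
  rw [h2, le_div_iff₀ hy] at h1
  rwa [← Finset.mul_sum, mul_comm]

/-- The same with open intervals `(α j, β j)`, which are exhausted by compact ones. -/
theorem sum_length_le_tsum_of_notMem_Ioo (hd : DifferentiableOn ℂ φ ℂ₊) (hm : ∀ z ∈ ℂ₊, φ z ∈ ℂ₊)
    (hinf : Tendsto φ (cocompact ℂ ⊓ 𝓟 ℂ₊) (cocompact ℂ))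
    (hi : Tendsto (fun y : ℝ => φ (y * Complex.I) / (y * Complex.I)) atTop (𝓝 1))
    (hαβ : ∀ j ∈ A, α j < β j)
    (hdisj : (A : Set ℕ).PairwiseDisjoint fun j => Ioo (α j) (β j)) (hab : ∀ k ∈ G, a k ≤ b k)
    (hoff : ∀ x : ℝ, (∀ k ∈ G, x ∉ Ioo (a k) (b k)) → ∃ y : ℝ,
      Tendsto φ (𝓝[ℂ₊] (x : ℂ)) (𝓝 (y : ℂ)) ∧ ∀ j ∈ A, y ∉ Ioo (α j) (β j)) :
    ∑ j ∈ A, ENNReal.ofReal (β j - α j) ≤ ∑' k : G, ENNReal.ofReal (b k - a k) := by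
  have hlim : Tendsto (fun t : ℝ => ∑ j ∈ A, ENNReal.ofReal ((β j - t) - (α j + t))) (𝓝[>] 0)
      (𝓝 (∑ j ∈ A, ENNReal.ofReal (β j - α j))) := by
    have h1 : Continuous fun t : ℝ => ∑ j ∈ A, ENNReal.ofReal ((β j - t) - (α j + t)) :=
      continuous_finsetSum _ fun j _ => ENNReal.continuous_ofReal.comp (by fun_prop)
    have h2 := (h1.tendsto 0).mono_left (nhdsWithin_le_nhds (s := Ioi 0))
    simpa using h2
  have hsmall : ∀ᶠ t : ℝ in 𝓝[>] 0, ∀ j ∈ A, α j + t ≤ β j - t := by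
    rw [Finset.eventually_all]
    intro j hj
    have h1 : ∀ᶠ t : ℝ in 𝓝 0, t < (β j - α j) / 2 :=
      gt_mem_nhds (by linarith [hαβ j hj])
    filter_upwards [h1.filter_mono nhdsWithin_le_nhds] with t ht
    linarith
  refine le_of_tendsto hlim ?_
  filter_upwards [hsmall, self_mem_nhdsWithin] with t ht ht0
  have ht0' : 0 < t := ht0
  refine sum_length_le_tsum (α := fun j => α j + t) (β := fun j => β j - t) hd hm hinf hi ht ?_ hab
    fun x hx => ?_
  · exact hdisj.mono_on fun j _ => Ioo_subset_Ioo (by linarith) (by linarith)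
  · obtain ⟨y, hy, hyA⟩ := hoff x hx
    exact ⟨y, hy, fun j hj hcon => hyA j hj ⟨by linarith [hcon.1], by linarith [hcon.2]⟩⟩

end harmonicMeasure

/-! ### Comparison of the gaps -/

lemma combDomain_anti {I I' : Set ℕ} (h : I' ⊆ I) (u v : ℕ → ℝ) :
    combDomain I u v ⊆ combDomain I' u v :=
  sdiff_subset_sdiff_right (biUnion_subset_biUnion_left h)

section gaps

variable {J J' : Set ℕ} {u h : ℕ → ℝ} {Θ Θ' : ℂ → ℂ}

lemma tendsto_comparisonMap_div_imaginary_axis (hc : IsComb J u h) (hc' : IsComb J' u h)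
    (hΘ : IsProperConformalOnto (combDomain J u h) Θ)
    (hΘ' : IsProperConformalOnto (combDomain J' u h) Θ') (hJ : J' ⊆ J)
    (hasy : (fun x : ℝ => boundaryExt Θ x) ~[atBot] fun x : ℝ => (x : ℂ) ^ (1 / 2 : ℂ))
    (hasy' : (fun x : ℝ => boundaryExt Θ' x) ~[atBot] fun x : ℝ => (x : ℂ) ^ (1 / 2 : ℂ)) :
    Tendsto (fun y : ℝ => comparisonMap Θ' Θ (y * Complex.I) / (y * Complex.I)) atTop (𝓝 1) := by
  have hsub := combDomain_anti hJ u h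
  exact tendsto_div_imaginary_axis (differentiableOn_comparisonMap hΘ hΘ' hsub)
    (fun z hz => comparisonMap_mem hΘ hΘ' hsub hz)
    (fun x => ⟨_, tendsto_boundaryExt_comparisonMap hΘ hΘ' hsub x⟩)
    (tendsto_comparisonMap_div_atBot hc hc' hΘ hΘ' hsub hasy hasy')

/-- On the closure of a gap that belongs to a slit of both combs, the comparison map is real. -/
lemma boundaryExt_comparisonMap_eq_ofReal_of_mem_gap (hc : IsComb J u h)
    (hΘ : IsProperConformalOnto (combDomain J u h) Θ)
    (hΘ' : IsProperConformalOnto (combDomain J' u h) Θ') (hJ : J' ⊆ J) {j : ℕ} (hj : j ∈ J') {x : ℝ}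
    (hx : x ∈ Icc (gapLeft Θ (u j) (h j)) (gapRight Θ (u j) (h j))) :
    boundaryExt (comparisonMap Θ' Θ) x = ((boundaryExt (comparisonMap Θ' Θ) x).re : ℂ) := by
  have hsub := combDomain_anti hJ u h
  obtain ⟨hlt, hpre⟩ := hc.slitPreimage_eq_Ioo hΘ (hJ hj)
  have hcont : Continuous fun x : ℝ => boundaryExt (comparisonMap Θ' Θ) x :=
    continuous_boundaryExt_comparisonMap hΘ hΘ' hsub
  have hcl : IsClosed {x : ℝ | boundaryExt (comparisonMap Θ' Θ) x =
      ((boundaryExt (comparisonMap Θ' Θ) x).re : ℂ)} :=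
    isClosed_eq hcont (Complex.continuous_ofReal.comp (Complex.continuous_re.comp hcont))
  rw [← closure_Ioo hlt.ne] at hx
  refine closure_minimal (fun t ht => ?_) hcl hx
  rw [← hpre, hΘ.mem_slitPreimage_iff] at ht
  exact boundaryExt_comparisonMap_eq_ofReal hΘ hΘ' hsub (slit_notMem_combDomain hj ht)

/-- Filling slits in does not shorten the remaining gaps, as `φ(z) - z` has nonnegative imaginary
part and hence increases along intervals where it is real. -/
theorem gap_length_le (hc : IsComb J u h) (hc' : IsComb J' u h)
    (hΘ : IsProperConformalOnto (combDomain J u h) Θ)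
    (hΘ' : IsProperConformalOnto (combDomain J' u h) Θ') (hJ : J' ⊆ J)
    (hasy : (fun x : ℝ => boundaryExt Θ x) ~[atBot] fun x : ℝ => (x : ℂ) ^ (1 / 2 : ℂ))
    (hasy' : (fun x : ℝ => boundaryExt Θ' x) ~[atBot] fun x : ℝ => (x : ℂ) ^ (1 / 2 : ℂ)) {j : ℕ}
    (hj : j ∈ J') :
    gapRight Θ (u j) (h j) - gapLeft Θ (u j) (h j) ≤
      (boundaryExt (comparisonMap Θ' Θ) (gapRight Θ (u j) (h j))).re -
        (boundaryExt (comparisonMap Θ' Θ) (gapLeft Θ (u j) (h j))).re := by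
  have hsub := combDomain_anti hJ u h
  obtain ⟨hlt, -⟩ := hc.slitPreimage_eq_Ioo hΘ (hJ hj)
  set a := gapLeft Θ (u j) (h j)
  set b := gapRight Θ (u j) (h j)
  set φ := comparisonMap Θ' Θ with hφ
  have hd := differentiableOn_comparisonMap hΘ hΘ' hsub
  have hcont : Continuous fun x : ℝ => (boundaryExt φ x).re - x :=
    (Complex.continuous_re.comp (continuous_boundaryExt_comparisonMap hΘ hΘ' hsub)).sub
      continuous_id
  have hmono : MonotoneOn (fun x : ℝ => (boundaryExt φ x).re - x) (Ioo a b) := by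
    refine monotoneOn_of_im_nonneg (f := fun z => φ z - z) (hd.sub differentiableOn_id) ?_ ?_
    · intro z hz
      rw [Complex.sub_im, sub_nonneg]
      exact im_le_im_of_tendsto_div hd (fun z hz => comparisonMap_mem hΘ hΘ' hsub hz)
        (fun x => ⟨_, tendsto_boundaryExt_comparisonMap hΘ hΘ' hsub x⟩)
        (tendsto_comparisonMap_div_imaginary_axis hc hc' hΘ hΘ' hJ hasy hasy') hz
    · intro x hx
      rw [Complex.ofReal_sub,
        ← boundaryExt_comparisonMap_eq_ofReal_of_mem_gap hc hΘ hΘ' hJ hj (Ioo_subset_Icc_self hx)]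
      exact (tendsto_boundaryExt_comparisonMap hΘ hΘ' hsub x).sub
        (continuousAt_id.tendsto.mono_left nhdsWithin_le_nhds)
  have hle : (boundaryExt φ a).re - a ≤ (boundaryExt φ b).re - b := by
    have h1 : Tendsto (fun t : ℝ => a + t) (𝓝[>] 0) (𝓝 a) :=
      ((continuous_const.add continuous_id).tendsto' 0 a (add_zero a)).mono_left nhdsWithin_le_nhds
    have h2 : Tendsto (fun t : ℝ => b - t) (𝓝[>] 0) (𝓝 b) :=
      ((continuous_const.sub continuous_id).tendsto' 0 b (sub_zero b)).mono_left nhdsWithin_le_nhds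
    refine le_of_tendsto_of_tendsto ((hcont.tendsto a).comp h1) ((hcont.tendsto b).comp h2) ?_
    filter_upwards [Ioo_mem_nhdsGT (show (0 : ℝ) < (b - a) / 2 by linarith)] with t ht
    exact hmono ⟨by linarith [ht.1], by linarith [ht.2]⟩ ⟨by linarith [ht.2], by linarith [ht.1]⟩
      (by linarith [ht.2])
  linarith

/-- The comparison map sends a gap of `Θ` into the gap of `Θ'` that belongs to the same slit. -/
lemma comparisonMap_gap_length_le (hc : IsComb J u h) (hc' : IsComb J' u h)
    (hΘ : IsProperConformalOnto (combDomain J u h) Θ)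
    (hΘ' : IsProperConformalOnto (combDomain J' u h) Θ') (hJ : J' ⊆ J) {j : ℕ} (hj : j ∈ J') :
    (boundaryExt (comparisonMap Θ' Θ) (gapRight Θ (u j) (h j))).re -
        (boundaryExt (comparisonMap Θ' Θ) (gapLeft Θ (u j) (h j))).re ≤
      gapRight Θ' (u j) (h j) - gapLeft Θ' (u j) (h j) := by
  have hsub := combDomain_anti hJ u h
  obtain ⟨hlt, hpre⟩ := hc.slitPreimage_eq_Ioo hΘ (hJ hj)
  obtain ⟨hlt', hpre'⟩ := hc'.slitPreimage_eq_Ioo hΘ' hj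
  have hcont : Continuous fun x : ℝ => (boundaryExt (comparisonMap Θ' Θ) x).re :=
    Complex.continuous_re.comp (continuous_boundaryExt_comparisonMap hΘ hΘ' hsub)
  have hmaps : MapsTo (fun x : ℝ => (boundaryExt (comparisonMap Θ' Θ) x).re)
      (Ioo (gapLeft Θ (u j) (h j)) (gapRight Θ (u j) (h j)))
      (Ioo (gapLeft Θ' (u j) (h j)) (gapRight Θ' (u j) (h j))) := by
    intro x hx
    have h1 := boundaryExt_comparisonMap_eq_ofReal_of_mem_gap hc hΘ hΘ' hJ hj
      (Ioo_subset_Icc_self hx)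
    rw [← hpre, hΘ.mem_slitPreimage_iff, ← (boundaryExt_comparisonMap hΘ hΘ' hsub x).2, h1] at hx
    rw [← hpre']
    exact hΘ'.mem_slitPreimage_iff.2 hx
  have hcl := hmaps.closure hcont
  rw [closure_Ioo hlt.ne, closure_Ioo hlt'.ne] at hcl
  have h1 := hcl (left_mem_Icc.2 hlt.le)
  have h2 := hcl (right_mem_Icc.2 hlt.le)
  linarith [h1.1, h2.2]

lemma pairwiseDisjoint_gap (hc : IsComb J u h)
    (hΘ : IsProperConformalOnto (combDomain J u h) Θ) :
    J.PairwiseDisjoint fun j => Ioo (gapLeft Θ (u j) (h j)) (gapRight Θ (u j) (h j)) := by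
  intro j hj k hk hjk
  simp only [Function.onFun]
  rw [← (hc.slitPreimage_eq_Ioo hΘ hj).2, ← (hc.slitPreimage_eq_Ioo hΘ hk).2,
    Set.disjoint_left]
  intro x hxj hxk
  rw [hΘ.mem_slitPreimage_iff] at hxj hxk
  exact hjk (disjoint_slit hc hj hk hxj hxk)

/-- The total length of the gaps does not increase when slits are filled in, provided that the gaps
of all removed slits are counted. -/
theorem sum_gap_length_le (hc : IsComb J u h) (hc' : IsComb J' u h)
    (hΘ : IsProperConformalOnto (combDomain J u h) Θ)
    (hΘ' : IsProperConformalOnto (combDomain J' u h) Θ') (hJ : J' ⊆ J)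
    (hasy : (fun x : ℝ => boundaryExt Θ x) ~[atBot] fun x : ℝ => (x : ℂ) ^ (1 / 2 : ℂ))
    (hasy' : (fun x : ℝ => boundaryExt Θ' x) ~[atBot] fun x : ℝ => (x : ℂ) ^ (1 / 2 : ℂ))
    {A : Finset ℕ} {G : Set ℕ} (hA : (A : Set ℕ) ⊆ J') (hAG : (A : Set ℕ) ⊆ G) (hG : G ⊆ J)
    (hJG : J \ J' ⊆ G) :
    ∑ j ∈ A, ENNReal.ofReal (gapRight Θ' (u j) (h j) - gapLeft Θ' (u j) (h j)) ≤
      ∑' k : G, ENNReal.ofReal (gapRight Θ (u k) (h k) - gapLeft Θ (u k) (h k)) := by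
  have hsub := combDomain_anti hJ u h
  refine sum_length_le_tsum_of_notMem_Ioo (φ := comparisonMap Θ' Θ)
    (α := fun j => gapLeft Θ' (u j) (h j)) (β := fun j => gapRight Θ' (u j) (h j))
    (a := fun j => gapLeft Θ (u j) (h j)) (b := fun j => gapRight Θ (u j) (h j))
    (differentiableOn_comparisonMap hΘ hΘ' hsub)
    (fun z hz => comparisonMap_mem hΘ hΘ' hsub hz) (tendsto_comparisonMap_cocompact hΘ hΘ' hsub)
    (tendsto_comparisonMap_div_imaginary_axis hc hc' hΘ hΘ' hJ hasy hasy')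
    (fun j hj => (hc'.slitPreimage_eq_Ioo hΘ' (hA hj)).1)
    ((pairwiseDisjoint_gap hc' hΘ').subset hA)
    (fun k hk => (hc.slitPreimage_eq_Ioo hΘ (hG hk)).1.le) fun x hx => ?_
  -- Off the gaps counted on the right, `Θ` does not take values in the removed slits.
  have hxΩ' : boundaryExt Θ x ∉ combDomain J' u h := by
    intro hcon
    have h1 := mem_combDomain.1 hcon
    obtain ⟨k, hk, hks⟩ := exists_slit_of_notMem_combDomain (hΘ.boundaryExt_notMem x) h1.1 h1.2.1
    have hkJ' : k ∉ J' := fun hk' => slit_notMem_combDomain hk' hks hcon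
    refine hx k (hJG ⟨hk, hkJ'⟩) ?_
    rw [← (hc.slitPreimage_eq_Ioo hΘ hk).2]
    exact hΘ.mem_slitPreimage_iff.2 hks
  have hreal := boundaryExt_comparisonMap_eq_ofReal hΘ hΘ' hsub hxΩ'
  refine ⟨_, hreal ▸ tendsto_boundaryExt_comparisonMap hΘ hΘ' hsub x, fun j hj hcon => ?_⟩
  rw [← (hc'.slitPreimage_eq_Ioo hΘ' (hA hj)).2, hΘ'.mem_slitPreimage_iff, ← hreal,
    (boundaryExt_comparisonMap hΘ hΘ' hsub x).2] at hcon
  refine hx j (hAG hj) ?_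
  rw [← (hc.slitPreimage_eq_Ioo hΘ (hJ (hA hj))).2]
  exact hΘ.mem_slitPreimage_iff.2 hcon

end gaps

/-! ### Normalized conformal maps onto comb domains -/

namespace IsNormalizedConformalMap

variable {E₀ : ℝ} {I : Set ℕ} {u h : ℕ → ℝ} {Θ : ℂ → ℂ}

lemma isProper (hΘ : IsNormalizedConformalMap E₀ (combDomain I u h) Θ) (hc : IsComb I u h) :
    IsProperConformalOnto (combDomain I u h) Θ := by
  obtain ⟨g, hg, hasy⟩ := hΘ.asymptotic
  refine IsConformalOnto.isProper ⟨hΘ.differentiableOn, hΘ.bijOn⟩ hc hg ?_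
  have h1 : Tendsto (fun x : ℝ => ‖(x : ℂ) ^ (1 / 2 : ℂ)‖) atBot atTop := by
    refine (Real.tendsto_sqrt_atTop.comp tendsto_neg_atBot_atTop).congr' ?_
    filter_upwards [eventually_lt_atBot 0] with x hx
    rw [ofReal_cpow_half_of_neg hx]
    simp [abs_of_nonneg (Real.sqrt_nonneg _)]
  rw [← Metric.cobounded_eq_cocompact, ← tendsto_norm_atTop_iff_cobounded]
  exact hasy.symm.isBigO.trans_tendsto_norm_atTop h1

lemma isEquivalent_boundaryExt (hΘ : IsNormalizedConformalMap E₀ (combDomain I u h) Θ) :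
    (fun x : ℝ => boundaryExt Θ x) ~[atBot] fun x : ℝ => (x : ℂ) ^ (1 / 2 : ℂ) := by
  obtain ⟨g, hg, hasy⟩ := hΘ.asymptotic
  refine hasy.congr_left ?_
  filter_upwards [hg] with x hx
  exact tendsto_nhds_unique hx (tendsto_extendFrom ⟨_, hx⟩)

end IsNormalizedConformalMap

theorem mainTheorem8 (E₀ : ℝ) (J : Set ℕ) (u h : ℕ → ℝ)
    (hu_pos : ∀ j ∈ J, 0 < u j) (hu_inj : InjOn u J)
    (hh_pos : ∀ j ∈ J, 0 < h j) (hh_sum : Summable fun j : J => h j)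
    (JN : ℕ → Finset ℕ) (hJN_mono : Monotone JN) (hJN_union : ⋃ N, (JN N : Set ℕ) = J)
    (Θ : ℂ → ℂ) (hΘ : IsNormalizedConformalMap E₀ (combDomain J u h) Θ)
    (ΘN : ℕ → ℂ → ℂ)
    (hΘN : ∀ N, IsNormalizedConformalMap E₀ (combDomain (JN N) u h) (ΘN N))
    (a b : ℕ → ℝ) (ha : ∀ j, a j = gapLeft Θ (u j) (h j))
    (hb : ∀ j, b j = gapRight Θ (u j) (h j)) :
    (∀ j ∈ J, a j < b j ∧ slitPreimage Θ (u j) (h j) = Ioo (a j) (b j)) ∧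
    ∀ N, ∃ φa φb : ℕ → ℝ,
      (∀ j ∈ JN N, HasRealBoundaryValue (comparisonMap (ΘN N) Θ) (a j) (φa j) ∧
        HasRealBoundaryValue (comparisonMap (ΘN N) Θ) (b j) (φb j)) ∧
      (∀ j ∈ JN N, b j - a j ≤ φb j - φa j) ∧
      (∑ j ∈ JN N, ENNReal.ofReal (φb j - φa j) ≤ ∑' j : J, ENNReal.ofReal (b j - a j)) ∧
      (∀ M : ℕ, (∀ j ∈ J, j < M → j ∈ JN N) →
        ∑ j ∈ JN N with M ≤ j, ENNReal.ofReal (φb j - φa j) ≤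
          ∑' j : {j | j ∈ J ∧ M ≤ j}, ENNReal.ofReal (b j - a j)) := by
  obtain rfl : a = fun j => gapLeft Θ (u j) (h j) := funext ha
  obtain rfl : b = fun j => gapRight Θ (u j) (h j) := funext hb
  have hc : IsComb J u h := by
    refine ⟨hu_pos, hu_inj, hh_pos, fun δ hδ => ?_⟩
    have h1 := hh_sum.tendsto_cofinite_zero.eventually (gt_mem_nhds hδ)
    rw [eventually_cofinite] at h1
    refine (h1.image Subtype.val).subset ?_
    rintro j ⟨hj, hjδ⟩
    exact ⟨⟨j, hj⟩, not_lt.2 hjδ, rfl⟩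
  have hp := hΘ.isProper hc
  have hasy := hΘ.isEquivalent_boundaryExt
  refine ⟨fun j hj => hc.slitPreimage_eq_Ioo hp hj, fun N => ?_⟩
  have hJ : (JN N : Set ℕ) ⊆ J := hJN_union ▸ subset_iUnion (fun N => (JN N : Set ℕ)) N
  have hc' : IsComb (JN N) u h := ⟨fun j hj => hu_pos j (hJ hj), hu_inj.mono hJ,
    fun j hj => hh_pos j (hJ hj), fun δ _ => (JN N).finite_toSet.subset fun j hj => hj.1⟩
  have hp' := (hΘN N).isProper hc'
  have hasy' := (hΘN N).isEquivalent_boundaryExt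
  have hsum : ∀ (A : Finset ℕ) (G : Set ℕ), (A : Set ℕ) ⊆ JN N → (A : Set ℕ) ⊆ G → G ⊆ J →
      J \ (JN N : Set ℕ) ⊆ G →
      ∑ j ∈ A, ENNReal.ofReal
        ((boundaryExt (comparisonMap (ΘN N) Θ) (gapRight Θ (u j) (h j))).re -
          (boundaryExt (comparisonMap (ΘN N) Θ) (gapLeft Θ (u j) (h j))).re) ≤
        ∑' k : G, ENNReal.ofReal (gapRight Θ (u k) (h k) - gapLeft Θ (u k) (h k)) :=
    fun A G hA hAG hG hJG => (Finset.sum_le_sum fun j hj => ENNReal.ofReal_le_ofReal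
      (comparisonMap_gap_length_le hc hc' hp hp' hJ (hA hj))).trans
      (sum_gap_length_le hc hc' hp hp' hJ hasy hasy' hA hAG hG hJG)
  refine ⟨fun j => (boundaryExt (comparisonMap (ΘN N) Θ) (gapLeft Θ (u j) (h j))).re,
    fun j => (boundaryExt (comparisonMap (ΘN N) Θ) (gapRight Θ (u j) (h j))).re,
    fun j hj => ?_, fun j hj => gap_length_le hc hc' hp hp' hJ hasy hasy' hj, ?_, fun M hM => ?_⟩
  · have hlt := (hc.slitPreimage_eq_Ioo hp (hJ hj)).1.le
    have hlim := tendsto_boundaryExt_comparisonMap hp hp' (combDomain_anti hJ u h)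
    constructor
    · rw [HasRealBoundaryValue, ← boundaryExt_comparisonMap_eq_ofReal_of_mem_gap hc hp hp' hJ hj
        (left_mem_Icc.2 hlt)]
      exact hlim _
    · rw [HasRealBoundaryValue, ← boundaryExt_comparisonMap_eq_ofReal_of_mem_gap hc hp hp' hJ hj
        (right_mem_Icc.2 hlt)]
      exact hlim _
  · exact hsum (JN N) J subset_rfl hJ subset_rfl sdiff_subset
  · refine hsum _ {j | j ∈ J ∧ M ≤ j} (fun j hj => ?_) (fun j hj => ?_) (fun j hj => hj.1)
      fun j hj => ⟨hj.1, not_lt.1 fun hlt => hj.2 (hM j hj.1 hlt)⟩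
    · exact (Finset.mem_filter.1 hj).1
    · exact ⟨hJ (Finset.mem_filter.1 hj).1, (Finset.mem_filter.1 hj).2⟩
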